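/- **Conventions.** Let $A$ be a C*-algebra (not necessarily unital or separable) and let $\mathbb K$ be the compact operators on a separable infinite-dimensional Hilbert space; identify $A$ with $A\otimes e_{1,1}\subset A\otimes\mathbb K$. $\mathrm{Ped}(\cdot)$ denotes the Pedersen ideal (the smallest dense two-sided ideal), $\mathrm{Her}(e)$ the hereditary C*-subalgebra generated by $e$, and $x\lesssim y$ Cuntz subequivalence ($x=\lim_k z_k^*yz_k$ for some $z_k$). For $\varepsilon>0$ let $f_\varepsilon:\mathbb R\to[0,1]$ be $0$ on $(-\infty,\varepsilon]$, $1$ on $[2\varepsilon,\infty)$ and linear in between. Let $\mathbb N=\{1,2,\dots\}$. A quasitrace on a pre-C*-algebra $P$ is a map $\tau:P\to\mathbb C$ with $0\le\tau(x^*x)=\tau(xx^*)$ for all $x$, linear on commutative $*$-subalgebras, and $\tau(a+ib)=\tau(a)+i\tau(b)$ for self-adjoint $a,b$; it is a 2-quasitrace if it extends to a quasitrace on $M_2(P)$. $\widetilde{\mathrm{QT}}(A)$ is the cone of 2-quasitraces on $\mathrm{Ped}(A\otimes\mathbb K)$ with the topology of pointwise convergence; $\mathrm{QT}(A)$ is the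 set of those $\tau\in\widetilde{\mathrm{QT}}(A)$ with $\sup\{\tau(a):a\in\mathrm{Ped}(A)_+,\|a\|\le1\}=1$, and $S$ is the closure of $\mathrm{QT}(A)$ in $\widetilde{\mathrm{QT}}(A)$. For $a\in(A\otimes\mathbb K)_+$ put $$d_\tau(a)=\lim_n\tau(f_{1/n}(a))\in[0,\infty],\qquad \omega(a)=\lim_{n}\ \sup_{\tau\in S}\bigl(d_\tau(a)-\tau(f_{1/n}(a))\bigr)\in[0,\infty].$$ $\mathrm{Aff}_+(\widetilde{\mathrm{QT}}(A))$ consists of $0$ and of the continuous, additive, $[0,\infty)$-homogeneous functions $\widetilde{\mathrm{QT}}(A)\to\mathbb R$ that are strictly positive on $\widetilde{\mathrm{QT}}(A)\setminus\{0\}$; $\mathrm{LAff}_+(\widetilde{\mathrm{QT}}(A))$ consists of the pointwise limits, with values in $[0,\infty]$, of increasing sequences in $\mathrm{Aff}_+(\widetilde{\mathrm{QT}}(A))$. The canonical map $\Gamma:\mathrm{Cu}(A)\to\mathrm{LAff}_+(\widetilde{\mathrm{QT}}(A))$, $[a]\mapsto(\tau\mapsto d_\tau(a))$, is called *hereditary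 surjective* if for every $a\in(A\otimes\mathbb K)_+$ and every $f\in\mathrm{LAff}_+(\widetilde{\mathrm{QT}}(A))$ with $f(\tau)<d_\tau(a)$ for all $\tau\in\widetilde{\mathrm{QT}}(A)\setminus\{0\}$ there is $b\in(A\otimes\mathbb K)_+$ with $b\lesssim a$ and $d_\tau(b)=f(\tau)$ for all $\tau\in\widetilde{\mathrm{QT}}(A)$. **Theorem.** Let $A$ be an algebraically simple C*-algebra with $\mathrm{QT}(A)\ne\emptyset$. The following are equivalent. 1. $\Gamma$ is hereditary surjective. 2. For every $e\in(A\otimes\mathbb K)_+$ and every $h\in\mathrm{Aff}_+(\widetilde{\mathrm{QT}}(A))$ with $h(\tau)<d_\tau(e)$ for all $\tau\in\widetilde{\mathrm{QT}}(A)\setminus\{0\}$ there is $y\in(A\otimes\mathbb K)_+$ with $y\lesssim e$ and $d_\tau(y)=h(\tau)$ for all $\tau\in\widetilde{\mathrm{QT}}(A)$. 3. For every $e\in(A\otimes\mathbb K)_+$ and every $h\in\mathrm{LAff}_+(\widetilde{\mathrm{QT}}(A))$ with $h(\tau)<d_\tau(e)$ for all $\tau\in\widetilde{\mathrm{QT}}(A)\setminus\{0\}$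 there is $y\in(A\otimes\mathbb K)_+$ with $y\lesssim e$, $d_\tau(y)=h(\tau)$ for all $\tau\in\widetilde{\mathrm{QT}}(A)$, and $y=\sum_{n=1}^\infty y_n$ for a sequence of mutually orthogonal elements $y_n\in(A\otimes\mathbb K)_+$ with $\omega(y_n)=0$ and $\|y_n\|<1/2^n$ for all $n\in\mathbb N$. Moreover, for every $\varepsilon>0$ there is a sequence of mutually orthogonal elements $b_n\in\mathrm{Her}(e)_+$ such that $\omega(b_n)<\varepsilon/2^n$ for all $n\in\mathbb N$ and $\bigl|h(\tau)-\sum_{n=1}^\infty d_\tau(b_n)\bigr|<\varepsilon$ for all $\tau\in S$. -/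

import Mathlib

open Filter Topology
open scoped ENNReal NNReal

noncomputable section

namespace TracialCuntz

universe u

section Stabilization

/-- The upper left corner embedding `M_N(A) → M_m(A)`, `x ↦ diag(x, 0)` (used for `N ≤ m`). -/
def pad {A : Type u} [Zero A] (N m : ℕ) (x : CStarMatrix (Fin N) (Fin N) A) :
    CStarMatrix (Fin m) (Fin m) A :=
  CStarMatrix.ofMatrix fun i j =>
    if h : (i : ℕ) < N ∧ (j : ℕ) < N then x ⟨i, h.1⟩ ⟨j, h.2⟩ else 0

lemma pad_apply {A : Type u} [Zero A] (N m : ℕ) (x : CStarMatrix (Fin N) (Fin N) A)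
    (i j : Fin m) :
    pad N m x i j = if h : (i : ℕ) < N ∧ (j : ℕ) < N then x ⟨i, h.1⟩ ⟨j, h.2⟩ else 0 := rfl

lemma pad_pad {A : Type u} [Zero A] {N m k : ℕ} (h : N ≤ m)
    (x : CStarMatrix (Fin N) (Fin N) A) : pad m k (pad N m x) = pad N k x := by
  ext i j
  simp only [pad_apply]
  split_ifs <;> first | rfl | omega

lemma pad_self {A : Type u} [Zero A] {N : ℕ}
    (x : CStarMatrix (Fin N) (Fin N) A) : pad N N x = x := by
  ext i j
  simp [pad_apply]

lemma pad_mul {A : Type u} [NonUnitalSemiring A] {N m : ℕ} (h : N ≤ m)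
    (x y : CStarMatrix (Fin N) (Fin N) A) : pad N m (x * y) = pad N m x * pad N m y := by
  ext i j
  rw [CStarMatrix.mul_apply]
  obtain ⟨k, rfl⟩ := Nat.exists_eq_add_of_le h
  rw [Fin.sum_univ_add]
  simp only [pad_apply, CStarMatrix.mul_apply, Fin.val_castAdd, Fin.val_natAdd, Fin.is_lt]
  by_cases hi : (i : ℕ) < N <;> by_cases hj : (j : ℕ) < N <;> simp [hi, hj]

lemma pad_add {A : Type u} [AddZeroClass A] {N m : ℕ}
    (x y : CStarMatrix (Fin N) (Fin N) A) : pad N m (x + y) = pad N m x + pad N m y := by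
  ext i j
  simp only [pad_apply, CStarMatrix.add_apply]
  split_ifs <;> simp

variable (A : Type u) [NonUnitalCStarAlgebra A]

variable {A} in
/-- `pad` as an (injective) `*`-homomorphism. -/
def padHom {N m : ℕ} (h : N ≤ m) :
    CStarMatrix (Fin N) (Fin N) A →⋆ₙₐ[ℂ] CStarMatrix (Fin m) (Fin m) A where
  toFun := pad N m
  map_smul' c x := by
    ext i j
    simp only [pad_apply, CStarMatrix.smul_apply, MonoidHom.id_apply]
    split_ifs <;> simp
  map_zero' := by ext i j; simp [pad_apply]
  map_add' := pad_add
  map_mul' := pad_mul h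
  map_star' x := by
    ext i j
    simp only [pad_apply, CStarMatrix.star_apply]
    split_ifs <;> first | rfl | omega | simp

variable {A} in
lemma padHom_injective {N m : ℕ} (h : N ≤ m) : Function.Injective (padHom (A := A) h) := by
  intro x y hxy
  ext i j
  have := congrFun (congrFun hxy (Fin.castLE h i)) (Fin.castLE h j)
  simpa [padHom, pad_apply] using this

/-- The `*`-algebra of the sequences `(x_n)`, `x_n ∈ M_n(A)`, that are eventually constant along the
corner embeddings `M_n(A) ⊆ M_{n+1}(A)`.  Modulo the sequences that are eventually zero this
is the algebraic direct limit `M_∞(A)` of the `M_n(A)`. -/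
def evtlConst : NonUnitalStarSubalgebra ℂ ((n : ℕ) → CStarMatrix (Fin n) (Fin n) A) where
  carrier := {x | ∃ N, ∀ m, N ≤ m → x m = pad N m (x N)}
  zero_mem' := ⟨0, fun m hm => ((padHom (A := A) hm).map_zero).symm⟩
  add_mem' := by
    rintro x y ⟨N, hN⟩ ⟨M, hM⟩
    refine ⟨max N M, fun m hm => ?_⟩
    have h1 := hN _ (le_max_left N M)
    have h2 := hM _ (le_max_right N M)
    rw [Pi.add_apply, Pi.add_apply, pad_add, h1, h2, pad_pad (le_max_left N M),
      pad_pad (le_max_right N M), hN m (by omega), hM m (by omega)]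
  mul_mem' := by
    rintro x y ⟨N, hN⟩ ⟨M, hM⟩
    refine ⟨max N M, fun m hm => ?_⟩
    have h1 := hN _ (le_max_left N M)
    have h2 := hM _ (le_max_right N M)
    rw [Pi.mul_apply, Pi.mul_apply, pad_mul hm, h1, h2, pad_pad (le_max_left N M),
      pad_pad (le_max_right N M), hN m (by omega), hM m (by omega)]
  smul_mem' := by
    rintro c x ⟨N, hN⟩
    exact ⟨N, fun m hm => by
      rw [Pi.smul_apply, hN m hm, Pi.smul_apply]
      exact ((padHom (A := A) hm).map_smul c (x N)).symm⟩
  star_mem' := by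
    rintro x ⟨N, hN⟩
    exact ⟨N, fun m hm => by
      rw [Pi.star_apply, hN m hm, Pi.star_apply]
      exact (map_star (padHom (A := A) hm) (x N)).symm⟩

/-- `M_∞(A) = ⋃ M_n(A)`, to be completed to `A ⊗ 𝕂`. -/
def PreStab : Type u := evtlConst A

instance : NonUnitalRing (PreStab A) := inferInstanceAs (NonUnitalRing (evtlConst A))
instance : StarRing (PreStab A) := inferInstanceAs (StarRing (evtlConst A))
instance : Module ℂ (PreStab A) := inferInstanceAs (Module ℂ (evtlConst A))
instance : StarModule ℂ (PreStab A) := inferInstanceAs (StarModule ℂ (evtlConst A))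
instance : IsScalarTower ℂ (PreStab A) (PreStab A) :=
  ⟨fun c x y => Subtype.ext (funext fun n => CStarMatrix.smul_mul c (x.1 n) (y.1 n))⟩
instance : SMulCommClass ℂ (PreStab A) (PreStab A) :=
  ⟨fun c x y => Subtype.ext (funext fun n => (Matrix.mul_smul (x.1 n) c (y.1 n)).symm)⟩

variable {A} in
/-- The `n`-th term of the sequence that represents an element of `M_∞(A)`. -/
def PreStab.term (n : ℕ) : PreStab A →⋆ₙₐ[ℂ] CStarMatrix (Fin n) (Fin n) A where
  toFun x := x.1 n
  map_smul' _ _ := rfl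
  map_zero' := rfl
  map_add' _ _ := rfl
  map_mul' _ _ := rfl
  map_star' _ := rfl

variable [PartialOrder A] [StarOrderedRing A]

/-- The norm of `M_∞(A)`: the eventual value of the C⋆-norms on the `M_n(A)`. -/
instance : Norm (PreStab A) := ⟨fun x => limUnder atTop fun n => ‖PreStab.term n x‖⟩

variable {A} in
lemma PreStab.exists_norm (x : PreStab A) : ∃ N, ∀ m, N ≤ m → ‖x‖ = ‖PreStab.term m x‖ := by
  obtain ⟨N, hN⟩ := x.2
  have key : ∀ m, N ≤ m → ‖PreStab.term m x‖ = ‖PreStab.term N x‖ := fun m hm => by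
    have : PreStab.term m x = padHom hm (PreStab.term N x) := hN m hm
    rw [this]
    exact NonUnitalStarAlgHom.norm_map (padHom (A := A) hm) (padHom_injective hm) _
  refine ⟨N, fun m hm => ?_⟩
  rw [key m hm]
  refine Tendsto.limUnder_eq (tendsto_const_nhds.congr' ?_)
  filter_upwards [eventually_ge_atTop N] with m hm using (key m hm).symm

variable {A} in
lemma PreStab.exists_norm₃ (x y z : PreStab A) : ∃ m, ‖x‖ = ‖PreStab.term m x‖ ∧
    ‖y‖ = ‖PreStab.term m y‖ ∧ ‖z‖ = ‖PreStab.term m z‖ := by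
  obtain ⟨N, hN⟩ := PreStab.exists_norm x
  obtain ⟨M, hM⟩ := PreStab.exists_norm y
  obtain ⟨K, hK⟩ := PreStab.exists_norm z
  exact ⟨max N (max M K), hN _ (by omega), hM _ (by omega), hK _ (by omega)⟩

instance : SeminormedAddCommGroup (PreStab A) :=
  AddGroupSeminorm.toSeminormedAddCommGroup
    { toFun := fun x => ‖x‖
      map_zero' := by
        obtain ⟨m, h, -⟩ := PreStab.exists_norm₃ (0 : PreStab A) 0 0
        rw [h, map_zero, norm_zero]
      add_le' := fun x y => by
        obtain ⟨m, h1, h2, h3⟩ := PreStab.exists_norm₃ x y (x + y)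
        rw [h1, h2, h3, map_add]
        exact norm_add_le _ _
      neg' := fun x => by
        obtain ⟨m, h1, h2, -⟩ := PreStab.exists_norm₃ x (-x) 0
        rw [h1, h2, map_neg, norm_neg] }

instance : NonUnitalSeminormedRing (PreStab A) where
  __ := (inferInstance : SeminormedAddCommGroup (PreStab A))
  __ := (inferInstance : NonUnitalRing (PreStab A))
  norm_mul_le x y := by
    obtain ⟨m, h1, h2, h3⟩ := PreStab.exists_norm₃ x y (x * y)
    rw [h1, h2, h3, map_mul]
    exact norm_mul_le _ _

instance : NormedSpace ℂ (PreStab A) where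
  norm_smul_le c x := by
    obtain ⟨m, h1, h2, -⟩ := PreStab.exists_norm₃ x (c • x) 0
    rw [h1, h2, map_smul]
    exact norm_smul_le _ _

instance : NormedStarGroup (PreStab A) where
  norm_star_le x := by
    obtain ⟨m, h1, h2, -⟩ := PreStab.exists_norm₃ x (star x) 0
    rw [h1, h2, map_star, norm_star]

variable {A} in
lemma PreStab.norm_star_mul_self (x : PreStab A) : ‖star x * x‖ = ‖x‖ * ‖x‖ := by
  obtain ⟨m, h1, h2, -⟩ := PreStab.exists_norm₃ x (star x * x) 0
  rw [h1, h2, map_mul, map_star, CStarRing.norm_star_mul_self]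

/-- The stabilization `A ⊗ 𝕂`, as the C⋆-algebra completion of `M_∞(A)`. -/
def Stab : Type u := UniformSpace.Completion (PreStab A)

namespace Stab

open UniformSpace

instance : NormedAddCommGroup (Stab A) :=
  inferInstanceAs (NormedAddCommGroup (Completion (PreStab A)))
instance : SMul ℂ (Stab A) := inferInstanceAs (SMul ℂ (Completion (PreStab A)))
instance : CompleteSpace (Stab A) := inferInstanceAs (CompleteSpace (Completion (PreStab A)))

variable {A} in
/-- The canonical map `M_∞(A) → A ⊗ 𝕂`. -/
def of (x : PreStab A) : Stab A := (x : Completion (PreStab A))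

variable {A}

lemma of_add (x y : PreStab A) : of (x + y) = of x + of y := Completion.coe_add x y
lemma of_zero : of (0 : PreStab A) = 0 := rfl
lemma of_smul (c : ℂ) (x : PreStab A) : of (c • x) = c • of x := Completion.coe_smul c x
lemma norm_of (x : PreStab A) : ‖of x‖ = ‖x‖ := Completion.norm_coe x
lemma continuous_of : Continuous (of : PreStab A → Stab A) := Completion.continuous_coe _
lemma denseRange_of : DenseRange (of : PreStab A → Stab A) := Completion.denseRange_coe
lemma isDenseInducing_of : IsDenseInducing (of : PreStab A → Stab A) :=
  Completion.isDenseInducing_coe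

/-- Multiplication and involution of `A ⊗ 𝕂` extend those of `M_∞(A)` by continuity. -/
instance : Mul (Stab A) :=
  ⟨Function.curry ((isDenseInducing_of.prodMap isDenseInducing_of).extend
    fun p : PreStab A × PreStab A => of (p.1 * p.2))⟩

instance : Star (Stab A) := ⟨Completion.map (star : PreStab A → PreStab A)⟩

lemma of_mul (x y : PreStab A) : of (x * y) = of x * of y :=
  ((isDenseInducing_of.prodMap isDenseInducing_of).extend_eq
    (continuous_of.comp (continuous_mul (M := PreStab A))) (x, y)).symm

lemma of_star (x : PreStab A) : of (star x) = star (of x) :=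
  (Completion.map_coe star_isometry.uniformContinuous x).symm

instance : ContinuousMul (Stab A) where
  continuous_mul := by
    let i : PreStab A →+ Stab A := ⟨⟨of, of_zero⟩, of_add⟩
    let m : PreStab A →+ PreStab A →+ Stab A :=
      (AddMonoidHom.mul : PreStab A →+ PreStab A →+ PreStab A).compr₂ i
    have hm : Continuous fun p : PreStab A × PreStab A => m p.1 p.2 :=
      continuous_of.comp continuous_mul
    have di : IsDenseInducing (i : PreStab A → Stab A) := isDenseInducing_of
    exact (di.extend_Z_bilin di hm :)

instance : ContinuousStar (Stab A) := ⟨Completion.continuous_map⟩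

lemma induction₁ {p : Stab A → Prop} (a : Stab A) (hp : IsClosed {a | p a})
    (h : ∀ x, p (of x)) : p a := Completion.induction_on a hp h

lemma induction₂ {p : Stab A → Stab A → Prop} (a b : Stab A)
    (hp : IsClosed {x : Stab A × Stab A | p x.1 x.2})
    (h : ∀ x y, p (of x) (of y)) : p a b := Completion.induction_on₂ a b hp h

lemma induction₃ {p : Stab A → Stab A → Stab A → Prop} (a b c : Stab A)
    (hp : IsClosed {x : Stab A × Stab A × Stab A | p x.1 x.2.1 x.2.2})
    (h : ∀ x y z, p (of x) (of y) (of z)) : p a b c := Completion.induction_on₃ a b c hp h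

instance : NonUnitalRing (Stab A) where
  __ := (inferInstance : AddCommGroup (Stab A))
  zero_mul a := by
    refine induction₁ (p := fun a => 0 * a = 0) a
      (isClosed_eq (by fun_prop) (by fun_prop)) fun x => ?_
    rw [← of_zero, ← of_mul, zero_mul]
  mul_zero a := by
    refine induction₁ (p := fun a => a * 0 = 0) a
      (isClosed_eq (by fun_prop) (by fun_prop)) fun x => ?_
    rw [← of_zero, ← of_mul, mul_zero]
  mul_assoc a b c := by
    refine induction₃ (p := fun a b c => a * b * c = a * (b * c)) a b c
      (isClosed_eq (by fun_prop) (by fun_prop)) fun x y z => ?_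
    simp only [← of_mul, mul_assoc]
  left_distrib a b c := by
    refine induction₃ (p := fun a b c => a * (b + c) = a * b + a * c) a b c
      (isClosed_eq (by fun_prop) (by fun_prop)) fun x y z => ?_
    simp only [← of_mul, ← of_add, mul_add]
  right_distrib a b c := by
    refine induction₃ (p := fun a b c => (a + b) * c = a * c + b * c) a b c
      (isClosed_eq (by fun_prop) (by fun_prop)) fun x y z => ?_
    simp only [← of_mul, ← of_add, add_mul]

instance : NonUnitalNormedRing (Stab A) where
  __ := (inferInstance : NormedAddCommGroup (Stab A))
  __ := (inferInstance : NonUnitalRing (Stab A))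
  norm_mul_le a b := by
    refine induction₂ (p := fun a b => ‖a * b‖ ≤ ‖a‖ * ‖b‖) a b
      (isClosed_le (by fun_prop) (by fun_prop)) fun x y => ?_
    simpa only [← of_mul, norm_of] using norm_mul_le x y

instance : Module ℂ (Stab A) where
  one_smul a := @one_smul ℂ (Completion (PreStab A)) _ _ a
  mul_smul c d a := @mul_smul ℂ (Completion (PreStab A)) _ _ c d a
  smul_zero c := @smul_zero ℂ (Completion (PreStab A)) _ _ c
  smul_add c a b := @smul_add ℂ (Completion (PreStab A)) _ _ c a b
  add_smul c d a := @add_smul ℂ (Completion (PreStab A)) _ _ _ c d a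
  zero_smul a := @zero_smul ℂ (Completion (PreStab A)) _ _ _ a

instance : NormedSpace ℂ (Stab A) where
  norm_smul_le c a := @norm_smul_le ℂ (Completion (PreStab A)) _ _ _ _ c a

instance : StarRing (Stab A) where
  star_involutive a := by
    refine induction₁ (p := fun a => star (star a) = a) a
      (isClosed_eq (by fun_prop) (by fun_prop)) fun x => ?_
    simp only [← of_star, star_star]
  star_mul a b := by
    refine induction₂ (p := fun a b => star (a * b) = star b * star a) a b
      (isClosed_eq (by fun_prop) (by fun_prop)) fun x y => ?_
    simp only [← of_star, ← of_mul, star_mul]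
  star_add a b := by
    refine induction₂ (p := fun a b => star (a + b) = star a + star b) a b
      (isClosed_eq (by fun_prop) (by fun_prop)) fun x y => ?_
    simp only [← of_star, ← of_add, star_add]

instance : CStarRing (Stab A) where
  norm_mul_self_le a := by
    refine induction₁ (p := fun a => ‖a‖ * ‖a‖ ≤ ‖star a * a‖) a
      (isClosed_le (by fun_prop) (by fun_prop)) fun x => ?_
    simp only [← of_star, ← of_mul, norm_of, PreStab.norm_star_mul_self, le_refl]

instance : IsScalarTower ℂ (Stab A) (Stab A) where
  smul_assoc c a b := by
    refine induction₂ (p := fun a b => (c • a) * b = c • (a * b)) a b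
      (isClosed_eq ((continuous_fst.const_smul c).mul continuous_snd)
        ((continuous_fst.mul continuous_snd).const_smul c)) fun x y => ?_
    rw [← of_smul, ← of_mul, ← of_mul, ← of_smul, smul_mul_assoc]

instance : SMulCommClass ℂ (Stab A) (Stab A) where
  smul_comm c a b := by
    refine induction₂ (p := fun a b => c • (a * b) = a * (c • b)) a b
      (isClosed_eq ((continuous_fst.mul continuous_snd).const_smul c)
        (continuous_fst.mul (continuous_snd.const_smul c))) fun x y => ?_
    rw [← of_smul, ← of_mul, ← of_mul, ← of_smul, mul_smul_comm]

instance : StarModule ℂ (Stab A) where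
  star_smul c a := by
    refine induction₁ (p := fun a => star (c • a) = star c • star a) a
      (isClosed_eq (continuous_id.const_smul c).star (continuous_star.const_smul (star c)))
      fun x => ?_
    rw [← of_smul, ← of_star, ← of_star, ← of_smul, star_smul]

instance : NonUnitalCStarAlgebra (Stab A) where

/-- The usual order of a C⋆-algebra: `0 ≤ x` iff `x` is positive. -/
instance : PartialOrder (Stab A) := CStarAlgebra.spectralOrder (Stab A)
instance : StarOrderedRing (Stab A) := CStarAlgebra.spectralOrderedRing (Stab A)

/-- `a ⊗ e_{1,1}` as an element of `M_∞(A)`. -/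
def preCorner (a : A) : PreStab A :=
  ⟨fun n => pad 1 n (CStarMatrix.ofMatrix (Matrix.of fun _ _ => a)),
    1, fun m _ => congrArg (pad 1 m) (pad_self _).symm⟩

/-- The identification `a ↦ a ⊗ e_{1,1}` of `A` with a corner of `A ⊗ 𝕂`. -/
def corner : A →⋆ₙₐ[ℂ] Stab A where
  toFun a := of (preCorner a)
  map_smul' c a := by
    rw [MonoidHom.id_apply, ← of_smul]
    refine congrArg of (Subtype.ext (funext fun n => ?_))
    ext i j
    change (if h : (i : ℕ) < 1 ∧ (j : ℕ) < 1 then c • a else 0) =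
      c • (if h : (i : ℕ) < 1 ∧ (j : ℕ) < 1 then a else 0)
    split_ifs <;> simp
  map_zero' := by
    rw [← of_zero]
    refine congrArg of (Subtype.ext (funext fun n => ?_))
    ext i j
    change (if h : (i : ℕ) < 1 ∧ (j : ℕ) < 1 then (0 : A) else 0) = 0
    split_ifs <;> rfl
  map_add' a b := by
    rw [← of_add]
    refine congrArg of (Subtype.ext (funext fun n => ?_))
    exact pad_add (CStarMatrix.ofMatrix (Matrix.of fun _ _ => a))
      (CStarMatrix.ofMatrix (Matrix.of fun _ _ => b))
  map_mul' a b := by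
    rw [← of_mul]
    refine congrArg of (Subtype.ext (funext fun n => ?_))
    rcases n with _ | n
    · exact funext fun i => i.elim0
    · refine Eq.trans (congrArg (pad 1 (n + 1)) ?_) (pad_mul (Nat.le_add_left 1 n)
        (CStarMatrix.ofMatrix (Matrix.of fun _ _ => a))
        (CStarMatrix.ofMatrix (Matrix.of fun _ _ => b)))
      ext i j
      rw [CStarMatrix.mul_apply, Fin.sum_univ_one]
      rfl
  map_star' a := by
    rw [← of_star]
    refine congrArg of (Subtype.ext (funext fun n => ?_))
    ext i j
    change (if h : (i : ℕ) < 1 ∧ (j : ℕ) < 1 then star a else 0) =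
      star (if h : (j : ℕ) < 1 ∧ (i : ℕ) < 1 then a else 0)
    split_ifs <;> first | rfl | omega | simp

end Stab

end Stabilization

section Quasitraces

open scoped ComplexOrder

section General

variable {B : Type u} [NonUnitalCStarAlgebra B]

/-- Algebraic (not necessarily closed) two-sided ideals of a C⋆-algebra. -/
def IsAlgIdeal (I : Submodule ℂ B) : Prop :=
  ∀ b : B, ∀ x ∈ I, b * x ∈ I ∧ x * b ∈ I

/-- The ideal `I^* = {x | x^* ∈ I}`. -/
def starIdeal (I : Submodule ℂ B) : Submodule ℂ B where
  carrier := {x | star x ∈ I}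
  zero_mem' := by simp
  add_mem' {x y} hx hy := by
    simp only [Set.mem_ofPred_eq, star_add] at *
    exact I.add_mem hx hy
  smul_mem' c x hx := by
    simp only [Set.mem_ofPred_eq, star_smul] at *
    exact I.smul_mem _ hx

variable (B) in
/-- The Pedersen ideal: the smallest dense ideal of a C⋆-algebra, i.e. the intersection of all
dense ideals. -/
def Ped : NonUnitalStarSubalgebra ℂ B where
  carrier := {x | ∀ I : Submodule ℂ B, IsAlgIdeal I → Dense (I : Set B) → x ∈ I}
  zero_mem' I _ _ := I.zero_mem
  add_mem' hx hy I h h' := I.add_mem (hx I h h') (hy I h h')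
  smul_mem' c _ hx I h h' := I.smul_mem c (hx I h h')
  mul_mem' {x _} _ hy I h h' := (h x _ (hy I h h')).1
  star_mem' {x} hx I h h' := by
    refine hx (starIdeal I) (fun b y hy => ?_) ?_
    · have hy' : star y ∈ I := hy
      exact ⟨show star (b * y) ∈ I by rw [star_mul]; exact (h _ _ hy').2,
        show star (y * b) ∈ I by rw [star_mul]; exact (h _ _ hy').1⟩
    · exact h'.preimage (Homeomorph.mk (Equiv.mk (star : B → B) star star_star star_star)
        continuous_star continuous_star).isOpenMap

/-- Cuntz subequivalence `a ≲ b`. -/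
def CuntzLE (a b : B) : Prop :=
  ∃ x : ℕ → B, Tendsto (fun k => star (x k) * b * x k) atTop (𝓝 a)

/-- `Her(a)`, the hereditary C⋆-subalgebra generated by `a`. -/
def Her [PartialOrder B] (a : B) : Set B :=
  {x | ∀ C : NonUnitalStarSubalgebra ℂ B, IsClosed (C : Set B) →
    (∀ y z : B, 0 ≤ y → y ≤ z → z ∈ C → y ∈ C) → a ∈ C → x ∈ C}

/-- The function `f_ε`: it is `0` on `(-∞, ε]`, `1` on `[2ε, ∞)` and linear on `[ε, 2ε]`. -/
def fEps (ε t : ℝ) : ℝ := max 0 (min 1 (t / ε - 1))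

lemma continuous_fEps (ε : ℝ) : Continuous (fEps ε) := by
  unfold fEps
  fun_prop

lemma fEps_zero (ε : ℝ) : fEps ε 0 = 0 := by simp [fEps]

lemma fEps_mul_half {ε : ℝ} (hε : 0 < ε) (t : ℝ) : fEps ε t * fEps (ε / 2) t = fEps ε t := by
  unfold fEps
  rcases le_total t ε with h | h
  · have : t / ε - 1 ≤ 0 := by
      have := (div_le_one hε).2 h
      linarith
    rw [max_eq_left ((min_le_right _ _).trans this), zero_mul]
  · have : 1 ≤ t / (ε / 2) - 1 := by
      have : 2 ≤ t / (ε / 2) := by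
        rw [le_div_iff₀ (by positivity)]
        linarith
      linarith
    rw [min_eq_left this, max_eq_right zero_le_one, mul_one]

/-- `f_ε(a)` lies in the Pedersen ideal. -/
lemma fEps_mem_ped (a : B) {ε : ℝ} (hε : 0 < ε) : cfcₙ (fEps ε) a ∈ Ped B := by
  intro I hI hd
  set f := cfcₙ (fEps ε) a with hf
  set k := cfcₙ (fEps (ε / 2)) a with hk
  have hfk : f * k = f := by
    rw [hf, hk, ← cfcₙ_mul (fEps ε) (fEps (ε / 2)) a (continuous_fEps _).continuousOn
      (fEps_zero _) (continuous_fEps _).continuousOn (fEps_zero _)]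
    simp only [fEps_mul_half hε]
  obtain ⟨x, hx, hxI⟩ := Metric.dense_iff.1 hd k 1 one_pos
  rw [Metric.mem_ball, dist_eq_norm, ← norm_neg, neg_sub] at hx
  have hd1 : ‖((k - x : B) : Unitization ℂ B)‖ < 1 := by
    rwa [Unitization.norm_inr]
  set u := (Units.oneSub ((k - x : B) : Unitization ℂ B) hd1) with hu
  set v : Unitization ℂ B := ↑u⁻¹ with hv
  have h1 : (1 - ((k - x : B) : Unitization ℂ B)) * v = 1 := u.mul_inv
  have h2 : (f : Unitization ℂ B) = ((f * x : B) : Unitization ℂ B) * v := by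
    have h3 : (f : Unitization ℂ B) * (1 - ((k - x : B) : Unitization ℂ B)) =
        ((f * x : B) : Unitization ℂ B) := by
      rw [mul_sub, mul_one, ← Unitization.inr_mul, mul_sub, hfk, ← Unitization.inr_sub]
      congr 1
      abel
    rw [← h3, mul_assoc, h1, mul_one]
  have h4 : f = v.fst • (f * x) + (f * x) * v.snd := by
    have := congrArg (fun w : Unitization ℂ B => w.snd) h2
    simpa [Unitization.snd_mul] using this
  have h5 : f * x ∈ I := (hI f x hxI).1
  rw [h4]
  exact I.add_mem (I.smul_mem _ h5) (hI _ _ h5).2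

end General

section PreCStar

variable {P : Type u} [NonUnitalRing P] [StarRing P] [Module ℂ P]

/-- Quasitraces on a pre-C⋆-algebra `P`. -/
structure IsQuasitrace (τ : P → ℂ) : Prop where
  nonneg : ∀ x : P, 0 ≤ τ (star x * x)
  tracial : ∀ x : P, τ (star x * x) = τ (x * star x)
  linear_of_comm : ∀ C : NonUnitalStarSubalgebra ℂ P, (∀ x ∈ C, ∀ y ∈ C, x * y = y * x) →
    (∀ x ∈ C, ∀ y ∈ C, τ (x + y) = τ x + τ y) ∧ ∀ (c : ℂ), ∀ x ∈ C, τ (c • x) = c * τ x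
  add_I_smul : ∀ a b : P, IsSelfAdjoint a → IsSelfAdjoint b →
    τ (a + Complex.I • b) = τ a + Complex.I * τ b

/-- 2-quasitraces: quasitraces on `P` that extend to a quasitrace on `M_2(P)`, where `P` is
embedded in the upper left corner. -/
def IsTwoQuasitrace (τ : P → ℂ) : Prop :=
  IsQuasitrace τ ∧ ∃ σ : CStarMatrix (Fin 2) (Fin 2) P → ℂ, IsQuasitrace σ ∧
    ∀ x : P, σ (CStarMatrix.ofMatrix !![x, 0; 0, 0]) = τ x

lemma IsQuasitrace.zero : IsQuasitrace (fun _ : P => (0 : ℂ)) where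
  nonneg _ := le_rfl
  tracial _ := rfl
  linear_of_comm _ _ := ⟨by simp, by simp⟩
  add_I_smul _ _ _ _ := by simp

lemma IsQuasitrace.add {τ σ : P → ℂ} (hτ : IsQuasitrace τ) (hσ : IsQuasitrace σ) :
    IsQuasitrace (fun x => τ x + σ x) where
  nonneg x := add_nonneg (hτ.nonneg x) (hσ.nonneg x)
  tracial x := by rw [hτ.tracial, hσ.tracial]
  linear_of_comm C hC := by
    obtain ⟨h1, h2⟩ := hτ.linear_of_comm C hC
    obtain ⟨h3, h4⟩ := hσ.linear_of_comm C hC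
    refine ⟨fun x hx y hy => ?_, fun c x hx => ?_⟩
    · rw [h1 x hx y hy, h3 x hx y hy]; ring
    · rw [h2 c x hx, h4 c x hx]; ring
  add_I_smul a b ha hb := by rw [hτ.add_I_smul a b ha hb, hσ.add_I_smul a b ha hb]; ring

lemma IsQuasitrace.smul {τ : P → ℂ} (hτ : IsQuasitrace τ) (s : ℝ≥0) :
    IsQuasitrace (fun x => ((s : ℝ) : ℂ) * τ x) where
  nonneg x := mul_nonneg (by exact_mod_cast s.2) (hτ.nonneg x)
  tracial x := by rw [hτ.tracial]
  linear_of_comm C hC := by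
    obtain ⟨h1, h2⟩ := hτ.linear_of_comm C hC
    refine ⟨fun x hx y hy => ?_, fun c x hx => ?_⟩
    · rw [h1 x hx y hy]; ring
    · rw [h2 c x hx]; ring
  add_I_smul a b ha hb := by rw [hτ.add_I_smul a b ha hb]; ring

end PreCStar

variable (A : Type u) [NonUnitalCStarAlgebra A] [PartialOrder A] [StarOrderedRing A]

/-- The cone `Q̃T(A)` of densely defined 2-quasitraces on `A ⊗ 𝕂`, i.e. 2-quasitraces defined on
the Pedersen ideal of `A ⊗ 𝕂`. -/
@[ext]
structure DQT where
  toFun : Ped (Stab A) → ℂ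
  isTwoQuasitrace : IsTwoQuasitrace toFun

variable {A} in
/-- `Ped(A) ⊗ e_{1,1} ⊆ Ped(A ⊗ 𝕂)`. -/
lemma corner_mem_ped {a : A} (ha : a ∈ Ped A) : Stab.corner a ∈ Ped (Stab A) := by
  intro I hI hd
  let φ : A →ₗ[ℂ] Stab A :=
    { toFun := Stab.corner
      map_add' := map_add Stab.corner
      map_smul' := map_smul Stab.corner }
  have hJ : IsAlgIdeal (I.comap φ) := fun b x hx =>
    ⟨show Stab.corner (b * x) ∈ I by rw [map_mul]; exact (hI _ _ hx).1,
      show Stab.corner (x * b) ∈ I by rw [map_mul]; exact (hI _ _ hx).2⟩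
  refine ha (I.comap φ) hJ ?_
  rw [Submodule.dense_iff_topologicalClosure_eq_top, ← top_le_iff,
    ← CStarAlgebra.span_nonneg, Submodule.span_le]
  intro b hb
  have hb0 : 0 ≤ b := hb
  rw [SetLike.mem_coe, ← SetLike.mem_coe, Submodule.topologicalClosure_coe, Metric.mem_closure_iff]
  intro δ hδ
  refine ⟨b * cfcₙ (fEps (δ / 3)) b, ?_, ?_⟩
  · show Stab.corner (b * cfcₙ (fEps (δ / 3)) b) ∈ I
    rw [map_mul, NonUnitalStarAlgHomClass.map_cfcₙ Stab.corner (fEps (δ / 3)) b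
      (continuous_fEps _).continuousOn (fEps_zero _)
      (AddMonoidHomClass.continuous_of_bound Stab.corner 1 fun x => by
        simpa using NonUnitalStarAlgHom.norm_apply_le Stab.corner x)
      hb0.isSelfAdjoint (hb0.isSelfAdjoint.map Stab.corner)]
    exact (hI _ _ (fEps_mem_ped _ (by positivity) I hI hd)).1
  · have h1 : b - b * cfcₙ (fEps (δ / 3)) b = cfcₙ (fun t => t - t * fEps (δ / 3) t) b := by
      rw [cfcₙ_sub (fun t => t) (fun t => t * fEps (δ / 3) t) b (by fun_prop) rfl
        (continuous_id.mul (continuous_fEps _)).continuousOn (by simp),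
        cfcₙ_mul (fun t => t) (fEps (δ / 3)) b (by fun_prop) rfl
        (continuous_fEps _).continuousOn (fEps_zero _), cfcₙ_id' ℝ b hb0.isSelfAdjoint]
    rw [dist_eq_norm, h1]
    refine lt_of_le_of_lt (norm_cfcₙ_le (c := 2 * (δ / 3)) fun t ht => ?_) (by linarith)
    have ht0 : 0 ≤ t := quasispectrum_nonneg_of_nonneg b hb0 t ht
    have hf0 : 0 ≤ fEps (δ / 3) t := le_max_left _ _
    have hf1 : fEps (δ / 3) t ≤ 1 := max_le zero_le_one (min_le_left _ _)
    rw [Real.norm_eq_abs, abs_of_nonneg (by nlinarith)]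
    rcases le_total t (2 * (δ / 3)) with h | h
    · nlinarith
    · have : fEps (δ / 3) t = 1 := by
        have : 1 ≤ t / (δ / 3) - 1 := by
          have : 2 ≤ t / (δ / 3) := by
            rw [le_div_iff₀ (by positivity)]
            linarith
          linarith
        rw [fEps, min_eq_left this, max_eq_right zero_le_one]
      rw [this]
      linarith

namespace DQT

variable {A}

instance : CoeFun (DQT A) (fun _ => Ped (Stab A) → ℂ) := ⟨DQT.toFun⟩

/-- The topology of pointwise convergence on `Ped(A ⊗ 𝕂)`. -/
instance : TopologicalSpace (DQT A) := TopologicalSpace.induced DQT.toFun inferInstance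

instance : Zero (DQT A) :=
  ⟨⟨fun _ => 0, IsQuasitrace.zero, fun _ => 0, IsQuasitrace.zero, fun _ => rfl⟩⟩

instance : Add (DQT A) :=
  ⟨fun τ σ => ⟨fun x => τ x + σ x, τ.2.1.add σ.2.1, by
    obtain ⟨-, τ', h1, h2⟩ := τ.2
    obtain ⟨-, σ', h3, h4⟩ := σ.2
    exact ⟨fun x => τ' x + σ' x, h1.add h3, fun x => congrArg₂ (· + ·) (h2 x) (h4 x)⟩⟩⟩

instance : SMul ℝ≥0 (DQT A) :=
  ⟨fun s τ => ⟨fun x => ((s : ℝ) : ℂ) * τ x, τ.2.1.smul s, by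
    obtain ⟨-, τ', h1, h2⟩ := τ.2
    exact ⟨fun x => ((s : ℝ) : ℂ) * τ' x, h1.smul s, fun x => congrArg (((s : ℝ) : ℂ) * ·) (h2 x)⟩⟩⟩

/-- `τ(f_{1/(n+1)}(a))`, a non-negative real number if `a ≥ 0`. -/
def cut (τ : DQT A) (n : ℕ) (a : Stab A) : ℝ≥0∞ :=
  ENNReal.ofReal (τ ⟨cfcₙ (fEps (1 / (n + 1))) a, fEps_mem_ped a Nat.one_div_pos_of_nat⟩).re

/-- `d_τ(a) = lim_n τ(f_{1/n}(a))` for `a ≥ 0`; the sequence is increasing. -/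
def d (τ : DQT A) (a : Stab A) : ℝ≥0∞ := ⨆ n : ℕ, τ.cut n a

end DQT

/-- `QT(A)`: those `τ` in `Q̃T(A)` with `sup {τ(a ⊗ e_{1,1}) | a ∈ Ped(A)_+, ‖a‖ ≤ 1} = 1`. -/
def QT : Set (DQT A) :=
  {τ | IsLUB {r : ℝ | ∃ (a : A) (ha : a ∈ Ped A), 0 ≤ a ∧ ‖a‖ ≤ 1 ∧
    r = (τ ⟨Stab.corner a, corner_mem_ped ha⟩).re} 1}

variable {A}

/-- The tracial oscillation `ω(a)` of `a ∈ (A ⊗ 𝕂)_+`: the limit over `n` of the (decreasing)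
suprema over the closure of `QT(A)` of `d_τ(a) - τ(f_{1/n}(a))`. -/
def omega (a : Stab A) : ℝ≥0∞ :=
  ⨅ n : ℕ, ⨆ τ ∈ closure (QT A), (τ.d a - τ.cut n a)

/-- `Aff(Q̃T(A))`. -/
structure IsAff (f : DQT A → ℝ) : Prop where
  continuous : Continuous f
  map_smul : ∀ (s : ℝ≥0) (τ : DQT A), f (s • τ) = s * f τ
  map_add : ∀ τ σ : DQT A, f (τ + σ) = f τ + f σ

/-- `Aff_+(Q̃T(A))`: the strictly positive functions in `Aff(Q̃T(A))`, and `0`. -/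
def IsAffPos (f : DQT A → ℝ) : Prop :=
  IsAff f ∧ ((∀ τ : DQT A, τ ≠ 0 → 0 < f τ) ∨ f = 0)

/-- `LAff_+(Q̃T(A))`: the pointwise limits in `[0, ∞]` of increasing sequences in
`Aff_+(Q̃T(A))`. -/
def IsLAffPos (f : DQT A → ℝ≥0∞) : Prop :=
  ∃ g : ℕ → DQT A → ℝ, (∀ n, IsAffPos (g n)) ∧ (∀ n τ, g n τ ≤ g (n + 1) τ) ∧
    ∀ τ, Tendsto (fun n => ENNReal.ofReal (g n τ)) atTop (𝓝 (f τ))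

variable (A) in
/-- The canonical map `Γ : Cu(A) → LAff_+(Q̃T(A))`, `[a] ↦ (τ ↦ d_τ(a))`, is hereditary
surjective. -/
def GammaHereditarySurjective : Prop :=
  ∀ a : Stab A, 0 ≤ a → ∀ f : DQT A → ℝ≥0∞, IsLAffPos f →
    (∀ τ : DQT A, τ ≠ 0 → f τ < τ.d a) →
    ∃ b : Stab A, 0 ≤ b ∧ CuntzLE b a ∧ ∀ τ : DQT A, τ.d b = f τ

end Quasitraces

end TracialCuntz

end

open TracialCuntz

set_option linter.unusedSectionVars false

/-! The third statement contains hereditary surjectivity, which contains the realization of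
functions in `Aff₊` (`RealizesAff`). The content is the way back from `RealizesAff` to orthogonal
decompositions. A realizing element is only Cuntz below `e`; to continue with what is left of `e`,
one needs `y` inside `Her e` together with an orthogonal `V` in `Her e` such that `d(e) ≤ d(y) +
d(V)`.

This is `RealizesAff.exists_split`. Cut-downs of a realizing element, moved into `Her e`, give `ζ₀`
with a unit `ζ` such that `d_τ(ζ) ≤ k(τ) ≤ τ(ζ₀) + ητ(f)`. From this pair one builds increasing
inner and decreasing outer elements, every outer one a unit for every inner one, whose gap contracts
by the factor 9/10 in each step (`UnitPair.exists_step`); the step applies `RealizesAff` to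
differences of outer and inner elements. The weighted sum `y` of the inner elements has `d_τ(y)`
equal to the common limit of the values, which is continuous because the convergence is locally
uniform. The compressions of `e` by `1 - outer` sum to `V`. Repeating this with `V` in place of `e`
exhausts an increasing sequence of continuous functions with limit `h`
(`RealizesAff.exists_orthogonal_of_pos`). Continuity of `d(y)` forces `ω(y) = 0` by a Dini argument
(`omega_eq_zero`).

Quasitraces are additive only on commuting elements, so values are compared through common units and
through the dimension function, which is Cuntz-monotone, subadditive, and additive on orthogonal
elements. These facts rest on a factorization (`exists_factor_of_le`): if `0 ≤ x ≤ T⋆T`, then `x =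
G⋆G` where every left unit of `T` is a left unit of `G`. Simplicity enters through `IsScale`: a
positive contraction `f` of the Pedersen ideal that is a unit for some non-zero element bounds all
quasitraces, so `{τ | τ(f) = 1}` is compact and Dini arguments give estimates that hold for all `τ`
up to `ητ(f)`. -/

namespace TracialCuntz

universe u

/-! ### Functional calculus on eigenvectors. -/

section Eigenvectors

variable {B : Type*} [NonUnitalCStarAlgebra B]

/-- Functional calculus acts by scalars on eigenvectors. -/
lemma cfcₙ_mul_eq_smul {a y : B} {c : ℝ} (ha : IsSelfAdjoint a)
    (h : a * y = (c : ℂ) • y) {f : ℝ → ℝ} (hf : Continuous f) (hf0 : f 0 = 0) :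
    cfcₙ f a * y = (f c : ℂ) • y := by
  -- The pairs `(b, z)` for which `b` and `b⋆` act on `y` as `z` and its conjugate form a closed
  -- ⋆-algebra. It contains `(a, c)`, hence also `(f(a), f(c))`.
  let S : NonUnitalStarSubalgebra ℝ (B × ℂ) :=
    { carrier := {p | p.1 * y = p.2 • y ∧ star p.1 * y = star p.2 • y}
      zero_mem' := by simp
      add_mem' := by
        rintro p q ⟨h1, h2⟩ ⟨h3, h4⟩
        exact ⟨by simp [add_mul, h1, h3, add_smul],
          by rw [Prod.fst_add, Prod.snd_add, star_add, star_add, add_mul, h2, h4, add_smul]⟩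
      mul_mem' := by
        rintro p q ⟨h1, h2⟩ ⟨h3, h4⟩
        refine ⟨?_, ?_⟩
        · rw [Prod.fst_mul, Prod.snd_mul, mul_assoc, h3, mul_smul_comm, h1, smul_smul, mul_comm]
        · rw [Prod.fst_mul, Prod.snd_mul, star_mul, star_mul, mul_assoc, h2, mul_smul_comm, h4,
            smul_smul, mul_comm]
      smul_mem' := by
        rintro c p ⟨h1, h2⟩
        refine ⟨by rw [Prod.smul_fst, Prod.smul_snd, smul_mul_assoc, h1, smul_assoc], ?_⟩
        rw [Prod.smul_fst, Prod.smul_snd, star_smul, star_smul, smul_mul_assoc, h2, smul_assoc]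
      star_mem' := by
        rintro p ⟨h1, h2⟩
        exact ⟨h2, by simpa using h1⟩ }
  have hS : IsClosed (S : Set (B × ℂ)) := by
    have : (S : Set (B × ℂ)) = {p | p.1 * y = p.2 • y} ∩ {p | star p.1 * y = star p.2 • y} := rfl
    rw [this]
    exact (isClosed_eq (by fun_prop) (by fun_prop)).inter (isClosed_eq (by fun_prop) (by fun_prop))
  have hc : IsSelfAdjoint (c : ℂ) := Complex.conj_ofReal c
  have hac : IsSelfAdjoint ((a, (c : ℂ)) : B × ℂ) := Prod.ext ha hc
  have hmem : ((a, (c : ℂ)) : B × ℂ) ∈ S := ⟨h, by rw [ha.star_eq, hc.star_eq, h]⟩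
  have h1 : cfcₙ f ((a, (c : ℂ)) : B × ℂ) ∈ S :=
    NonUnitalStarAlgebra.elemental.le_of_mem hS hmem (cfcₙ_mem_elemental f _)
  have h2 : cfcₙ f (c : ℂ) = (f c : ℂ) := by
    rw [cfcₙ_eq_cfc (by fun_prop) hf0]
    exact cfc_algebraMap (A := ℂ) c f
  rw [cfcₙ_map_prod (S := ℝ) f a (c : ℂ) hf.continuousOn hac ha hc, h2] at h1
  exact h1.1

lemma cfcₙ_mul_eq_self {a y : B} (ha : IsSelfAdjoint a) (h : a * y = y) {f : ℝ → ℝ}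
    (hf : Continuous f) (hf0 : f 0 = 0) (hf1 : f 1 = 1) : cfcₙ f a * y = y := by
  simpa [hf1] using cfcₙ_mul_eq_smul (c := 1) ha (by simpa using h) hf hf0

end Eigenvectors

/-! ### The cut-offs `f_ε(a)` and their units. -/

section FEps

lemma fEps_nonneg (ε t : ℝ) : 0 ≤ fEps ε t := le_max_left _ _

lemma fEps_le_one (ε t : ℝ) : fEps ε t ≤ 1 := max_le zero_le_one (min_le_left _ _)

lemma fEps_eq_one {ε t : ℝ} (hε : 0 < ε) (h : 2 * ε ≤ t) : fEps ε t = 1 := by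
  have : 1 ≤ t / ε - 1 := by
    have : 2 ≤ t / ε := (le_div_iff₀ hε).2 h
    linarith
  rw [fEps, min_eq_left this, max_eq_right zero_le_one]

lemma fEps_eq_zero {ε t : ℝ} (hε : 0 < ε) (h : t ≤ ε) : fEps ε t = 0 := by
  have : t / ε - 1 ≤ 0 := by
    have := (div_le_one hε).2 h
    linarith
  exact max_eq_left ((min_le_right _ _).trans this)

lemma fEps_mul_fEps {δ ε : ℝ} (hδ : 0 < δ) (h : 2 * δ ≤ ε) (t : ℝ) :
    fEps δ t * fEps ε t = fEps ε t := by
  rcases le_total t ε with ht | ht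
  · rw [fEps_eq_zero (by linarith) ht, mul_zero]
  · rw [fEps_eq_one hδ (h.trans ht), one_mul]

lemma fEps_anti {δ ε t : ℝ} (hδ : 0 < δ) (h : δ ≤ ε) : fEps ε t ≤ fEps δ t := by
  rcases le_total t ε with ht | ht
  · rw [fEps_eq_zero (by linarith) ht]
    exact fEps_nonneg _ _
  · have : t / ε ≤ t / δ := div_le_div_of_nonneg_left (by linarith) hδ h
    unfold fEps
    gcongr

/-- `f_ε(t) = t g(t)` for a continuous function `g` that vanishes at `0`. -/
lemma fEps_eq_mul {ε : ℝ} (hε : 0 < ε) (t : ℝ) : fEps ε t = t * (fEps ε t / max t ε) := by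
  rcases le_total t ε with ht | ht
  · rw [fEps_eq_zero hε ht]; simp
  · rw [max_eq_left ht, mul_div_cancel₀]
    linarith

lemma continuous_fEps_div {ε : ℝ} (hε : 0 < ε) : Continuous fun t => fEps ε t / max t ε :=
  (continuous_fEps ε).div (by fun_prop) fun t => (lt_max_of_lt_right hε).ne'

lemma abs_sub_mul_fEps_le {ε t : ℝ} (hε : 0 < ε) (ht : 0 ≤ t) : |t - t * fEps ε t| ≤ 2 * ε := by
  have h0 := fEps_nonneg ε t
  have h1 := fEps_le_one ε t
  rw [abs_of_nonneg (by nlinarith)]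
  rcases le_total t (2 * ε) with h | h
  · nlinarith
  · rw [fEps_eq_one hε h]; linarith

variable {B : Type*} [NonUnitalCStarAlgebra B]

lemma fE_isSelfAdjoint (ε : ℝ) (a : B) : IsSelfAdjoint (cfcₙ (fEps ε) a) :=
  cfcₙ_predicate _ _

lemma fE_mul_fE {δ ε : ℝ} (hδ : 0 < δ) (h : 2 * δ ≤ ε) (a : B) :
    cfcₙ (fEps δ) a * cfcₙ (fEps ε) a = cfcₙ (fEps ε) a := by
  rw [← cfcₙ_mul (fEps δ) (fEps ε) a (continuous_fEps _).continuousOn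
      (fEps_zero _) (continuous_fEps _).continuousOn (fEps_zero _)]
  simp only [fEps_mul_fEps hδ h]

lemma fE_mul_fE' {δ ε : ℝ} (hδ : 0 < δ) (h : 2 * δ ≤ ε) (a : B) :
    cfcₙ (fEps ε) a * cfcₙ (fEps δ) a = cfcₙ (fEps ε) a := by
  have := congrArg star (fE_mul_fE hδ h a)
  rwa [star_mul, (fE_isSelfAdjoint δ a).star_eq, (fE_isSelfAdjoint ε a).star_eq] at this

lemma exists_fE_eq_mul {ε : ℝ} (hε : 0 < ε) {a : B} (ha : IsSelfAdjoint a) :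
    ∃ c : B, cfcₙ (fEps ε) a = a * c ∧ cfcₙ (fEps ε) a = c * a := by
  have hg := continuous_fEps_div hε
  have hg0 : fEps ε 0 / max 0 ε = 0 := by simp [fEps_zero]
  refine ⟨cfcₙ (fun t => fEps ε t / max t ε) a, ?_, ?_⟩
  · nth_rw 2 [← cfcₙ_id' ℝ a ha]
    rw [← cfcₙ_mul (fun t => t) _ a (by fun_prop) rfl hg.continuousOn hg0]
    exact cfcₙ_congr fun t _ => fEps_eq_mul hε t
  · nth_rw 3 [← cfcₙ_id' ℝ a ha]
    rw [← cfcₙ_mul _ (fun t => t) a hg.continuousOn hg0 (by fun_prop) rfl]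
    exact cfcₙ_congr fun t _ => (fEps_eq_mul hε t).trans (mul_comm _ _)

/-- Left units of `a` are left units of `f_ε(a)`. -/
lemma mul_fE_eq {ε : ℝ} (hε : 0 < ε) {u a : B} (ha : IsSelfAdjoint a) (h : u * a = a) :
    u * cfcₙ (fEps ε) a = cfcₙ (fEps ε) a := by
  obtain ⟨c, hc, -⟩ := exists_fE_eq_mul hε ha
  rw [hc, ← mul_assoc, h]

lemma mul_fE_eq_zero {ε : ℝ} (hε : 0 < ε) {u a : B} (ha : IsSelfAdjoint a) (h : u * a = 0) :
    u * cfcₙ (fEps ε) a = 0 := by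
  obtain ⟨c, hc, -⟩ := exists_fE_eq_mul hε ha
  rw [hc, ← mul_assoc, h, zero_mul]

lemma fE_mul_eq_zero {ε : ℝ} (hε : 0 < ε) {u a : B} (ha : IsSelfAdjoint a) (h : a * u = 0) :
    cfcₙ (fEps ε) a * u = 0 := by
  obtain ⟨c, -, hc⟩ := exists_fE_eq_mul hε ha
  rw [hc, mul_assoc, h, mul_zero]

lemma fE_mul_eq_self {ε : ℝ} (hε : 0 < ε) (hε' : ε ≤ 1 / 2) {u a : B} (ha : IsSelfAdjoint a)
    (h : a * u = u) : cfcₙ (fEps ε) a * u = u :=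
  cfcₙ_mul_eq_self ha h (continuous_fEps ε) (fEps_zero ε) (fEps_eq_one hε (by linarith))

variable [PartialOrder B] [StarOrderedRing B]

lemma fE_nonneg (ε : ℝ) (a : B) : 0 ≤ cfcₙ (fEps ε) a :=
  cfcₙ_nonneg fun t _ => fEps_nonneg ε t

lemma norm_fE_le_one (ε : ℝ) (a : B) : ‖cfcₙ (fEps ε) a‖ ≤ 1 :=
  norm_cfcₙ_le fun t _ => by
    rw [Real.norm_eq_abs, abs_of_nonneg (fEps_nonneg ε t)]
    exact fEps_le_one ε t

lemma norm_sub_mul_fE_le {ε : ℝ} (hε : 0 < ε) {a : B} (ha : 0 ≤ a) :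
    ‖a - a * cfcₙ (fEps ε) a‖ ≤ 2 * ε := by
  have h1 : a - a * cfcₙ (fEps ε) a = cfcₙ (fun t => t - t * fEps ε t) a := by
    rw [cfcₙ_sub (fun t => t) (fun t => t * fEps ε t) a (by fun_prop) rfl
      (continuous_id.mul (continuous_fEps _)).continuousOn (by simp),
      cfcₙ_mul (fun t => t) (fEps ε) a (by fun_prop) rfl
      (continuous_fEps _).continuousOn (fEps_zero _), cfcₙ_id' ℝ a ha.isSelfAdjoint]
  rw [h1]
  exact norm_cfcₙ_le fun t ht =>
    abs_sub_mul_fEps_le hε (quasispectrum_nonneg_of_nonneg a ha t ht)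

lemma norm_sub_fE_mul_le {ε : ℝ} (hε : 0 < ε) {a : B} (ha : 0 ≤ a) :
    ‖a - cfcₙ (fEps ε) a * a‖ ≤ 2 * ε := by
  rw [← norm_star, star_sub, star_mul, (fE_isSelfAdjoint ε a).star_eq, ha.isSelfAdjoint.star_eq]
  exact norm_sub_mul_fE_le hε ha

lemma exists_fE_ne_zero {a : B} (ha : 0 ≤ a) (h : a ≠ 0) :
    ∃ ε : ℝ, 0 < ε ∧ cfcₙ (fEps ε) a ≠ 0 := by
  by_contra! hcon
  refine h (norm_le_zero_iff.1 (le_of_forall_pos_le_add fun δ hδ => ?_))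
  have := norm_sub_mul_fE_le (half_pos hδ) ha
  rw [hcon _ (half_pos hδ), mul_zero, sub_zero] at this
  linarith

end FEps

/-! ### Square roots and positive elements with units. -/

section Sqrt

variable {B : Type*} [NonUnitalCStarAlgebra B] [PartialOrder B] [StarOrderedRing B]

lemma exists_sqrt {a : B} (ha : 0 ≤ a) : ∃ s : B, 0 ≤ s ∧ s * s = a :=
  ⟨CFC.sqrt a, CFC.sqrt_nonneg a, CFC.sqrt_mul_sqrt_self a ha⟩

/-- Compression of an inequality by `1 - u`. -/
lemma norm_sub_mul_sq_le {x s z u : B} (hs : 0 ≤ s) (hx : s * s = x) (hxz : x ≤ z) :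
    ‖s - u * s‖ ^ 2 ≤ ‖z - u * z - z * star u + u * z * star u‖ := by
  obtain ⟨c, hc, hcz⟩ := exists_sqrt (sub_nonneg.2 hxz)
  have e1 : (s - u * s) * star (s - u * s) = x - u * x - x * star u + u * x * star u := by
    rw [star_sub, star_mul, hs.isSelfAdjoint.star_eq, ← hx]
    noncomm_ring
  have e2 : (c - u * c) * star (c - u * c) =
      (z - u * z - z * star u + u * z * star u) - (x - u * x - x * star u + u * x * star u) := by
    rw [star_sub, star_mul, hc.isSelfAdjoint.star_eq, ← sub_eq_zero]
    have : z = c * c + x := by rw [hcz]; abel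
    rw [this]
    noncomm_ring
  rw [sq, ← CStarRing.norm_self_mul_star, e1]
  refine CStarAlgebra.norm_le_norm_of_nonneg_of_le ?_ ?_
  · rw [← e1]; exact mul_star_self_nonneg _
  · rw [← sub_nonneg, ← e2]; exact mul_star_self_nonneg _

/-- The compression of `x` by `1 - u` is `(s - us)(s - us)⋆`, and it vanishes. -/
lemma mul_sqrt_eq {x s u : B} (hs : 0 ≤ s) (hsx : s * s = x) (hu : u * x = x) : u * s = s := by
  have hx : 0 ≤ x := by rw [← hsx]; simpa [hs.isSelfAdjoint.star_eq] using star_mul_self_nonneg s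
  have h := norm_sub_mul_sq_le (u := u) hs hsx le_rfl
  have hu' : x * star u = x := by
    have := congrArg star hu
    rwa [star_mul, hx.isSelfAdjoint.star_eq] at this
  rw [hu, hu', sub_self, zero_sub, neg_add_cancel, norm_zero] at h
  have h2 : s - u * s = 0 := by
    rw [← norm_eq_zero]
    exact pow_eq_zero_iff two_ne_zero |>.1 (le_antisymm h (by positivity))
  exact (sub_eq_zero.1 h2).symm

lemma sq_le_self_of_norm_le_one {u : B} (hu : 0 ≤ u) (h : ‖u‖ ≤ 1) : u * u ≤ u := by
  obtain ⟨s, hs, rfl⟩ := exists_sqrt hu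
  have := CStarAlgebra.star_left_conjugate_le_norm_smul (a := s) (b := s * s) hu.isSelfAdjoint
  rw [hs.isSelfAdjoint.star_eq] at this
  calc s * s * (s * s) = s * (s * s) * s := by noncomm_ring
    _ ≤ ‖s * s‖ • (s * s) := this
    _ ≤ (1 : ℝ) • (s * s) := smul_le_smul_of_nonneg_right h hu
    _ = s * s := one_smul _ _

/-- A positive element with a contractive unit `u` is below a multiple of `u`. -/
lemma le_norm_smul_of_unit {a u : B} (ha : 0 ≤ a) (hu : 0 ≤ u) (hu1 : ‖u‖ ≤ 1) (h : u * a = a) :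
    a ≤ ‖a‖ • u := by
  have h' : a * u = a := by
    have := congrArg star h
    rwa [star_mul, ha.isSelfAdjoint.star_eq, hu.isSelfAdjoint.star_eq] at this
  have := CStarAlgebra.star_left_conjugate_le_norm_smul (a := u) (b := a) ha.isSelfAdjoint
  rw [hu.isSelfAdjoint.star_eq, h, h'] at this
  exact this.trans (smul_le_smul_of_nonneg_left (sq_le_self_of_norm_le_one hu hu1) (norm_nonneg _))

lemma le_of_unit {a u : B} (ha : 0 ≤ a) (ha1 : ‖a‖ ≤ 1) (hu : 0 ≤ u) (hu1 : ‖u‖ ≤ 1)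
    (h : u * a = a) : a ≤ u := by
  refine (le_norm_smul_of_unit ha hu hu1 h).trans ?_
  calc ‖a‖ • u ≤ (1 : ℝ) • u := smul_le_smul_of_nonneg_right ha1 hu
    _ = u := one_smul _ _

lemma norm_sub_le_one_of_unit {a u : B} (ha : 0 ≤ a) (ha1 : ‖a‖ ≤ 1) (hu : 0 ≤ u) (hu1 : ‖u‖ ≤ 1)
    (h : u * a = a) : ‖u - a‖ ≤ 1 :=
  (CStarAlgebra.norm_le_norm_of_nonneg_of_le (sub_nonneg.2 (le_of_unit ha ha1 hu hu1 h))
    (sub_le_self u ha)).trans hu1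

end Sqrt

/-! ### Factorization of positive elements below `T⋆T`. -/

section Factor

variable {B : Type*} [NonUnitalCStarAlgebra B] [PartialOrder B] [StarOrderedRing B]

/-- The real function `t ↦ t / (1 / (n + 1) + t ^ 2)`, which approximates `t⁻¹`. -/
lemma continuous_div_add_sq (n : ℕ) : Continuous fun t : ℝ => t / (1 / ((n : ℝ) + 1) + t ^ 2) :=
  continuous_id.div (by fun_prop) fun t => by positivity

/-- With `m = n + 1` the inner bracket is `1 / (1 + m t²)`, and `t √m ≤ 1 + m t²`. The rate makes
the regularized inverses in `exists_factor` converge. -/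
lemma mul_one_sub_sq_le (n : ℕ) (t : ℝ) :
    t * (1 - t * (t / (1 / ((n : ℝ) + 1) + t ^ 2))) ^ 2 ≤ 1 / Real.sqrt ((n : ℝ) + 1) := by
  set m : ℝ := (n : ℝ) + 1 with hm
  have hm0 : 0 < m := by positivity
  have hs : 0 < Real.sqrt m := Real.sqrt_pos.2 hm0
  have hss : Real.sqrt m ^ 2 = m := Real.sq_sqrt hm0.le
  have e : 1 - t * (t / (1 / m + t ^ 2)) = 1 / (1 + m * t ^ 2) := by
    field_simp
    ring
  rw [e, div_pow, one_pow, mul_one_div, div_le_div_iff₀ (by positivity) hs]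
  have h1 : t * Real.sqrt m ≤ 1 + m * t ^ 2 := by
    have e2 : m * t ^ 2 = (t * Real.sqrt m) ^ 2 := by rw [mul_pow, hss]; ring
    rw [e2]; nlinarith [sq_nonneg (t * Real.sqrt m - 1), sq_nonneg (t * Real.sqrt m)]
  have h2 : 0 ≤ m * t ^ 2 := by positivity
  nlinarith

lemma cfcₙ_mul_one_sub_sq {h : B} (hh : IsSelfAdjoint h) {g : ℝ → ℝ} (hg : Continuous g)
    (hg0 : g 0 = 0) : cfcₙ (fun t => t * (1 - g t) ^ 2) h =
      h - cfcₙ g h * h - h * cfcₙ g h + cfcₙ g h * h * cfcₙ g h := by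
  have e1 : (fun t => t * (1 - g t) ^ 2) =
      fun t => ((t - g t * t) - t * g t) + (g t * t) * g t := by
    funext t; ring
  have e2 : cfcₙ (fun t => g t * t) h = cfcₙ g h * h := by
    rw [cfcₙ_mul g (fun t => t) h hg.continuousOn hg0 (by fun_prop) rfl, cfcₙ_id' ℝ h hh]
  have e3 : cfcₙ (fun t => t * g t) h = h * cfcₙ g h := by
    rw [cfcₙ_mul (fun t => t) g h (by fun_prop) rfl hg.continuousOn hg0, cfcₙ_id' ℝ h hh]
  rw [e1, cfcₙ_add (fun t => (t - g t * t) - t * g t) (fun t => (g t * t) * g t) h (by fun_prop)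
      (by simp) (by fun_prop) (by simp),
    cfcₙ_sub (fun t => t - g t * t) (fun t => t * g t) h (by fun_prop) (by simp) (by fun_prop)
      (by simp),
    cfcₙ_sub (fun t => t) (fun t => g t * t) h (by fun_prop) rfl (by fun_prop) (by simp),
    cfcₙ_mul (fun t => g t * t) g h (by fun_prop) (by simp) hg.continuousOn hg0, e2, e3,
    cfcₙ_id' ℝ h hh]

/-- Two-sided functional calculus. -/
lemma cfcₙ_mul_mul {h : B} (hh : IsSelfAdjoint h) {g : ℝ → ℝ} (hg : Continuous g)
    (hg0 : g 0 = 0) : cfcₙ g h * h * cfcₙ g h = cfcₙ (fun t => g t * t * g t) h := by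
  rw [cfcₙ_mul (fun t => g t * t) g h (by fun_prop) (by simp) hg.continuousOn hg0,
    cfcₙ_mul g (fun t => t) h hg.continuousOn hg0 (by fun_prop) rfl, cfcₙ_id' ℝ h hh]

/-- If `0 ≤ x ≤ C |T|` then `x = G⋆ G` for some `G` in the closed right ideal generated by `T`. -/
lemma exists_factor {x h T : B} {C : ℝ} (hx : 0 ≤ x) (hh : 0 ≤ h) (hT : star T * T = h * h)
    (hxh : x ≤ C • h) :
    ∃ G : B, star G * G = x ∧ ∀ f : B, f * T = T → f * G = G := by
  obtain ⟨s, hs, hsx⟩ := exists_sqrt hx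
  let ψ : ℕ → ℝ → ℝ := fun n t => t / (1 / ((n : ℝ) + 1) + t ^ 2)
  have hψ : ∀ n, Continuous (ψ n) := continuous_div_add_sq
  have hψ0 : ∀ n, ψ n 0 = 0 := fun n => by simp [ψ]
  let p : ℕ → B := fun n => cfcₙ (ψ n) h
  -- Formally `G = T h⁻¹ s`. The regularizations `T p_n s` form a Cauchy sequence because `‖T a‖ =
  -- ‖h a‖` and `h p_n s → s`; the latter uses `s² = x ≤ C h`.
  let Y : ℕ → B := fun n => h * (p n * s)
  have hiso : ∀ a : B, ‖T * a‖ = ‖h * a‖ := fun a => by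
    have : ‖T * a‖ * ‖T * a‖ = ‖h * a‖ * ‖h * a‖ := by
      rw [← CStarRing.norm_star_mul_self, ← CStarRing.norm_star_mul_self, star_mul, star_mul,
        hh.isSelfAdjoint.star_eq]
      congr 1
      calc star a * star T * (T * a) = star a * (star T * T) * a := by noncomm_ring
        _ = star a * h * (h * a) := by rw [hT]; noncomm_ring
    exact (mul_self_inj (norm_nonneg _) (norm_nonneg _)).1 this
  have hhp : ∀ n, h * p n = cfcₙ (fun t => t * ψ n t) h := fun n => by
    rw [cfcₙ_mul (fun t => t) (ψ n) h (by fun_prop) rfl (hψ n).continuousOn (hψ0 n),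
      cfcₙ_id' ℝ h hh.isSelfAdjoint]
  have hbound : ∀ n : ℕ, ‖s - Y n‖ ^ 2 ≤ |C| * (1 / Real.sqrt ((n : ℝ) + 1)) := fun n => by
    have hu : star (h * p n) = h * p n := by
      rw [hhp]; exact (cfcₙ_predicate _ _ : IsSelfAdjoint _).star_eq
    have h1 := norm_sub_mul_sq_le (u := h * p n) hs hsx hxh
    rw [hu, mul_assoc h] at h1
    refine h1.trans ?_
    have hc1 : Continuous fun t => t * ψ n t := continuous_id.mul (hψ n)
    have e : C • h - h * p n * C • h - C • h * (h * p n) + h * p n * C • h * (h * p n) =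
        C • cfcₙ (fun t => t * (1 - t * ψ n t) ^ 2) h := by
      have : cfcₙ (fun t => t * (1 - t * ψ n t) ^ 2) h =
          h - (h * p n) * h - h * (h * p n) + (h * p n) * h * (h * p n) := by
        rw [hhp]
        exact cfcₙ_mul_one_sub_sq hh.isSelfAdjoint hc1 (by simp)
      rw [this]
      simp only [smul_add, smul_sub, mul_smul_comm, smul_mul_assoc]
    rw [e, norm_smul, Real.norm_eq_abs]
    refine mul_le_mul_of_nonneg_left (norm_cfcₙ_le fun t ht => ?_) (abs_nonneg _)
    have ht0 := quasispectrum_nonneg_of_nonneg h hh t ht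
    rw [Real.norm_eq_abs, abs_of_nonneg (by positivity)]
    exact mul_one_sub_sq_le n t
  have hY : Tendsto Y atTop (𝓝 s) := by
    rw [tendsto_iff_norm_sub_tendsto_zero]
    have h0 : Tendsto (fun n : ℕ => |C| * (1 / Real.sqrt ((n : ℝ) + 1))) atTop (𝓝 0) := by
      have : Tendsto (fun n : ℕ => 1 / Real.sqrt ((n : ℝ) + 1)) atTop (𝓝 0) := by
        have h2 : Tendsto (fun n : ℕ => Real.sqrt ((n : ℝ) + 1)) atTop atTop :=
          Real.tendsto_sqrt_atTop.comp
            (tendsto_natCast_atTop_atTop.atTop_add tendsto_const_nhds)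
        simpa [Pi.inv_def] using h2.inv_tendsto_atTop
      simpa using this.const_mul |C|
    have h1 : Tendsto (fun n => ‖s - Y n‖ ^ 2) atTop (𝓝 0) :=
      squeeze_zero (fun n => by positivity) hbound h0
    have h2 := (Real.continuous_sqrt.tendsto 0).comp h1
    simp only [Real.sqrt_zero, Function.comp_def, Real.sqrt_sq (norm_nonneg _)] at h2
    simpa only [norm_sub_rev] using h2
  have hcau : CauchySeq fun n => T * (p n * s) := by
    have := hY.cauchySeq
    rw [Metric.cauchySeq_iff] at this ⊢
    intro ε hε
    obtain ⟨N, hN⟩ := this ε hε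
    refine ⟨N, fun m hm n hn => ?_⟩
    have := hN m hm n hn
    rw [dist_eq_norm, ← mul_sub] at this ⊢
    rwa [hiso]
  obtain ⟨G, hG⟩ := cauchySeq_tendsto_of_complete hcau
  refine ⟨G, ?_, fun f hf => ?_⟩
  · have h1 : Tendsto (fun n => star (T * (p n * s)) * (T * (p n * s))) atTop (𝓝 (star G * G)) :=
      hG.star.mul hG
    have h2 : Tendsto (fun n => star (Y n) * Y n) atTop (𝓝 (star s * s)) := hY.star.mul hY
    have h3 : ∀ n, star (T * (p n * s)) * (T * (p n * s)) = star (Y n) * Y n := fun n => by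
      simp only [Y, star_mul, hh.isSelfAdjoint.star_eq]
      calc _ = star s * star (p n) * (star T * T) * (p n * s) := by noncomm_ring
        _ = _ := by rw [hT]; noncomm_ring
    simp only [h3] at h1
    rw [tendsto_nhds_unique h1 h2, hs.isSelfAdjoint.star_eq, hsx]
  · have h1 : Tendsto (fun n => f * (T * (p n * s))) atTop (𝓝 (f * G)) := hG.const_mul f
    simp only [← mul_assoc, hf] at h1
    simp only [← mul_assoc] at hG
    exact tendsto_nhds_unique h1 hG

/-- If `0 ≤ x ≤ T⋆ T` then `x = G⋆ G` for some `G` in the closed right ideal generated by `T`. -/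
lemma exists_factor_of_le {x T : B} (hx : 0 ≤ x) (hxT : x ≤ star T * T) :
    ∃ G : B, star G * G = x ∧ ∀ f : B, f * T = T → f * G = G := by
  obtain ⟨h, hh, hhT⟩ := exists_sqrt (star_mul_self_nonneg T)
  -- `T⋆T = h² ≤ ‖h‖ h`, so a bound by `T⋆T` is also a bound by a multiple of `|T|`.
  refine exists_factor (C := ‖h‖) hx hh hhT.symm (hxT.trans ?_)
  rw [← hhT]
  obtain ⟨s, hs, rfl⟩ := exists_sqrt hh
  have := CStarAlgebra.star_left_conjugate_le_norm_smul (a := s) (b := s * s) hh.isSelfAdjoint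
  rw [hs.isSelfAdjoint.star_eq] at this
  calc s * s * (s * s) = s * (s * s) * s := by noncomm_ring
    _ ≤ _ := this

/-- `|T| = G⋆ G` for some `G` in the closed right ideal generated by `T`. -/
lemma exists_factor_abs {h T : B} (hh : 0 ≤ h) (hT : star T * T = h * h) :
    ∃ G : B, star G * G = h ∧ ∀ f : B, f * T = T → f * G = G :=
  exists_factor (C := 1) hh hh hT (by rw [one_smul])

end Factor

section Cut

variable {B : Type*} [NonUnitalCStarAlgebra B] [PartialOrder B] [StarOrderedRing B]

/-- The function `t ↦ (t - ε)_+`. -/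
def cutFun (ε t : ℝ) : ℝ := max (t - ε) 0

lemma continuous_cutFun (ε : ℝ) : Continuous (cutFun ε) := by unfold cutFun; fun_prop

lemma cutFun_zero {ε : ℝ} (hε : 0 ≤ ε) : cutFun ε 0 = 0 := by simp [cutFun, hε]

/-- If `‖a - T⋆ T‖ < ε` then `(a - ε)_+ = G⋆ G` for some `G` in the closed right ideal generated
by `T`. -/
lemma exists_factor_cut {a T : B} {ε : ℝ} (ha : 0 ≤ a) (hε : 0 < ε) (h : ‖a - star T * T‖ < ε) :
    ∃ G : B, star G * G = cfcₙ (cutFun ε) a ∧ ∀ f : B, f * T = T → f * G = G := by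
  set r := ‖a - star T * T‖ with hr
  have hr0 : 0 ≤ r := norm_nonneg _
  -- Chosen so that `v a v - r v² = (a - ε)_+` for `v = φ(a)`; since `v (a - T⋆T) v ≤ r v²`, this
  -- puts `(a - ε)_+` below `(T v)⋆(T v)`. The `max t ε` keeps the denominator at least `ε - r > 0`.
  let φ : ℝ → ℝ := fun t => Real.sqrt (cutFun ε t / (max t ε - r))
  have hφc : Continuous φ := by
    refine Real.continuous_sqrt.comp ((continuous_cutFun ε).div (by fun_prop) fun t => ?_)
    have : ε ≤ max t ε := le_max_right _ _
    intro h0; linarith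
  have hφ0 : φ 0 = 0 := by simp [φ, cutFun_zero hε.le]
  set v := cfcₙ φ a with hv
  have hv' : star v = v := (cfcₙ_predicate φ a : IsSelfAdjoint _).star_eq
  have key : cfcₙ (cutFun ε) a ≤ star (T * v) * (T * v) := by
    have h1 : v * a * v - r • (v * v) = cfcₙ (cutFun ε) a := by
      have e1 : v * a * v = cfcₙ (fun t => φ t * t * φ t) a :=
        cfcₙ_mul_mul ha.isSelfAdjoint hφc hφ0
      have e2 : v * v = cfcₙ (fun t => φ t * φ t) a := by
        rw [cfcₙ_mul _ _ a (by fun_prop) hφ0 (by fun_prop) hφ0]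
      rw [e1, e2, ← cfcₙ_smul r _ a (by fun_prop) (by simp [hφ0]),
        ← cfcₙ_sub _ _ a (by fun_prop) (by simp [hφ0]) (by fun_prop) (by simp [hφ0])]
      refine cfcₙ_congr fun t ht => ?_
      have hq : 0 ≤ cutFun ε t / (max t ε - r) :=
        div_nonneg (le_max_right _ _) (by have := le_max_right t ε; linarith)
      have hsq : φ t * φ t = cutFun ε t / (max t ε - r) := Real.mul_self_sqrt hq
      have : φ t * t * φ t - r • (φ t * φ t) = φ t * φ t * (t - r) := by
        rw [smul_eq_mul]; ring
      refine this.trans ?_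
      rw [hsq]
      rcases le_total t ε with hte | hte
      · have : cutFun ε t = 0 := max_eq_right (by linarith)
        rw [this]; simp
      · rw [max_eq_left hte, div_mul_cancel₀]
        intro h0; linarith
    have h2 : v * (a - star T * T) * v ≤ r • (v * v) := by
      have hsa : IsSelfAdjoint (a - star T * T) :=
        ha.isSelfAdjoint.sub (IsSelfAdjoint.star_mul_self T)
      have := CStarAlgebra.star_left_conjugate_le_norm_smul (a := v) hsa
      rwa [hv'] at this
    rw [← h1, sub_le_iff_le_add, star_mul, hv']
    calc v * a * v = v * (a - star T * T) * v + v * star T * (T * v) := by noncomm_ring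
      _ ≤ r • (v * v) + v * star T * (T * v) := by gcongr
      _ = _ := add_comm _ _
  obtain ⟨G, hG, hG'⟩ := exists_factor_of_le (cfcₙ_nonneg fun t _ => le_max_right _ _) key
  exact ⟨G, hG, fun f hf => hG' f (by rw [← mul_assoc, hf])⟩

end Cut

/-! ### Closed right ideals and hereditary subalgebras. -/

section Hereditary

variable {B : Type*} [NonUnitalCStarAlgebra B]

/-- `v` lies in the closed right ideal generated by `e`. -/
def InHer (e v : B) : Prop :=
  Tendsto (fun n : ℕ => cfcₙ (fEps (1 / ((n : ℝ) + 1))) e * v) atTop (𝓝 v)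

lemma tendsto_one_div_add_one : Tendsto (fun n : ℕ => 2 * (1 / ((n : ℝ) + 1))) atTop (𝓝 0) := by
  simpa using tendsto_one_div_add_atTop_nhds_zero_nat.const_mul (2 : ℝ)

lemma InHer.add {e v w : B} (hv : InHer e v) (hw : InHer e w) : InHer e (v + w) := by
  simpa only [InHer, mul_add] using Tendsto.add hv hw

lemma InHer.sub {e v w : B} (hv : InHer e v) (hw : InHer e w) : InHer e (v - w) := by
  simpa only [InHer, mul_sub] using Tendsto.sub hv hw

lemma InHer.zero (e : B) : InHer e 0 := by simp [InHer]

lemma InHer.smul {e v : B} (c : ℝ) (hv : InHer e v) : InHer e (c • v) := by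
  simpa only [InHer, mul_smul_comm] using Tendsto.const_smul hv c

lemma InHer.mul_right {e v : B} (hv : InHer e v) (b : B) : InHer e (v * b) := by
  simpa only [InHer, mul_assoc] using Tendsto.mul_const b hv

variable [PartialOrder B] [StarOrderedRing B]

lemma InHer.of_tendsto {e v : B} {w : ℕ → B} (hw : ∀ n, InHer e (w n))
    (h : Tendsto w atTop (𝓝 v)) : InHer e v := by
  rw [InHer, Metric.tendsto_atTop]
  intro δ hδ
  obtain ⟨N, hN⟩ := Metric.tendsto_atTop.1 h (δ / 3) (by positivity)
  obtain ⟨M, hM⟩ := Metric.tendsto_atTop.1 (hw N) (δ / 3) (by positivity)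
  refine ⟨M, fun n hn => ?_⟩
  have h1 := hM n hn
  have h2 := hN N le_rfl
  rw [dist_eq_norm] at h1 h2 ⊢
  set u := cfcₙ (fEps (1 / ((n : ℝ) + 1))) e
  have hu : ‖u‖ ≤ 1 := norm_fE_le_one _ _
  have h3 : ‖u * (w N - v)‖ ≤ ‖w N - v‖ :=
    (norm_mul_le _ _).trans (mul_le_of_le_one_left (norm_nonneg _) hu)
  have e : u * v - v = (u * w N - w N) + (w N - v) - u * (w N - v) := by rw [mul_sub]; abel
  rw [e]
  refine (norm_sub_le _ _).trans_lt ?_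
  have := norm_add_le (u * w N - w N) (w N - v)
  linarith

lemma InHer.self {e : B} (he : 0 ≤ e) : InHer e e := by
  rw [InHer, tendsto_iff_norm_sub_tendsto_zero]
  refine squeeze_zero (fun _ => norm_nonneg _) (fun n => ?_) tendsto_one_div_add_one
  rw [norm_sub_rev]
  exact norm_sub_fE_mul_le Nat.one_div_pos_of_nat he

lemma InHer.of_mul {e v : B} (he : 0 ≤ e) (b : B) (h : v = e * b) : InHer e v := by
  rw [h]; exact (InHer.self he).mul_right b

lemma InHer.of_unit {e v : B} (he : 0 ≤ e) {ε : ℝ} (hε : 0 < ε) (h : cfcₙ (fEps ε) e * v = v) :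
    InHer e v := by
  obtain ⟨c, hc, -⟩ := exists_fE_eq_mul hε he.isSelfAdjoint
  exact InHer.of_mul he (c * v) (by rw [← mul_assoc, ← hc, h])

/-- The approximants `f_{1/(n+1)}(v) w` are of the form `v c w`, and the closed right ideal of `e`
contains these as well as their limit. -/
lemma InHer.trans {e v w : B} (hv : 0 ≤ v) (h1 : InHer e v) (h2 : InHer v w) : InHer e w := by
  refine InHer.of_tendsto (fun n => ?_) h2
  obtain ⟨c, hc, -⟩ := exists_fE_eq_mul (ε := 1 / ((n : ℝ) + 1)) Nat.one_div_pos_of_nat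
    hv.isSelfAdjoint
  rw [hc, mul_assoc]
  exact h1.mul_right _

lemma InHer.mul_eq_zero {e v y : B} (he : 0 ≤ e) (h : InHer e v) (hy : y * e = 0) : y * v = 0 := by
  have h1 : Tendsto (fun n : ℕ => y * (cfcₙ (fEps (1 / ((n : ℝ) + 1))) e * v)) atTop
      (𝓝 (y * v)) := Tendsto.const_mul y h
  have h2 : ∀ n : ℕ, y * (cfcₙ (fEps (1 / ((n : ℝ) + 1))) e * v) = 0 := fun n => by
    rw [← mul_assoc, mul_fE_eq_zero Nat.one_div_pos_of_nat he.isSelfAdjoint hy, zero_mul]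
  simp only [h2] at h1
  exact tendsto_nhds_unique h1 tendsto_const_nhds

/-- `u_n s → s` for `s = √x` when `x ≤ C b` and `u_n b → b`. -/
lemma InHer.sqrt_of_le {e x s z : B} (hs : 0 ≤ s) (hsx : s * s = x) (hxz : x ≤ z)
    (h : InHer e z) : InHer e s := by
  rw [InHer, tendsto_iff_norm_sub_tendsto_zero] at *
  have h1 : ∀ n : ℕ, ‖cfcₙ (fEps (1 / ((n : ℝ) + 1))) e * s - s‖ ^ 2 ≤
      2 * ‖cfcₙ (fEps (1 / ((n : ℝ) + 1))) e * z - z‖ := fun n => by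
    set u := cfcₙ (fEps (1 / ((n : ℝ) + 1))) e
    have hu : ‖u‖ ≤ 1 := norm_fE_le_one _ _
    have hu' : star u = u := (fE_isSelfAdjoint _ _).star_eq
    rw [norm_sub_rev]
    refine (norm_sub_mul_sq_le hs hsx hxz).trans ?_
    have e : z - u * z - z * star u + u * z * star u = (u * z - z) * u - (u * z - z) := by
      rw [hu']; noncomm_ring
    rw [e]
    refine (norm_sub_le _ _).trans ?_
    have : ‖(u * z - z) * u‖ ≤ ‖u * z - z‖ :=
      (norm_mul_le _ _).trans (mul_le_of_le_one_right (norm_nonneg _) hu)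
    linarith
  have h2 : Tendsto (fun n : ℕ => ‖cfcₙ (fEps (1 / ((n : ℝ) + 1))) e * s - s‖ ^ 2) atTop (𝓝 0) :=
    squeeze_zero (fun n => by positivity) h1 (by simpa using h.const_mul 2)
  have h3 := (Real.continuous_sqrt.tendsto 0).comp h2
  simpa only [Real.sqrt_zero, Function.comp_def, Real.sqrt_sq (norm_nonneg _)] using h3

lemma InHer.of_le {x z : B} (hx : 0 ≤ x) (hxz : x ≤ z) : InHer z x := by
  obtain ⟨s, hs, hsx⟩ := exists_sqrt hx
  have := InHer.sqrt_of_le hs hsx hxz (InHer.self (hx.trans hxz))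
  rw [← hsx]
  exact this.mul_right s

lemma InHer.of_le_smul {x z : B} {C : ℝ} (hx : 0 ≤ x) (hz : 0 ≤ z) (hxz : x ≤ C • z) :
    InHer z x := by
  have hC : 0 ≤ C • z := hx.trans hxz
  refine InHer.trans hC ?_ (InHer.of_le hx hxz)
  exact (InHer.self hz).smul C

/-- `x` is the limit of `u x u ≤ ‖x‖ u²` with `u = f_{1/(n+1)}(e)`, and `u` lies in every closed
⋆-subalgebra that contains `e`. -/
lemma InHer.mem_her {e x : B} (hx : 0 ≤ x) (h : InHer e x) : x ∈ Her e := by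
  intro C hC hher heC
  obtain ⟨s, hs, hsx⟩ := exists_sqrt hx
  have hs' : InHer e s := InHer.sqrt_of_le hs hsx le_rfl h
  have hfin : Tendsto (fun n : ℕ => (cfcₙ (fEps (1 / ((n : ℝ) + 1))) e * s) *
      star (cfcₙ (fEps (1 / ((n : ℝ) + 1))) e * s)) atTop (𝓝 (s * star s)) :=
    Tendsto.mul hs' (Tendsto.star hs')
  rw [hs.isSelfAdjoint.star_eq, hsx] at hfin
  refine hC.mem_of_tendsto hfin (Eventually.of_forall fun n => ?_)
  set u := cfcₙ (fEps (1 / ((n : ℝ) + 1))) e with hu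
  have huC : u ∈ C := by
    have h1 : cfcₙ (fEps (1 / ((n : ℝ) + 1))) e ∈ NonUnitalStarAlgebra.elemental ℝ e :=
      cfcₙ_mem_elemental _ _
    let C' : NonUnitalStarSubalgebra ℝ B :=
      { carrier := C
        zero_mem' := C.zero_mem
        add_mem' := C.add_mem
        mul_mem' := C.mul_mem
        smul_mem' := fun c x hx => by
          have : (c : ℂ) • x ∈ C := SMulMemClass.smul_mem (c : ℂ) hx
          rwa [Complex.coe_smul] at this
        star_mem' := fun hx => star_mem hx }
    exact NonUnitalStarAlgebra.elemental.le_of_mem (s := C') hC heC h1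
  refine hher _ ((‖x‖ : ℂ) • (u * u)) (mul_star_self_nonneg _) ?_ 
    (SMulMemClass.smul_mem _ (mul_mem huC huC))
  have hu' : star u = u := (fE_isSelfAdjoint _ _).star_eq
  have := CStarAlgebra.star_left_conjugate_le_norm_smul (a := u) (b := x) hx.isSelfAdjoint
  rw [hu'] at this
  rw [Complex.coe_smul]
  calc u * s * star (u * s) = u * x * u := by
        rw [star_mul, hs.isSelfAdjoint.star_eq, hu', ← hsx]; noncomm_ring
    _ ≤ _ := this

/-- Write `f_{1/(n+1)}(e) = g e g` with `g` a function of `e`. Then `√x f_{1/(n+1)}(e) √x = (g √x)⋆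
e (g √x)` tends to `x`. -/
lemma InHer.cuntzLE {e x : B} (he : 0 ≤ e) (hx : 0 ≤ x) (h : InHer e x) : CuntzLE x e := by
  obtain ⟨s, hs, hsx⟩ := exists_sqrt hx
  have hs' : InHer e s := InHer.sqrt_of_le hs hsx le_rfl h
  let g : ℕ → ℝ → ℝ := fun n t =>
    Real.sqrt (fEps (1 / ((n : ℝ) + 1)) t / max t (1 / ((n : ℝ) + 1)))
  have hg : ∀ n, Continuous (g n) := fun n =>
    Real.continuous_sqrt.comp (continuous_fEps_div Nat.one_div_pos_of_nat)
  have hg0 : ∀ n, g n 0 = 0 := fun n => by simp [g, fEps_zero]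
  refine ⟨fun n => cfcₙ (g n) e * s, ?_⟩
  have h1 : Tendsto (fun n : ℕ => s * (cfcₙ (fEps (1 / ((n : ℝ) + 1))) e * s)) atTop
    (𝓝 (s * s)) := Tendsto.const_mul s hs'
  rw [hsx] at h1
  refine h1.congr fun n => ?_
  have e1 : cfcₙ (fEps (1 / ((n : ℝ) + 1))) e = cfcₙ (g n) e * e * cfcₙ (g n) e := by
    rw [cfcₙ_mul_mul he.isSelfAdjoint (hg n) (hg0 n)]
    refine cfcₙ_congr fun t ht => ?_
    have hpos : (0 : ℝ) < 1 / ((n : ℝ) + 1) := Nat.one_div_pos_of_nat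
    have hq : 0 ≤ fEps (1 / ((n : ℝ) + 1)) t / max t (1 / ((n : ℝ) + 1)) :=
      div_nonneg (fEps_nonneg _ _) (hpos.le.trans (le_max_right _ _))
    have : g n t * t * g n t = t * (g n t * g n t) := by ring
    refine Eq.trans ?_ this.symm
    rw [Real.mul_self_sqrt hq]
    exact fEps_eq_mul hpos t
  rw [e1, star_mul, hs.isSelfAdjoint.star_eq, (cfcₙ_predicate _ _ : IsSelfAdjoint _).star_eq]
  noncomm_ring

end Hereditary

/-! ### Block sums and the Pedersen ideal of a stable algebra. -/

/-- Two isometries with orthogonal ranges in the multiplier algebra of `B`, given by their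
actions by left multiplication on `B`. -/
structure IsometryPair (B : Type*) [NonUnitalCStarAlgebra B] where
  L : Fin 2 → B →ₗ[ℂ] B
  map_mul : ∀ i x y, L i (x * y) = L i x * y
  inner : ∀ i j x y, star (L i x) * L j y = if i = j then star x * y else 0

section Products

variable {B : Type*} [NonUnitalCStarAlgebra B] [PartialOrder B] [StarOrderedRing B]

/-- A linear property that holds for squares of positive elements holds everywhere. -/
lemma induction_sq {p : B → Prop} (hadd : ∀ x y, p x → p y → p (x + y))
    (hsmul : ∀ (c : ℂ) x, p x → p (c • x)) (hsq : ∀ s : B, 0 ≤ s → p (s * s)) (x : B) : p x := by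
  have hx : x ∈ Submodule.span ℂ {a : B | 0 ≤ a} := by
    rw [CStarAlgebra.span_nonneg]; trivial
  induction hx using Submodule.span_induction with
  | mem x hx =>
    obtain ⟨s, hs, rfl⟩ := exists_sqrt hx
    exact hsq s hs
  | zero => simpa using hsq 0 le_rfl
  | add x y _ _ hx hy => exact hadd x y hx hy
  | smul c x _ hx => exact hsmul c x hx

lemma dense_of_nonneg {I : Submodule ℂ B} (h : ∀ a : B, 0 ≤ a → a ∈ closure (I : Set B)) :
    Dense (I : Set B) := by
  rw [Submodule.dense_iff_topologicalClosure_eq_top, ← top_le_iff,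
    ← CStarAlgebra.span_nonneg, Submodule.span_le]
  intro b hb
  rw [SetLike.mem_coe, ← SetLike.mem_coe, Submodule.topologicalClosure_coe]
  exact h b hb

lemma mul_mem_ped_left {x : B} (b : B) (hx : x ∈ Ped B) : b * x ∈ Ped B :=
  fun I hI hd => (hI b x (hx I hI hd)).1

lemma mul_mem_ped_right {x : B} (b : B) (hx : x ∈ Ped B) : x * b ∈ Ped B :=
  fun I hI hd => (hI b x (hx I hI hd)).2

end Products

namespace IsometryPair

variable {B : Type*} [NonUnitalCStarAlgebra B] [PartialOrder B] [StarOrderedRing B]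
variable (Φ : IsometryPair B)

/-- The map `x ↦ V_i x V_j⋆`. -/
def conj (i j : Fin 2) (x : B) : B := Φ.L i (star (Φ.L j (star x)))

lemma inner_self (i : Fin 2) (x y : B) : star (Φ.L i x) * Φ.L i y = star x * y := by
  rw [Φ.inner, if_pos rfl]

lemma conj_mul_L (i j k : Fin 2) (x y : B) :
    Φ.conj i j x * Φ.L k y = if j = k then Φ.L i (x * y) else 0 := by
  rw [conj, ← Φ.map_mul, Φ.inner, star_star]
  split_ifs <;> simp

lemma conj_mul (i j : Fin 2) (p q : B) :
    Φ.conj i j (p * q) = Φ.L i p * star (Φ.L j (star q)) := by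
  rw [conj, star_mul, Φ.map_mul, star_mul, star_star, Φ.map_mul]

lemma conj_add (i j : Fin 2) (x y : B) : Φ.conj i j (x + y) = Φ.conj i j x + Φ.conj i j y := by
  simp [conj]

lemma conj_smul (i j : Fin 2) (c : ℂ) (x : B) : Φ.conj i j (c • x) = c • Φ.conj i j x := by
  simp [conj, star_smul]

lemma conj_sub (i j : Fin 2) (x y : B) : Φ.conj i j (x - y) = Φ.conj i j x - Φ.conj i j y := by
  simp [conj]

/-- For a product `pq` the map gives `(V_i p)(V_j q⋆)⋆`, whose adjoint is visible. Squares of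
positive elements span `B`. -/
lemma star_conj (i j : Fin 2) (x : B) : star (Φ.conj i j x) = Φ.conj j i (star x) := by
  refine induction_sq (p := fun x => star (Φ.conj i j x) = Φ.conj j i (star x)) ?_ ?_ ?_ x
  · intro x y hx hy
    rw [conj_add, star_add, hx, hy, star_add, conj_add]
  · intro c x hx
    rw [conj_smul, star_smul, hx, star_smul, conj_smul]
  · intro s _
    rw [conj_mul, star_mul, star_star, star_mul, conj_mul, star_star]

lemma conj_mul_conj (i j k l : Fin 2) (x y : B) :
    Φ.conj i j x * Φ.conj k l y = if j = k then Φ.conj i l (x * y) else 0 := by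
  conv_lhs => rw [conj.eq_1 Φ k l, conj_mul_L]
  split_ifs with h
  · rw [conj, star_mul, Φ.map_mul i, Φ.map_mul l, star_mul, star_star, Φ.map_mul i]
  · rfl

lemma conj_self_nonneg (i : Fin 2) {x : B} (hx : 0 ≤ x) : 0 ≤ Φ.conj i i x := by
  obtain ⟨s, hs, rfl⟩ := exists_sqrt hx
  rw [conj_mul, hs.isSelfAdjoint.star_eq]
  exact mul_star_self_nonneg _

/-- The block sum `V_0 x V_0⋆ + V_1 y V_1⋆`. -/
def dsum (x y : B) : B := Φ.conj 0 0 x + Φ.conj 1 1 y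

lemma dsum_nonneg {x y : B} (hx : 0 ≤ x) (hy : 0 ≤ y) : 0 ≤ Φ.dsum x y :=
  add_nonneg (Φ.conj_self_nonneg 0 hx) (Φ.conj_self_nonneg 1 hy)

lemma dsum_mul (x y x' y' : B) : Φ.dsum x y * Φ.dsum x' y' = Φ.dsum (x * x') (y * y') := by
  simp [dsum, add_mul, mul_add, conj_mul_conj]

lemma dsum_sub (x y x' y' : B) : Φ.dsum x y - Φ.dsum x' y' = Φ.dsum (x - x') (y - y') := by
  simp only [dsum, conj_sub]; abel

/-- Blockwise `g² ≤ g`, hence `‖g‖² ≤ ‖g‖`. -/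
lemma norm_dsum_le_one {x y : B} (hx : 0 ≤ x) (hy : 0 ≤ y) (hx1 : ‖x‖ ≤ 1) (hy1 : ‖y‖ ≤ 1) :
    ‖Φ.dsum x y‖ ≤ 1 := by
  set g := Φ.dsum x y with hg
  have hg0 : 0 ≤ g := Φ.dsum_nonneg hx hy
  have h1 : g * g ≤ g := by
    rw [← sub_nonneg, hg, dsum_mul, dsum_sub]
    exact Φ.dsum_nonneg (sub_nonneg.2 (sq_le_self_of_norm_le_one hx hx1))
      (sub_nonneg.2 (sq_le_self_of_norm_le_one hy hy1))
  have h2 : ‖g‖ * ‖g‖ ≤ ‖g‖ := by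
    rw [← CStarRing.norm_star_mul_self, hg0.isSelfAdjoint.star_eq]
    refine CStarAlgebra.norm_le_norm_of_nonneg_of_le ?_ h1
    simpa [hg0.isSelfAdjoint.star_eq] using star_mul_self_nonneg g
  by_contra! h
  nlinarith

/-- The column `V_0 x + V_1 y`. -/
def col (x y : B) : B := Φ.L 0 x + Φ.L 1 y

lemma star_col_mul_col (x y x' y' : B) :
    star (Φ.col x y) * Φ.col x' y' = star x * x' + star y * y' := by
  simp [col, add_mul, mul_add, Φ.inner]

lemma dsum_mul_col (f f' x y : B) : Φ.dsum f f' * Φ.col x y = Φ.col (f * x) (f' * y) := by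
  simp [col, dsum, add_mul, mul_add, conj_mul_L]

/-- The isometries are only multipliers, so ideals need not be visibly invariant under them. The
span of the products `b y` with `y ∈ I` is again a dense ideal, hence contains `x`, and `V(b y) = (V
b) y` lies in `I`. -/
lemma L_mem_ped (i : Fin 2) {x : B} (hx : x ∈ Ped B) : Φ.L i x ∈ Ped B := by
  intro I hI hd
  let I2 : Submodule ℂ B := Submodule.span ℂ {z | ∃ b : B, ∃ y ∈ I, z = b * y}
  have hI2 : IsAlgIdeal I2 := by
    intro b z hz
    induction hz using Submodule.span_induction with
    | mem z hz =>
      obtain ⟨b', y, hy, rfl⟩ := hz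
      exact ⟨Submodule.subset_span ⟨b * b', y, hy, (mul_assoc _ _ _).symm⟩,
        Submodule.subset_span ⟨b', y * b, (hI b y hy).2, mul_assoc _ _ _⟩⟩
    | zero => simp
    | add z w _ _ hz hw =>
      exact ⟨by rw [mul_add]; exact I2.add_mem hz.1 hw.1,
        by rw [add_mul]; exact I2.add_mem hz.2 hw.2⟩
    | smul c z _ hz =>
      exact ⟨by rw [mul_smul_comm]; exact I2.smul_mem c hz.1,
        by rw [smul_mul_assoc]; exact I2.smul_mem c hz.2⟩
  have hd2 : Dense (I2 : Set B) := by
    refine dense_of_nonneg fun a ha => ?_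
    obtain ⟨s, -, rfl⟩ := exists_sqrt ha
    exact map_mem_closure (f := fun y => s * y) (by fun_prop) (hd s)
      fun y hy => Submodule.subset_span ⟨s, y, hy, rfl⟩
  have hx2 : x ∈ I2 := hx I2 hI2 hd2
  clear hx
  induction hx2 using Submodule.span_induction with
  | mem z hz =>
    obtain ⟨b, y, hy, rfl⟩ := hz
    rw [Φ.map_mul]
    exact (hI _ y hy).1
  | zero => simp
  | add z w _ _ hz hw => rw [map_add]; exact I.add_mem hz hw
  | smul c z _ hz => rw [map_smul]; exact I.smul_mem c hz

lemma conj_mem_ped (i j : Fin 2) {x : B} (hx : x ∈ Ped B) : Φ.conj i j x ∈ Ped B :=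
  Φ.L_mem_ped i (star_mem (Φ.L_mem_ped j (star_mem hx)))

/-- Block sums of elements of `S`. -/
inductive UnitGen (S : Set B) : B → Prop
  | base {f : B} : f ∈ S → UnitGen S f
  | dsum {f g : B} : UnitGen S f → UnitGen S g → UnitGen S (Φ.dsum f g)

variable {Φ}

lemma UnitGen.props {S : Set B} (hS : ∀ f ∈ S, f ∈ Ped B ∧ 0 ≤ f ∧ ‖f‖ ≤ 1) {f : B}
    (hf : Φ.UnitGen S f) : f ∈ Ped B ∧ 0 ≤ f ∧ ‖f‖ ≤ 1 := by
  induction hf with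
  | base h => exact hS _ h
  | dsum _ _ h1 h2 =>
    exact ⟨add_mem (Φ.conj_mem_ped 0 0 h1.1) (Φ.conj_mem_ped 1 1 h2.1),
      Φ.dsum_nonneg h1.2.1 h2.2.1, Φ.norm_dsum_le_one h1.2.1 h2.2.1 h1.2.2 h2.2.2⟩

variable (Φ)

/-- The ideal of the products `H⋆ K` such that `H` and `K` have a common left unit that is a
block sum of elements of `S`. -/
def unitIdeal (S : Set B) (hS : S.Nonempty) : Submodule ℂ B where
  carrier := {x | ∃ f H K, Φ.UnitGen S f ∧ f * H = H ∧ f * K = K ∧ x = star H * K}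
  zero_mem' := by
    obtain ⟨f, hf⟩ := hS
    exact ⟨f, 0, 0, .base hf, by simp, by simp, by simp⟩
  add_mem' := by
    rintro _ _ ⟨f, H, K, hf, hH, hK, rfl⟩ ⟨f', H', K', hf', hH', hK', rfl⟩
    exact ⟨Φ.dsum f f', Φ.col H H', Φ.col K K', hf.dsum hf', by rw [dsum_mul_col, hH, hH'],
      by rw [dsum_mul_col, hK, hK'], (Φ.star_col_mul_col _ _ _ _).symm⟩
  smul_mem' := by
    rintro c _ ⟨f, H, K, hf, hH, hK, rfl⟩
    exact ⟨f, H, c • K, hf, hH, by rw [mul_smul_comm, hK], (mul_smul_comm _ _ _).symm⟩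

lemma isAlgIdeal_unitIdeal {S : Set B} (hS : S.Nonempty) : IsAlgIdeal (Φ.unitIdeal S hS) := by
  rintro b _ ⟨f, H, K, hf, hH, hK, rfl⟩
  exact ⟨⟨f, H * star b, K, hf, by rw [← mul_assoc, hH], hK, by
      rw [star_mul, star_star, mul_assoc]⟩,
    ⟨f, H, K * b, hf, hH, by rw [← mul_assoc, hK], mul_assoc _ _ _⟩⟩

variable {Φ}

/-- Positive elements of the ideal are of the form `G⋆ G`, where `G` has a left unit. -/
lemma exists_factor_of_mem_unitIdeal {S : Set B} {hS : S.Nonempty} {x : B} (hx : 0 ≤ x)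
    (h : x ∈ Φ.unitIdeal S hS) : ∃ f G, Φ.UnitGen S f ∧ f * G = G ∧ star G * G = x := by
  obtain ⟨f, H, K, hf, hH, hK, hxe⟩ := h
  have hxe' : x = star K * H := by
    rw [← hx.isSelfAdjoint.star_eq, hxe, star_mul, star_star]
  -- Expanding `(H - K)⋆(H - K) ≥ 0` with `x = H⋆K = K⋆H` gives `2x ≤ H⋆H + K⋆K`, the square of the
  -- column.
  have h1 : x ≤ star (Φ.col H K) * Φ.col H K := by
    rw [star_col_mul_col]
    have h2 : 0 ≤ star (H - K) * (H - K) := star_mul_self_nonneg _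
    have h3 : star (H - K) * (H - K) = star H * H + star K * K - (x + x) := by
      nth_rw 1 [hxe]; rw [hxe', star_sub]; noncomm_ring
    rw [h3, sub_nonneg] at h2
    exact (le_add_of_nonneg_left hx).trans h2
  obtain ⟨G, hG, hG'⟩ := exists_factor_of_le hx h1
  exact ⟨Φ.dsum f f, G, hf.dsum hf, hG' _ (by rw [dsum_mul_col, hH, hK]), hG⟩

/-- The elements `f_ε(e)` for `e ≥ 0`. -/
def cutoffs (B : Type*) [NonUnitalCStarAlgebra B] [PartialOrder B] [StarOrderedRing B] : Set B :=
  {f | ∃ ε : ℝ, 0 < ε ∧ ∃ e : B, 0 ≤ e ∧ f = cfcₙ (fEps ε) e}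

lemma cutoffs_props : ∀ f ∈ cutoffs B, f ∈ Ped B ∧ 0 ≤ f ∧ ‖f‖ ≤ 1 := by
  rintro _ ⟨ε, hε, e, -, rfl⟩
  exact ⟨fEps_mem_ped e hε, fE_nonneg _ _, norm_fE_le_one _ _⟩

lemma cutoffs_nonempty : (cutoffs B).Nonempty := ⟨_, 1, one_pos, 0, le_rfl, rfl⟩

variable (Φ)

/-- It suffices that the ideal is dense: `f² a` with `f = f_ε(a)` is close to `a`, and `f_{ε/2}(a)`
is a unit for both of its factors. -/
lemma mem_unitIdeal_of_mem_ped {x : B} (hx : x ∈ Ped B) :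
    x ∈ Φ.unitIdeal (cutoffs B) cutoffs_nonempty := by
  refine hx _ (Φ.isAlgIdeal_unitIdeal _) (dense_of_nonneg fun a ha => ?_)
  rw [Metric.mem_closure_iff]
  intro δ hδ
  set f := cfcₙ (fEps (δ / 5)) a with hf
  have hδ5 : 0 < δ / 5 := by positivity
  refine ⟨f * (f * a), ⟨cfcₙ (fEps (δ / 5 / 2)) a, f, f * a, .base ⟨_, by positivity, a, ha, rfl⟩,
    fE_mul_fE (by positivity) (by linarith) a, ?_, ?_⟩, ?_⟩
  · rw [← mul_assoc, fE_mul_fE (by positivity) (by linarith) a]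
  · rw [(fE_isSelfAdjoint _ _).star_eq]
  · have h1 := norm_sub_fE_mul_le hδ5 ha
    have h2 : ‖f * (a - f * a)‖ ≤ ‖a - f * a‖ :=
      (norm_mul_le _ _).trans (mul_le_of_le_one_left (norm_nonneg _) (norm_fE_le_one _ _))
    rw [dist_eq_norm]
    have e : a - f * (f * a) = (a - f * a) + f * (a - f * a) := by rw [mul_sub]; abel
    rw [e]
    refine (norm_add_le _ _).trans_lt ?_
    linarith

/-- Positive elements of the Pedersen ideal are of the form `G⋆ G`, where `G` has a left unit in
the Pedersen ideal. -/
lemma exists_factor_of_mem_ped (Φ : IsometryPair B) {x : B} (hx : 0 ≤ x) (h : x ∈ Ped B) :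
    ∃ f G : B, (f ∈ Ped B ∧ 0 ≤ f ∧ ‖f‖ ≤ 1) ∧ f * G = G ∧ star G * G = x := by
  obtain ⟨f, G, hf, hG, hGx⟩ := exists_factor_of_mem_unitIdeal hx (Φ.mem_unitIdeal_of_mem_ped h)
  exact ⟨f, G, hf.props cutoffs_props, hG, hGx⟩

lemma _root_.TracialCuntz.mem_ped_of_unit {f G : B} (hf : f ∈ Ped B) (h : f * G = G) : G ∈ Ped B := by
  rw [← h]; exact mul_mem_ped_right G hf

/-- Self-adjoint elements of the Pedersen ideal are differences of orthogonal positive elements of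
the Pedersen ideal. -/
lemma exists_pos_sub_pos (Φ : IsometryPair B) {x : B} (hx : IsSelfAdjoint x) (h : x ∈ Ped B) :
    ∃ p q : B, p ∈ Ped B ∧ q ∈ Ped B ∧ 0 ≤ p ∧ 0 ≤ q ∧ p * q = 0 ∧ q * p = 0 ∧ x = p - q := by
  have hxx : star x * x ∈ Ped B := mul_mem_ped_left _ h
  obtain ⟨f, G, hf, hG, hGx⟩ := Φ.exists_factor_of_mem_ped (star_mul_self_nonneg x) hxx
  -- `|x|` inherits the unit of `G`, so it is in the Pedersen ideal; then `x⁺` and `x⁻` are the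
  -- halves of `|x| + x` and `|x| - x`.
  have h1 : star G * G = CFC.abs x * CFC.abs x := by rw [hGx, CFC.abs_mul_abs]
  obtain ⟨K, hK, hK'⟩ := exists_factor_abs (CFC.abs_nonneg x) h1
  have h2 : CFC.abs x ∈ Ped B := by
    rw [← hK]; exact mul_mem_ped_left _ (mem_ped_of_unit hf.1 (hK' f hG))
  have h3 : x⁺ - x⁻ = x := CFC.posPart_sub_negPart x hx
  have h4 : x⁺ + x⁻ = CFC.abs x := CFC.posPart_add_negPart x hx
  have hp : (2 : ℂ) • x⁺ = CFC.abs x + x := by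
    rw [two_smul, ← h4]; nth_rw 5 [← h3]; abel
  have hq : (2 : ℂ) • x⁻ = CFC.abs x - x := by
    rw [two_smul, ← h4]; nth_rw 5 [← h3]; abel
  have half : ∀ z : B, (2 : ℂ) • z ∈ Ped B → z ∈ Ped B := fun z hz => by
    simpa [smul_smul] using SMulMemClass.smul_mem (2⁻¹ : ℂ) hz
  refine ⟨x⁺, x⁻, ?_, ?_, CFC.posPart_nonneg x, CFC.negPart_nonneg x,
    CFC.posPart_mul_negPart x, CFC.negPart_mul_posPart x, h3.symm⟩
  · exact half _ (hp ▸ add_mem h2 h)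
  · exact half _ (hq ▸ sub_mem h2 h)

end IsometryPair

/-! ### Values and dimension functions of quasitraces. -/

section Values

variable {B : Type*} [NonUnitalCStarAlgebra B]

open Classical in
/-- The real part of `τ(x)`, extended by `0` outside the Pedersen ideal. -/
noncomputable def val (τ : Ped B → ℂ) (x : B) : ℝ := if h : x ∈ Ped B then (τ ⟨x, h⟩).re else 0

lemma val_of_mem (τ : Ped B → ℂ) {x : B} (h : x ∈ Ped B) : val τ x = (τ ⟨x, h⟩).re := dif_pos h

/-- The dimension function `d_τ`. -/
noncomputable def dim (τ : Ped B → ℂ) (a : B) : ℝ≥0∞ :=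
  ⨆ n : ℕ, ENNReal.ofReal (val τ (cfcₙ (fEps (1 / ((n : ℝ) + 1))) a))

variable {τ : Ped B → ℂ}

lemma fE_mem (a : B) {ε : ℝ} (hε : 0 < ε) : cfcₙ (fEps ε) a ∈ Ped B := fEps_mem_ped a hε

end Values

namespace IsQuasitrace

open scoped ComplexOrder

section Basic

variable {B : Type*} [NonUnitalCStarAlgebra B] {τ : Ped B → ℂ}

lemma val_sq_nonneg (hτ : IsQuasitrace τ) {x : B} (hx : x ∈ Ped B) : 0 ≤ val τ (star x * x) := by
  have h1 : star x * x ∈ Ped B := mul_mem (star_mem hx) hx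
  rw [val_of_mem τ h1]
  exact (Complex.nonneg_iff.1 (hτ.nonneg ⟨x, hx⟩)).1

lemma val_tracial (hτ : IsQuasitrace τ) {x : B} (hx : x ∈ Ped B) :
    val τ (star x * x) = val τ (x * star x) := by
  rw [val_of_mem τ (mul_mem (star_mem hx) hx), val_of_mem τ (mul_mem hx (star_mem hx))]
  exact congrArg Complex.re (hτ.tracial ⟨x, hx⟩)

/-- Commuting self-adjoint elements generate a commutative ⋆-subalgebra. -/
lemma linear_of_commute (hτ : IsQuasitrace τ) {x y : Ped B} (hx : IsSelfAdjoint x)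
    (hy : IsSelfAdjoint y) (h : x * y = y * x) :
    τ (x + y) = τ x + τ y ∧ ∀ c : ℂ, τ (c • x) = c * τ x := by
  let C := NonUnitalStarAlgebra.adjoin ℂ ({x, y} : Set (Ped B))
  have hC : ∀ a ∈ C, ∀ b ∈ C, a * b = b * a := by
    have := NonUnitalStarAlgebra.isMulCommutative_adjoin (R := ℂ) (s := ({x, y} : Set (Ped B)))
      (by
        rintro a (rfl | rfl) b (rfl | rfl)
        exacts [rfl, h, h.symm, rfl])
      (by
        rintro a (rfl | rfl) b (rfl | rfl)
        · rw [hx.star_eq]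
        · rw [hy.star_eq, h]
        · rw [hx.star_eq, h]
        · rw [hy.star_eq])
    intro a ha b hb
    exact congrArg Subtype.val (this.is_comm.comm (⟨a, ha⟩ : C) ⟨b, hb⟩)
  obtain ⟨h1, h2⟩ := hτ.linear_of_comm C hC
  have hxC : x ∈ C := NonUnitalStarAlgebra.subset_adjoin ℂ _ (by simp)
  have hyC : y ∈ C := NonUnitalStarAlgebra.subset_adjoin ℂ _ (by simp)
  exact ⟨h1 x hxC y hyC, fun c => h2 c x hxC⟩

lemma val_add (hτ : IsQuasitrace τ) {x y : B} (hx : x ∈ Ped B) (hy : y ∈ Ped B)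
    (hxs : IsSelfAdjoint x) (hys : IsSelfAdjoint y) (h : x * y = y * x) :
    val τ (x + y) = val τ x + val τ y := by
  rw [val_of_mem τ hx, val_of_mem τ hy, val_of_mem τ (add_mem hx hy), ← Complex.add_re]
  exact congrArg Complex.re (hτ.linear_of_commute (x := ⟨x, hx⟩) (y := ⟨y, hy⟩)
    (Subtype.ext hxs) (Subtype.ext hys) (Subtype.ext h)).1

lemma val_smul (hτ : IsQuasitrace τ) {x : B} (hx : x ∈ Ped B) (hxs : IsSelfAdjoint x) (c : ℝ) :
    val τ (c • x) = c * val τ x := by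
  have hm : (c : ℂ) • x ∈ Ped B := SMulMemClass.smul_mem _ hx
  have e : c • x = (c : ℂ) • x := (Complex.coe_smul c x).symm
  rw [e, val_of_mem τ hx, val_of_mem τ hm, ← Complex.re_ofReal_mul]
  exact congrArg Complex.re ((hτ.linear_of_commute (x := ⟨x, hx⟩) (y := ⟨x, hx⟩)
    (Subtype.ext hxs) (Subtype.ext hxs) rfl).2 c)

lemma smul_mem_ped {x : B} (hx : x ∈ Ped B) (c : ℝ) : c • x ∈ Ped B := by
  rw [← Complex.coe_smul c x]; exact SMulMemClass.smul_mem _ hx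

lemma val_zero (hτ : IsQuasitrace τ) : val τ 0 = 0 := by
  have := hτ.val_smul (zero_mem (Ped B)) (IsSelfAdjoint.zero B) 0
  simpa using this

lemma val_sub (hτ : IsQuasitrace τ) {x y : B} (hx : x ∈ Ped B) (hy : y ∈ Ped B)
    (hxs : IsSelfAdjoint x) (hys : IsSelfAdjoint y) (h : x * y = y * x) :
    val τ (x - y) = val τ x - val τ y := by
  have := hτ.val_add (sub_mem hx hy) hy (hxs.sub hys) hys (by rw [sub_mul, mul_sub, h])
  rw [sub_add_cancel] at this
  linarith

end Basic

variable {B : Type*} [NonUnitalCStarAlgebra B] [PartialOrder B] [StarOrderedRing B]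
variable {τ : Ped B → ℂ}

/-- Positivity is given for squares `G⋆G` with `G` in the Pedersen ideal. The square root of `x` is
not used for `G`; the factorization supplies a `G` with a unit there. -/
lemma val_nonneg (hτ : IsQuasitrace τ) (Φ : IsometryPair B) {x : B} (hx : x ∈ Ped B)
    (h : 0 ≤ x) : 0 ≤ val τ x := by
  obtain ⟨f, G, hf, hG, rfl⟩ := Φ.exists_factor_of_mem_ped h hx
  exact hτ.val_sq_nonneg (mem_ped_of_unit hf.1 hG)

/-- Commutation is needed to split `τ(y - x)`. Monotonicity without it is available only for the
dimension function. -/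
lemma val_mono (hτ : IsQuasitrace τ) (Φ : IsometryPair B) {x y : B} (hx : x ∈ Ped B)
    (hy : y ∈ Ped B) (hx0 : IsSelfAdjoint x) (h : x ≤ y) (hc : x * y = y * x) :
    val τ x ≤ val τ y := by
  have hys : IsSelfAdjoint y := by
    have := (sub_nonneg.2 h).isSelfAdjoint.add hx0
    rwa [sub_add_cancel] at this
  have := hτ.val_nonneg Φ (sub_mem hy hx) (sub_nonneg.2 h)
  rw [hτ.val_sub hy hx hys hx0 hc.symm] at this
  linarith

lemma val_le_of_unit (hτ : IsQuasitrace τ) (Φ : IsometryPair B) {x f : B} (hx : 0 ≤ x)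
    (hf : f ∈ Ped B) (hf0 : 0 ≤ f) (hf1 : ‖f‖ ≤ 1) (h : f * x = x) :
    val τ x ≤ ‖x‖ * val τ f := by
  rw [← hτ.val_smul hf hf0.isSelfAdjoint]
  refine hτ.val_mono Φ (mem_ped_of_unit hf h) (smul_mem_ped hf _) hx.isSelfAdjoint
    (le_norm_smul_of_unit hx hf0 hf1 h) ?_
  have h2 := congrArg star h
  rw [star_mul, hf0.isSelfAdjoint.star_eq, hx.isSelfAdjoint.star_eq] at h2
  rw [mul_smul_comm, smul_mul_assoc, h, h2]

/-- `S⋆S` may be replaced by `SS⋆`, which has the same value and norm and has `f` as a unit, hence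
commutes with `f`. -/
lemma val_le_of_factor (hτ : IsQuasitrace τ) (Φ : IsometryPair B) {S f : B}
    (hf : f ∈ Ped B) (hf0 : 0 ≤ f) (hf1 : ‖f‖ ≤ 1) (h : f * S = S) :
    val τ (star S * S) ≤ ‖star S * S‖ * val τ f := by
  rw [hτ.val_tracial (mem_ped_of_unit hf h), CStarRing.norm_star_mul_self,
    ← CStarRing.norm_self_mul_star]
  exact hτ.val_le_of_unit Φ (mul_star_self_nonneg S) hf hf0 hf1 (by rw [← mul_assoc, h])

/-- Cut-downs of elements close to `T⋆ T` are of the form `S⋆ S`, where `S` has the same left units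
as `T`. -/
lemma _root_.TracialCuntz.exists_factor_fE {c T : B} {δ : ℝ} (hc : 0 ≤ c) (hδ : 0 < δ)
    (h : ‖c - star T * T‖ < δ / 2) :
    ∃ S : B, star S * S = cfcₙ (fEps δ) c ∧ ∀ f : B, f * T = T → f * S = S := by
  obtain ⟨G, hG, hG'⟩ := exists_factor_cut hc (half_pos hδ) h
  have hδ2 : (0 : ℝ) ≤ 2 / δ := by positivity
  -- Pointwise `f_δ(t) ≤ (2/δ)(t - δ/2)_+`, and the right side is a scaled `G⋆G`.
  have h1 : cfcₙ (fEps δ) c ≤ star ((Real.sqrt (2 / δ)) • G) * (Real.sqrt (2 / δ) • G) := by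
    rw [star_smul, smul_mul_smul_comm, hG, star_trivial, Real.mul_self_sqrt hδ2,
      ← cfcₙ_smul (2 / δ) (cutFun (δ / 2)) c (continuous_cutFun _).continuousOn
        (cutFun_zero (by positivity))]
    refine cfcₙ_mono (fun t _ => ?_) (hf := (continuous_fEps δ).continuousOn)
      (hg := ((continuous_cutFun (δ / 2)).const_smul (2 / δ) :).continuousOn) (hf0 := fEps_zero δ)
      (hg0 := by simp [cutFun_zero (half_pos hδ).le])
    rcases le_total t δ with ht | ht
    · rw [fEps_eq_zero hδ ht]
      exact smul_nonneg hδ2 (le_max_right _ _)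
    · refine (fEps_le_one _ _).trans ?_
      have : δ / 2 ≤ cutFun (δ / 2) t := le_trans (by linarith) (le_max_left _ _)
      rw [smul_eq_mul]
      calc (1 : ℝ) = 2 / δ * (δ / 2) := by field_simp
        _ ≤ _ := by gcongr
  obtain ⟨S, hS, hS'⟩ := exists_factor_of_le (fE_nonneg _ _) h1
  exact ⟨S, hS, fun f hf => hS' f (by rw [mul_smul_comm, hG' f hf])⟩

lemma val_fE_le_of_factor (hτ : IsQuasitrace τ) (Φ : IsometryPair B) {c T f : B} {δ : ℝ}
    (hc : 0 ≤ c) (hδ : 0 < δ) (h : ‖c - star T * T‖ < δ / 2)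
    (hf : f ∈ Ped B) (hf0 : 0 ≤ f) (hf1 : ‖f‖ ≤ 1) (hfT : f * T = T) :
    val τ (cfcₙ (fEps δ) c) ≤ val τ f := by
  obtain ⟨S, hS, hS'⟩ := exists_factor_fE hc hδ h
  rw [← hS]
  refine (hτ.val_le_of_factor Φ hf hf0 hf1 (hS' f hfT)).trans ?_
  rw [hS]
  exact mul_le_of_le_one_left (hτ.val_nonneg Φ hf hf0) (norm_fE_le_one _ _)

/-- The basic estimate of the dimension function. -/
lemma dim_le_of_forall (hτ : IsQuasitrace τ) (Φ : IsometryPair B) {c : B} {M : ℝ≥0∞} (hc : 0 ≤ c)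
    (h : ∀ ε : ℝ, 0 < ε → ∃ T f : B, ‖c - star T * T‖ < ε ∧ f ∈ Ped B ∧ 0 ≤ f ∧ ‖f‖ ≤ 1 ∧
      f * T = T ∧ ENNReal.ofReal (val τ f) ≤ M) : dim τ c ≤ M := by
  refine iSup_le fun n => ?_
  have hn : (0 : ℝ) < 1 / ((n : ℝ) + 1) := Nat.one_div_pos_of_nat
  obtain ⟨T, f, hT, hf, hf0, hf1, hfT, hM⟩ := h _ (half_pos hn)
  exact (ENNReal.ofReal_le_ofReal
    (hτ.val_fE_le_of_factor Φ hc hn hT hf hf0 hf1 hfT)).trans hM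

lemma val_fE_anti (hτ : IsQuasitrace τ) (Φ : IsometryPair B) (a : B) {δ ε : ℝ} (hδ : 0 < δ)
    (h : δ ≤ ε) : val τ (cfcₙ (fEps ε) a) ≤ val τ (cfcₙ (fEps δ) a) := by
  refine hτ.val_mono Φ (fE_mem a (hδ.trans_le h)) (fE_mem a hδ) (fE_isSelfAdjoint _ _) ?_ ?_
  · exact cfcₙ_mono (fun t _ => fEps_anti hδ h) (hf := (continuous_fEps ε).continuousOn)
      (hg := (continuous_fEps δ).continuousOn) (hf0 := fEps_zero ε) (hg0 := fEps_zero δ)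
  · exact cfcₙ_commute_cfcₙ _ _ _

lemma val_fE_le_dim (hτ : IsQuasitrace τ) (Φ : IsometryPair B) (a : B) {δ : ℝ} (hδ : 0 < δ) :
    ENNReal.ofReal (val τ (cfcₙ (fEps δ) a)) ≤ dim τ a := by
  obtain ⟨n, hn⟩ := exists_nat_one_div_lt hδ
  exact (ENNReal.ofReal_le_ofReal (hτ.val_fE_anti Φ a Nat.one_div_pos_of_nat hn.le)).trans
    (le_iSup (fun n : ℕ => ENNReal.ofReal (val τ (cfcₙ (fEps (1 / ((n : ℝ) + 1))) a))) n)

lemma dim_le_of_unit (hτ : IsQuasitrace τ) (Φ : IsometryPair B) {c f : B} (hc : 0 ≤ c)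
    (hf : f ∈ Ped B) (hf0 : 0 ≤ f) (hf1 : ‖f‖ ≤ 1) (h : f * c = c) :
    dim τ c ≤ ENNReal.ofReal (val τ f) := by
  obtain ⟨s, hs, hsc⟩ := exists_sqrt hc
  refine hτ.dim_le_of_forall Φ hc fun ε hε => ⟨s, f, ?_, hf, hf0, hf1, mul_sqrt_eq hs hsc h, le_rfl⟩
  rw [hs.isSelfAdjoint.star_eq, hsc, sub_self, norm_zero]; exact hε

lemma _root_.TracialCuntz.tendsto_star_fE_mul {T b : B} (h : InHer b T) :
    Tendsto (fun n : ℕ => star (cfcₙ (fEps (1 / ((n : ℝ) + 1))) b * T) *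
      (cfcₙ (fEps (1 / ((n : ℝ) + 1))) b * T)) atTop (𝓝 (star T * T)) :=
  (Tendsto.star h).mul h

lemma dim_le_of_inHer_factor (hτ : IsQuasitrace τ) (Φ : IsometryPair B) {c b : B} (hc : 0 ≤ c)
    (h : ∀ ε : ℝ, 0 < ε → ∃ T : B, InHer b T ∧ ‖c - star T * T‖ < ε) : dim τ c ≤ dim τ b := by
  refine hτ.dim_le_of_forall Φ hc fun ε hε => ?_
  obtain ⟨T, hT, hcT⟩ := h ε hε
  have h1 := (tendsto_const_nhds (x := c)).sub (tendsto_star_fE_mul hT) |>.norm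
  obtain ⟨n, hn⟩ := (h1.eventually_lt_const hcT).exists
  have hn0 : (0 : ℝ) < 1 / ((n : ℝ) + 1) := Nat.one_div_pos_of_nat
  refine ⟨_, cfcₙ (fEps (1 / ((n : ℝ) + 1) / 2)) b, hn, fE_mem b (half_pos hn0), fE_nonneg _ _,
    norm_fE_le_one _ _, ?_, hτ.val_fE_le_dim Φ b (half_pos hn0)⟩
  rw [← mul_assoc, fE_mul_fE (half_pos hn0) (by linarith)]

lemma dim_le_of_cuntzLE (hτ : IsQuasitrace τ) (Φ : IsometryPair B) {a b : B} (ha : 0 ≤ a)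
    (hb : 0 ≤ b) (h : CuntzLE a b) : dim τ a ≤ dim τ b := by
  obtain ⟨z, hz⟩ := h
  obtain ⟨s, hs, hsb⟩ := exists_sqrt hb
  refine hτ.dim_le_of_inHer_factor Φ ha fun ε hε => ?_
  obtain ⟨k, hk⟩ := ((Metric.tendsto_nhds.1 hz) ε hε).exists
  refine ⟨s * z k, (InHer.sqrt_of_le hs hsb le_rfl (InHer.self hb)).mul_right _, ?_⟩
  rw [dist_comm, dist_eq_norm] at hk
  rwa [star_mul, hs.isSelfAdjoint.star_eq, mul_assoc, ← mul_assoc s s, hsb, ← mul_assoc]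

lemma dim_le_of_inHer (hτ : IsQuasitrace τ) (Φ : IsometryPair B) {x e : B} (he : 0 ≤ e)
    (hx : 0 ≤ x) (h : InHer e x) : dim τ x ≤ dim τ e :=
  hτ.dim_le_of_cuntzLE Φ hx he (h.cuntzLE he hx)

/-- `G` lies in the closed right ideal of `GG⋆`. Applied to `G⋆`, this also gives the reverse
inequality. -/
lemma dim_star_mul_self (hτ : IsQuasitrace τ) (Φ : IsometryPair B) (G : B) :
    dim τ (star G * G) ≤ dim τ (G * star G) := by
  refine hτ.dim_le_of_inHer_factor Φ (star_mul_self_nonneg G) fun ε hε => ⟨G, ?_, by simpa using hε⟩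
  have h0 : 0 ≤ G * star G := mul_star_self_nonneg G
  have h1 : Tendsto (fun n : ℕ => ‖G - cfcₙ (fEps (1 / ((n : ℝ) + 1))) (G * star G) * G‖)
      atTop (𝓝 0) := by
    have key : ∀ n : ℕ, ‖G - cfcₙ (fEps (1 / ((n : ℝ) + 1))) (G * star G) * G‖ ≤
        Real.sqrt (2 * (2 * (1 / ((n : ℝ) + 1)))) := fun n => by
      set f := cfcₙ (fEps (1 / ((n : ℝ) + 1))) (G * star G) with hf
      have hn0 : (0 : ℝ) < 1 / ((n : ℝ) + 1) := Nat.one_div_pos_of_nat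
      refine Real.le_sqrt_of_sq_le ?_
      rw [pow_two, ← CStarRing.norm_self_mul_star, star_sub, star_mul,
        (fE_isSelfAdjoint _ _).star_eq]
      have e : (G - f * G) * (star G - star G * f) =
          (G * star G - f * (G * star G)) - (G * star G - f * (G * star G)) * f := by
        noncomm_ring
      rw [e]
      have h2 := norm_sub_fE_mul_le hn0 h0
      refine (norm_sub_le _ _).trans ?_
      have h3 : ‖(G * star G - f * (G * star G)) * f‖ ≤ ‖G * star G - f * (G * star G)‖ :=
        (norm_mul_le _ _).trans (mul_le_of_le_one_right (norm_nonneg _) (norm_fE_le_one _ _))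
      linarith
    refine squeeze_zero (fun n => norm_nonneg _) key ?_
    have := (Real.continuous_sqrt.tendsto _).comp (tendsto_one_div_add_one.const_mul 2)
    simpa [Function.comp_def] using this
  rw [InHer, tendsto_iff_norm_sub_tendsto_zero]
  simpa only [norm_sub_rev] using h1

/-- Elements dominated by a positive element of the Pedersen ideal. -/
lemma exists_bound (Φ : IsometryPair B) {p : B} (hp : p ∈ Ped B) (hp0 : 0 ≤ p) :
    ∃ f : B, f ∈ Ped B ∧ 0 ≤ f ∧ ‖f‖ ≤ 1 ∧ ∀ (τ : Ped B → ℂ), IsQuasitrace τ →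
      ∀ x, 0 ≤ x → x ≤ p → x ∈ Ped B ∧ val τ x ≤ ‖x‖ * val τ f := by
  obtain ⟨f, G, hf, hG, rfl⟩ := Φ.exists_factor_of_mem_ped hp0 hp
  refine ⟨f, hf.1, hf.2.1, hf.2.2, fun τ hτ x hx hxp => ?_⟩
  obtain ⟨S, rfl, hS⟩ := exists_factor_of_le hx hxp
  exact ⟨mul_mem_ped_left _ (mem_ped_of_unit hf.1 (hS f hG)),
    hτ.val_le_of_factor Φ hf.1 hf.2.1 hf.2.2 (hS f hG)⟩

/-- `τ(p)` is at most `τ(f_δ(p))`, up to a uniformly small multiple of `τ(f)`. -/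
lemma exists_val_le_val_fE (Φ : IsometryPair B) {p : B} (hp : p ∈ Ped B) (hp0 : 0 ≤ p)
    (hp1 : ‖p‖ ≤ 1) :
    ∃ f : B, f ∈ Ped B ∧ 0 ≤ f ∧ ‖f‖ ≤ 1 ∧ ∀ (τ : Ped B → ℂ), IsQuasitrace τ → ∀ δ : ℝ, 0 < δ →
      val τ p ≤ val τ (cfcₙ (fEps δ) p) + 2 * δ * val τ f := by
  obtain ⟨f, hf, hf0, hf1, hb⟩ := exists_bound Φ hp hp0
  refine ⟨f, hf, hf0, hf1, fun τ hτ δ hδ => ?_⟩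
  -- Split `p = pg + (p - pg)`. The first part is at most `g` because `‖p‖ ≤ 1`; the second is below
  -- `p` and has norm at most `2δ`, so `exists_bound` controls its value.
  set g := cfcₙ (fEps δ) p with hg
  have hid : cfcₙ (fun t : ℝ => t) p = p := cfcₙ_id' ℝ p hp0.isSelfAdjoint
  have hpg : p * g = cfcₙ (fun t => t * fEps δ t) p := by
    rw [cfcₙ_mul (fun t => t) (fEps δ) p (by fun_prop) rfl
      (continuous_fEps _).continuousOn (fEps_zero _), hid]
  have hcont : Continuous fun t => t * fEps δ t := continuous_id.mul (continuous_fEps _)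
  have hc : p * g = g * p := by
    conv_lhs => rw [← hid]
    conv_rhs => rw [← hid]
    exact cfcₙ_commute_cfcₙ _ _ _
  have hpgm : p * g ∈ Ped B := mul_mem_ped_right _ hp
  have hgm : g ∈ Ped B := fE_mem p hδ
  have hpgs : IsSelfAdjoint (p * g) := by rw [hpg]; exact cfcₙ_predicate _ _
  have hpg0 : 0 ≤ p * g := by
    rw [hpg]
    exact cfcₙ_nonneg fun t ht => mul_nonneg (quasispectrum_nonneg_of_nonneg p hp0 t ht)
      (fEps_nonneg _ _)
  have hr0 : 0 ≤ p - p * g := by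
    have : p - p * g = cfcₙ (fun t => t - t * fEps δ t) p := by
      rw [cfcₙ_sub (fun t => t) (fun t => t * fEps δ t) p (by fun_prop) rfl
        hcont.continuousOn (by simp), hid, hpg]
    rw [this]
    exact cfcₙ_nonneg fun t ht => by
      have := quasispectrum_nonneg_of_nonneg p hp0 t ht
      nlinarith [fEps_le_one δ t]
  have h1 : val τ (p - p * g) = val τ p - val τ (p * g) :=
    hτ.val_sub hp hpgm hp0.isSelfAdjoint hpgs (by rw [mul_assoc, ← hc])
  have h2 : val τ (p - p * g) ≤ 2 * δ * val τ f := by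
    refine ((hb τ hτ _ hr0 (sub_le_self _ hpg0)).2).trans ?_
    exact mul_le_mul_of_nonneg_right (norm_sub_mul_fE_le hδ hp0) (hτ.val_nonneg Φ hf hf0)
  have h3 : val τ (p * g) ≤ val τ g := by
    refine hτ.val_mono Φ hpgm hgm hpgs ?_ (by rw [hc, mul_assoc, ← hc])
    rw [hpg]
    refine cfcₙ_mono (fun t ht => ?_) (hf := hcont.continuousOn)
      (hg := (continuous_fEps _).continuousOn) (hf0 := by simp) (hg0 := fEps_zero _)
    refine mul_le_of_le_one_left (fEps_nonneg _ _) ?_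
    refine (le_abs_self t).trans ?_
    exact (NonUnitalIsometricContinuousFunctionalCalculus.norm_quasispectrum_le p ht).trans hp1
  linarith

/-- Let `δ → 0` in `exists_val_le_val_fE`; norm continuity of `τ` is not assumed. -/
lemma val_le_dim (hτ : IsQuasitrace τ) (Φ : IsometryPair B) {p : B} (hp : p ∈ Ped B) (hp0 : 0 ≤ p)
    (hp1 : ‖p‖ ≤ 1) : ENNReal.ofReal (val τ p) ≤ dim τ p := by
  obtain ⟨f, hf, hf0, hf1, h⟩ := exists_val_le_val_fE Φ hp hp0 hp1
  rcases eq_or_ne (dim τ p) ∞ with hd | hd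
  · rw [hd]; exact le_top
  rw [ENNReal.ofReal_le_iff_le_toReal hd]
  have hf2 := hτ.val_nonneg Φ hf hf0
  refine le_of_forall_pos_le_add fun ε hε => ?_
  have hδ : 0 < ε / (2 * (val τ f + 1)) := by positivity
  refine (h τ hτ _ hδ).trans (add_le_add ?_ ?_)
  · exact (ENNReal.ofReal_le_iff_le_toReal hd).1 (hτ.val_fE_le_dim Φ p hδ)
  · calc 2 * (ε / (2 * (val τ f + 1))) * val τ f = ε * (val τ f / (val τ f + 1)) := by field_simp
      _ ≤ ε * 1 := by gcongr; rw [div_le_one (by positivity)]; linarith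
      _ = ε := mul_one ε

end IsQuasitrace

/-! ### Subadditivity and orthogonal additivity of the dimension function. -/

namespace IsQuasitrace

variable {B : Type*} [NonUnitalCStarAlgebra B] [PartialOrder B] [StarOrderedRing B]
variable {τ : Ped B → ℂ}

lemma dim_zero (hτ : IsQuasitrace τ) : dim τ 0 = 0 := by
  simp [dim, hτ.val_zero]

/-- A converse to `dim_le_of_forall`: `T` is `√b` cut by some `f_δ(b)`, and `f_{δ/2}(b)` is its
unit. -/
lemma exists_val_approx (hτ : IsQuasitrace τ) (Φ : IsometryPair B) {b : B} (hb : 0 ≤ b) {ε : ℝ}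
    (hε : 0 < ε) : ∃ T f : B, ‖b - star T * T‖ < ε ∧ f ∈ Ped B ∧ 0 ≤ f ∧ ‖f‖ ≤ 1 ∧
      f * T = T ∧ ENNReal.ofReal (val τ f) ≤ dim τ b := by
  obtain ⟨s, hs, hsb⟩ := exists_sqrt hb
  have hT := InHer.sqrt_of_le hs hsb le_rfl (InHer.self hb)
  have h1 := (tendsto_const_nhds (x := b)).sub (tendsto_star_fE_mul hT) |>.norm
  rw [hs.isSelfAdjoint.star_eq, hsb, sub_self, norm_zero] at h1
  obtain ⟨n, hn⟩ := (h1.eventually_lt_const hε).exists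
  have hn0 : (0 : ℝ) < 1 / ((n : ℝ) + 1) := Nat.one_div_pos_of_nat
  refine ⟨_, cfcₙ (fEps (1 / ((n : ℝ) + 1) / 2)) b, hn, fE_mem b (half_pos hn0), fE_nonneg _ _,
    norm_fE_le_one _ _, ?_, hτ.val_fE_le_dim Φ b (half_pos hn0)⟩
  rw [← mul_assoc, fE_mul_fE (half_pos hn0) (by linarith)]

/-- Lower semicontinuity: an approximation of a nearby `u n` also approximates `c`. -/
lemma dim_le_of_tendsto (hτ : IsQuasitrace τ) (Φ : IsometryPair B) {c : B} {M : ℝ≥0∞} {u : ℕ → B}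
    (hc : 0 ≤ c) (hu : ∀ n, 0 ≤ u n) (h : Tendsto u atTop (𝓝 c)) (hM : ∀ n, dim τ (u n) ≤ M) :
    dim τ c ≤ M := by
  refine hτ.dim_le_of_forall Φ hc fun ε hε => ?_
  obtain ⟨n, hn⟩ := (Metric.tendsto_nhds.1 h (ε / 2) (half_pos hε)).exists
  obtain ⟨T, f, hT, hf, hf0, hf1, hfT, hfd⟩ := hτ.exists_val_approx Φ (hu n) (half_pos hε)
  refine ⟨T, f, ?_, hf, hf0, hf1, hfT, hfd.trans (hM n)⟩
  rw [dist_comm, dist_eq_norm] at hn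
  calc ‖c - star T * T‖ = ‖(c - u n) + (u n - star T * T)‖ := by rw [sub_add_sub_cancel]
    _ ≤ _ := norm_add_le _ _
    _ < ε := by linarith

/-- For `x = G⋆G`, swapping the factors of `(V G⋆)(V G⋆)⋆` cancels the isometry and leaves `GG⋆`. -/
lemma val_conj (hτ : IsQuasitrace τ) (Φ : IsometryPair B) (i : Fin 2) {x : B} (hx : x ∈ Ped B)
    (h : 0 ≤ x) : val τ (Φ.conj i i x) = val τ x := by
  obtain ⟨f, G, hf, hG, rfl⟩ := Φ.exists_factor_of_mem_ped h hx
  have hGm : G ∈ Ped B := mem_ped_of_unit hf.1 hG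
  rw [Φ.conj_mul, ← hτ.val_tracial (Φ.L_mem_ped i (star_mem hGm)), Φ.inner_self, star_star]
  exact (hτ.val_tracial hGm).symm

lemma val_dsum (hτ : IsQuasitrace τ) (Φ : IsometryPair B) {x y : B} (hx : x ∈ Ped B) (h : 0 ≤ x)
    (hy : y ∈ Ped B) (h' : 0 ≤ y) : val τ (Φ.dsum x y) = val τ x + val τ y := by
  rw [IsometryPair.dsum, hτ.val_add (Φ.conj_mem_ped 0 0 hx) (Φ.conj_mem_ped 1 1 hy)
    (Φ.conj_self_nonneg 0 h).isSelfAdjoint (Φ.conj_self_nonneg 1 h').isSelfAdjoint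
    (by simp [Φ.conj_mul_conj]), hτ.val_conj Φ 0 hx h, hτ.val_conj Φ 1 hy h']

/-- The column `V₀S + V₁T` has square `S⋆S + T⋆T`, and the block sum of the units of `S` and `T` is
a unit for it. The two blocks commute, so the value of this unit is additive although `a` and `b`
need not commute. -/
lemma dim_add_le (hτ : IsQuasitrace τ) (Φ : IsometryPair B) {a b : B} (ha : 0 ≤ a) (hb : 0 ≤ b) :
    dim τ (a + b) ≤ dim τ a + dim τ b := by
  refine hτ.dim_le_of_forall Φ (add_nonneg ha hb) fun ε hε => ?_
  obtain ⟨S, f, hS, hf, hf0, hf1, hfS, hfd⟩ := hτ.exists_val_approx Φ ha (half_pos hε)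
  obtain ⟨T, g, hT, hg, hg0, hg1, hgT, hgd⟩ := hτ.exists_val_approx Φ hb (half_pos hε)
  refine ⟨Φ.col S T, Φ.dsum f g, ?_, add_mem (Φ.conj_mem_ped 0 0 hf) (Φ.conj_mem_ped 1 1 hg),
    Φ.dsum_nonneg hf0 hg0, Φ.norm_dsum_le_one hf0 hg0 hf1 hg1, by rw [Φ.dsum_mul_col, hfS, hgT], ?_⟩
  · rw [Φ.star_col_mul_col, add_sub_add_comm]
    refine (norm_add_le _ _).trans_lt ?_
    linarith
  · rw [hτ.val_dsum Φ hf hf0 hg hg0, ENNReal.ofReal_add (hτ.val_nonneg Φ hf hf0)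
      (hτ.val_nonneg Φ hg hg0)]
    exact add_le_add hfd hgd

lemma _root_.TracialCuntz.norm_add_le_one_of_orthogonal {f g : B} (hf : 0 ≤ f) (hg : 0 ≤ g)
    (hf1 : ‖f‖ ≤ 1) (hg1 : ‖g‖ ≤ 1) (h : f * g = 0) (h' : g * f = 0) : ‖f + g‖ ≤ 1 := by
  have h0 : 0 ≤ f + g := add_nonneg hf hg
  have h1 : (f + g) * (f + g) ≤ f + g := by
    rw [add_mul, mul_add, mul_add, h, h', zero_add, add_zero]
    exact add_le_add (sq_le_self_of_norm_le_one hf hf1) (sq_le_self_of_norm_le_one hg hg1)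
  have h2 : ‖f + g‖ * ‖f + g‖ ≤ ‖f + g‖ := by
    rw [← CStarRing.norm_star_mul_self, h0.isSelfAdjoint.star_eq]
    refine CStarAlgebra.norm_le_norm_of_nonneg_of_le ?_ h1
    simpa [h0.isSelfAdjoint.star_eq] using star_mul_self_nonneg (f + g)
  by_contra! h
  nlinarith

lemma _root_.TracialCuntz.mul_eq_zero_symm {a b : B} (ha : 0 ≤ a) (hb : 0 ≤ b) (h : a * b = 0) :
    b * a = 0 := by
  have := congrArg star h
  rwa [star_mul, star_zero, ha.isSelfAdjoint.star_eq, hb.isSelfAdjoint.star_eq] at this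

/-- The cut-offs of `a` and `b` are orthogonal, so their sum is a contraction in the Pedersen ideal
on which `τ` is additive, and it lies in the right ideal of `a + b`. -/
lemma le_dim_add (hτ : IsQuasitrace τ) (Φ : IsometryPair B) {a b : B} (ha : 0 ≤ a) (hb : 0 ≤ b)
    (h : a * b = 0) : dim τ a + dim τ b ≤ dim τ (a + b) := by
  have hab := add_nonneg ha hb
  have hm : ∀ c : B, Monotone fun n : ℕ =>
      ENNReal.ofReal (val τ (cfcₙ (fEps (1 / ((n : ℝ) + 1))) c)) := fun c m n hmn =>
    ENNReal.ofReal_le_ofReal (hτ.val_fE_anti Φ c Nat.one_div_pos_of_nat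
      (Nat.one_div_le_one_div hmn))
  rw [dim, dim, ENNReal.iSup_add_iSup_of_monotone (hm a) (hm b)]
  refine iSup_le fun n => ?_
  have hn : (0 : ℝ) < 1 / ((n : ℝ) + 1) := Nat.one_div_pos_of_nat
  set f := cfcₙ (fEps (1 / ((n : ℝ) + 1))) a with hf
  set g := cfcₙ (fEps (1 / ((n : ℝ) + 1))) b with hg
  have hf0 : 0 ≤ f := fE_nonneg _ _
  have hg0 : 0 ≤ g := fE_nonneg _ _
  have hfg : f * g = 0 := mul_fE_eq_zero hn hb.isSelfAdjoint (fE_mul_eq_zero hn ha.isSelfAdjoint h)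
  have hgf : g * f = 0 := mul_eq_zero_symm hf0 hg0 hfg
  have hfm : f ∈ Ped B := fE_mem a hn
  have hgm : g ∈ Ped B := fE_mem b hn
  rw [← ENNReal.ofReal_add (hτ.val_nonneg Φ hfm hf0) (hτ.val_nonneg Φ hgm hg0),
    ← hτ.val_add hfm hgm hf0.isSelfAdjoint hg0.isSelfAdjoint (by rw [hfg, hgf])]
  refine (hτ.val_le_dim Φ (add_mem hfm hgm) (add_nonneg hf0 hg0)
    (norm_add_le_one_of_orthogonal hf0 hg0 (norm_fE_le_one _ _) (norm_fE_le_one _ _) hfg hgf)).trans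
    (hτ.dim_le_of_inHer Φ hab (add_nonneg hf0 hg0) (InHer.add ?_ ?_))
  · obtain ⟨c, hc, -⟩ := exists_fE_eq_mul hn ha.isSelfAdjoint
    exact (InHer.of_le ha (le_add_of_nonneg_right hb)).trans ha (InHer.of_mul ha c hc)
  · obtain ⟨c, hc, -⟩ := exists_fE_eq_mul hn hb.isSelfAdjoint
    exact (InHer.of_le hb (le_add_of_nonneg_left ha)).trans hb (InHer.of_mul hb c hc)

lemma dim_add_of_orthogonal (hτ : IsQuasitrace τ) (Φ : IsometryPair B) {a b : B} (ha : 0 ≤ a)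
    (hb : 0 ≤ b) (h : a * b = 0) : dim τ (a + b) = dim τ a + dim τ b :=
  (hτ.dim_add_le Φ ha hb).antisymm (hτ.le_dim_add Φ ha hb h)

lemma dim_mono (hτ : IsQuasitrace τ) (Φ : IsometryPair B) {a b : B} (ha : 0 ≤ a) (h : a ≤ b) :
    dim τ a ≤ dim τ b :=
  hτ.dim_le_of_inHer Φ (ha.trans h) ha (InHer.of_le ha h)

lemma dim_le_smul (hτ : IsQuasitrace τ) (Φ : IsometryPair B) {a b : B} {C : ℝ} (ha : 0 ≤ a)
    (hb : 0 ≤ b) (h : a ≤ C • b) : dim τ a ≤ dim τ b :=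
  hτ.dim_le_of_inHer Φ hb ha (InHer.of_le_smul ha hb h)

lemma dim_smul (hτ : IsQuasitrace τ) (Φ : IsometryPair B) {a : B} {c : ℝ} (ha : 0 ≤ a)
    (hc : 0 < c) : dim τ (c • a) = dim τ a := by
  refine (hτ.dim_le_smul Φ (smul_nonneg hc.le ha) ha le_rfl).antisymm
    (hτ.dim_le_smul (C := c⁻¹) Φ ha (smul_nonneg hc.le ha) ?_)
  rw [smul_smul, inv_mul_cancel₀ hc.ne', one_smul]

/-- `d(g R g) ≤ d(R)`. -/
lemma dim_conj_le (hτ : IsQuasitrace τ) (Φ : IsometryPair B) {R : B} (hR : 0 ≤ R) (g : B) :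
    dim τ (star g * R * g) ≤ dim τ R :=
  hτ.dim_le_of_cuntzLE Φ (star_left_conjugate_nonneg hR g) hR ⟨fun _ => g, tendsto_const_nhds⟩

end IsQuasitrace

/-! ### Cut-offs near 1. -/

section Cof

/-- The function `1 - f_s(1 - t)`. -/
noncomputable def cof (s t : ℝ) : ℝ := 1 - fEps s (1 - t)

lemma continuous_cof (s : ℝ) : Continuous (cof s) :=
  continuous_const.sub ((continuous_fEps s).comp (continuous_const.sub continuous_id))

lemma cof_zero {s : ℝ} (hs : 0 < s) (hs' : s ≤ 1 / 4) : cof s 0 = 0 := by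
  rw [cof, fEps_eq_one hs (by linarith), sub_self]

lemma cof_one (s : ℝ) : cof s 1 = 1 := by rw [cof, sub_self, fEps_zero, sub_zero]

lemma cof_nonneg (s t : ℝ) : 0 ≤ cof s t := sub_nonneg.2 (fEps_le_one _ _)

lemma cof_le_one (s t : ℝ) : cof s t ≤ 1 := sub_le_self _ (fEps_nonneg _ _)

lemma cof_mul_cof {s t : ℝ} (r : ℝ) (h : 2 * t ≤ s) (ht : 0 < t) :
    cof s r * cof t r = cof t r := by
  have := fEps_mul_fEps ht h (1 - r)
  rw [cof, cof]
  linear_combination this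

variable {B : Type*} [NonUnitalCStarAlgebra B] [PartialOrder B] [StarOrderedRing B]

lemma cof_mem_ped (F : B) {s : ℝ} (hs : 0 < s) (hs' : s ≤ 1 / 4) : cfcₙ (cof s) F ∈ Ped B := by
  have h : cfcₙ (fEps (1 / 4)) F * cfcₙ (cof s) F = cfcₙ (cof s) F := by
    rw [← cfcₙ_mul (fEps (1 / 4)) (cof s) F (continuous_fEps _).continuousOn
      (fEps_zero _) (continuous_cof _).continuousOn (cof_zero hs hs')]
    congr 1
    funext t
    rcases le_total (1 / 2) t with h | h
    · rw [fEps_eq_one (by norm_num) (by linarith), one_mul]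
    · rw [cof, fEps_eq_one hs (by linarith), sub_self, mul_zero]
  exact mem_ped_of_unit (fE_mem F (by norm_num)) h

lemma cof_cfc_nonneg (s : ℝ) (F : B) : 0 ≤ cfcₙ (cof s) F := cfcₙ_nonneg fun t _ => cof_nonneg s t

lemma norm_cof_le_one (s : ℝ) (F : B) : ‖cfcₙ (cof s) F‖ ≤ 1 :=
  norm_cfcₙ_le fun t _ => by
    rw [Real.norm_eq_abs, abs_of_nonneg (cof_nonneg s t)]; exact cof_le_one s t

lemma cof_mul_cof_cfc {s t : ℝ} (hs : 0 < s) (hs' : s ≤ 1 / 4) (ht : 0 < t) (h : 2 * t ≤ s) (F : B) :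
    cfcₙ (cof s) F * cfcₙ (cof t) F = cfcₙ (cof t) F := by
  rw [← cfcₙ_mul (cof s) (cof t) F (continuous_cof _).continuousOn
    (cof_zero hs hs') (continuous_cof _).continuousOn (cof_zero ht (by linarith))]
  simp only [cof_mul_cof _ h ht]

lemma cof_mul_eq_self {s : ℝ} (hs : 0 < s) (hs' : s ≤ 1 / 4) {F x : B} (hF : IsSelfAdjoint F)
    (h : F * x = x) : cfcₙ (cof s) F * x = x :=
  cfcₙ_mul_eq_self hF h (continuous_cof s) (cof_zero hs hs') (cof_one s)

lemma exists_cof_eq_mul {s : ℝ} (hs : 0 < s) (hs' : s ≤ 1 / 4) {F : B} (hF : IsSelfAdjoint F) :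
    ∃ c : B, cfcₙ (cof s) F = F * c := by
  obtain ⟨c, hc, -⟩ := exists_fE_eq_mul (ε := 1 / 4) (by norm_num) hF
  refine ⟨c * cfcₙ (cof s) F, ?_⟩
  rw [← mul_assoc, ← hc]
  rw [← cfcₙ_mul (fEps (1 / 4)) (cof s) F (continuous_fEps _).continuousOn
    (fEps_zero _) (continuous_cof _).continuousOn (cof_zero hs hs')]
  congr 1
  funext t
  rcases le_total (1 / 2) t with h | h
  · rw [fEps_eq_one (by norm_num) (by linarith), one_mul]
  · rw [cof, fEps_eq_one hs (by linarith), sub_self, mul_zero]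

/-- As `s ≤ 1/4`, the function `cof s` vanishes for `t ≤ 1/2`. Hence `g² ≤ 2 g F g ≤ 2 g R g`, even
if `F` is not positive and does not commute with `R`. -/
lemma IsQuasitrace.dim_cof_le {τ : Ped B → ℂ} (hτ : IsQuasitrace τ) (Φ : IsometryPair B)
    {s : ℝ} (hs : 0 < s) (hs' : s ≤ 1 / 4) {F R : B} (hF : IsSelfAdjoint F) (hR : 0 ≤ R)
    (h : F ≤ R) : dim τ (cfcₙ (cof s) F) ≤ dim τ R := by
  set g := cfcₙ (cof s) F with hg
  have hg0 : 0 ≤ g := cof_cfc_nonneg s F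
  have h1 : g * g ≤ (2 : ℝ) • (star g * R * g) := by
    have h2 : g * g ≤ (2 : ℝ) • (g * F * g) := by
      rw [hg, cfcₙ_mul_mul hF (continuous_cof s) (cof_zero hs hs'),
        ← cfcₙ_mul (cof s) (cof s) F (continuous_cof _).continuousOn
        (cof_zero hs hs') (continuous_cof _).continuousOn (cof_zero hs hs'),
        ← cfcₙ_smul (2 : ℝ) (fun t => cof s t * t * cof s t) F
          (((continuous_cof s).mul continuous_id).mul (continuous_cof s)).continuousOn
          (by simp)]
      refine cfcₙ_mono (fun t _ => ?_)
        (hf := ((continuous_cof s).mul (continuous_cof s)).continuousOn)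
        (hg := ((((continuous_cof s).mul continuous_id).mul (continuous_cof s)).const_smul
          (2 : ℝ) :).continuousOn)
        (hf0 := by simp [cof_zero hs hs']) (hg0 := by simp)
      rw [smul_eq_mul]
      rcases le_total (1 / 2) t with h | h
      · nlinarith [mul_nonneg (cof_nonneg s t) (cof_nonneg s t)]
      · rw [cof, fEps_eq_one hs (by linarith), sub_self]; simp
    rw [hg0.isSelfAdjoint.star_eq]
    refine h2.trans (smul_le_smul_of_nonneg_left ?_ zero_le_two)
    have := star_left_conjugate_le_conjugate h g
    rwa [hg0.isSelfAdjoint.star_eq] at this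
  have hgg : 0 ≤ g * g := by
    simpa [hg0.isSelfAdjoint.star_eq] using star_mul_self_nonneg g
  have hz : 0 ≤ star g * R * g := star_left_conjugate_nonneg hR g
  have h3 : InHer (star g * R * g) g :=
    InHer.sqrt_of_le hg0 rfl le_rfl (InHer.of_le_smul hgg hz h1)
  exact (hτ.dim_le_of_inHer Φ hz hg0 h3).trans (hτ.dim_conj_le Φ hR g)

end Cof

/-! ### Isometries, matrix units and ideals of `A ⊗ 𝕂`. -/

namespace Stab

open UniformSpace

variable {A : Type u} [NonUnitalCStarAlgebra A]

lemma _root_.TracialCuntz.PreStab.exists_entry (x : PreStab A) : ∃ N, ∀ m, N ≤ m →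
    ∀ i j : Fin m, PreStab.term m x i j =
      if h : (i : ℕ) < N ∧ (j : ℕ) < N then PreStab.term N x ⟨i, h.1⟩ ⟨j, h.2⟩ else 0 := by
  obtain ⟨N, hN⟩ := x.2
  refine ⟨N, fun m hm i j => ?_⟩
  have : PreStab.term m x = pad N m (PreStab.term N x) := hN m hm
  rw [this, pad_apply]

/-- The matrix `a ⊗ e_{i,j}`. -/
def preUnit (i j : ℕ) (a : A) : PreStab A :=
  ⟨fun n => CStarMatrix.ofMatrix fun k l => if (k : ℕ) = i ∧ (l : ℕ) = j then a else 0,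
    max i j + 1, fun m _ => by
      ext k l
      change (if (k : ℕ) = i ∧ (l : ℕ) = j then a else 0) =
        if h : (k : ℕ) < max i j + 1 ∧ (l : ℕ) < max i j + 1 then
          (if (k : ℕ) = i ∧ (l : ℕ) = j then a else 0) else 0
      split_ifs <;> first | rfl | omega⟩

lemma term_preUnit (n i j : ℕ) (a : A) (k l : Fin n) :
    PreStab.term n (preUnit i j a) k l = if (k : ℕ) = i ∧ (l : ℕ) = j then a else 0 := rfl

/-- The isometry `e_k ↦ e_{2k+c}`. -/
def preIsometry (c : ℕ) : PreStab A →ₗ[ℂ] PreStab A where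
  toFun x := ⟨fun n => CStarMatrix.ofMatrix fun i j =>
      if (i : ℕ) % 2 = c then PreStab.term n x ⟨i / 2, by omega⟩ j else 0, by
    obtain ⟨N, hN⟩ := x.exists_entry
    refine ⟨2 * N + 2, fun m hm => ?_⟩
    ext i j
    change (if (i : ℕ) % 2 = c then PreStab.term m x ⟨i / 2, by omega⟩ j else 0) =
      if h : (i : ℕ) < 2 * N + 2 ∧ (j : ℕ) < 2 * N + 2 then
        (if (i : ℕ) % 2 = c then PreStab.term (2 * N + 2) x ⟨i / 2, by omega⟩ ⟨j, h.2⟩ else 0) else 0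
    rw [hN m (by omega)]
    by_cases h1 : (i : ℕ) % 2 = c
    · rw [if_pos h1]
      by_cases h3 : (i : ℕ) < 2 * N + 2 ∧ (j : ℕ) < 2 * N + 2
      · rw [dif_pos h3, if_pos h1, hN _ (by omega)]
      · rw [dif_neg h3, dif_neg]
        rintro ⟨h4, h5⟩
        simp only at h4
        omega
    · rw [if_neg h1]
      simp only [if_neg h1]
      split_ifs <;> rfl⟩
  map_add' x y := by
    refine Subtype.ext (funext fun n => ?_)
    ext i j
    change (if (i : ℕ) % 2 = c then PreStab.term n (x + y) ⟨i / 2, by omega⟩ j else 0) =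
      (if (i : ℕ) % 2 = c then PreStab.term n x ⟨i / 2, by omega⟩ j else 0) +
      (if (i : ℕ) % 2 = c then PreStab.term n y ⟨i / 2, by omega⟩ j else 0)
    rw [map_add]
    split_ifs <;> simp
  map_smul' z x := by
    refine Subtype.ext (funext fun n => ?_)
    ext i j
    change (if (i : ℕ) % 2 = c then PreStab.term n (z • x) ⟨i / 2, by omega⟩ j else 0) =
      z • (if (i : ℕ) % 2 = c then PreStab.term n x ⟨i / 2, by omega⟩ j else 0)
    rw [map_smul]
    split_ifs <;> simp

lemma term_preIsometry (c n : ℕ) (x : PreStab A) (i j : Fin n) :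
    PreStab.term n (preIsometry c x) i j =
      if (i : ℕ) % 2 = c then PreStab.term n x ⟨i / 2, by omega⟩ j else 0 := rfl

lemma preIsometry_mul (c : ℕ) (x y : PreStab A) :
    preIsometry c (x * y) = preIsometry c x * y := by
  refine Subtype.ext (funext fun n => ?_)
  ext i j
  change PreStab.term n (preIsometry c (x * y)) i j = PreStab.term n (preIsometry c x * y) i j
  rw [term_preIsometry, map_mul, map_mul, CStarMatrix.mul_apply, CStarMatrix.mul_apply]
  simp only [term_preIsometry]
  split_ifs <;> simp

/-- At a finite stage `n` the isometry loses the rows `k` with `2k + c ≥ n`. For large `n` these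
rows of `y` are zero, so the relation holds eventually but not at every stage. -/
lemma eventually_inner (c c' : Fin 2) (x y : PreStab A) : ∀ᶠ n in atTop,
    PreStab.term n (star (preIsometry c x) * preIsometry c' y) =
      PreStab.term n (if c = c' then star x * y else 0) := by
  obtain ⟨N, hN⟩ := y.exists_entry
  filter_upwards [eventually_ge_atTop (2 * N + 2)] with n hn
  ext i j
  rw [map_mul, map_star, CStarMatrix.mul_apply]
  simp only [CStarMatrix.star_apply, term_preIsometry]
  split_ifs with h
  · subst h
    rw [map_mul, map_star, CStarMatrix.mul_apply]
    simp only [CStarMatrix.star_apply]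
    symm
    have key : ∀ k : Fin n, k ∈ Finset.univ.filter (fun k : Fin n => 2 * (k : ℕ) + c < n) →
        2 * (k : ℕ) + c < n := fun k hk => (Finset.mem_filter.1 hk).2
    rw [← Finset.sum_filter_add_sum_filter_not Finset.univ (fun k : Fin n => 2 * (k : ℕ) + c < n),
      ← Finset.sum_filter_add_sum_filter_not Finset.univ (fun k : Fin n => (k : ℕ) % 2 = c)]
    congr 1
    · refine Finset.sum_bij (fun k hk => ⟨2 * k + c, key k hk⟩) ?_ ?_ ?_ ?_
      · intro k hk
        rw [Finset.mem_filter]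
        refine ⟨Finset.mem_univ _, ?_⟩
        simp only; omega
      · intro k _ l _ hkl
        have := congrArg Fin.val hkl
        ext; simp only at this; omega
      · intro k hk
        have hk2 := (Finset.mem_filter.1 hk).2
        refine ⟨⟨k / 2, by omega⟩, Finset.mem_filter.2 ⟨Finset.mem_univ _, ?_⟩, ?_⟩
        · simp only; omega
        · ext; simp only; omega
      · intro k hk
        have h1 : (2 * (k : ℕ) + c) % 2 = c := by omega
        have h2 : (2 * (k : ℕ) + c) / 2 = k := by omega
        simp only [h1, if_true, h2]
    · rw [Finset.sum_eq_zero, Finset.sum_eq_zero]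
      · intro k hk
        have hk2 := (Finset.mem_filter.1 hk).2
        simp [hk2]
      · intro k hk
        have hk2 := (Finset.mem_filter.1 hk).2
        rw [hN n (by omega) k j, dif_neg (by omega), mul_zero]
  · rw [map_zero, CStarMatrix.zero_apply]
    refine Finset.sum_eq_zero fun k _ => ?_
    split_ifs with h1 h2
    · exact absurd (Fin.ext (h1.symm.trans h2)) h
    all_goals simp

variable [PartialOrder A] [StarOrderedRing A]

/-- Eventually vanishing sequences have seminorm zero; the completion identifies them with `0`. -/
lemma of_eq_of_eventually {x y : PreStab A}
    (h : ∀ᶠ n in atTop, PreStab.term n x = PreStab.term n y) : of x = of y := by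
  have h0 : of (x - y) = 0 := by
    rw [← norm_eq_zero, norm_of]
    obtain ⟨N, hN⟩ := PreStab.exists_norm (x - y)
    obtain ⟨n, hn, hnN⟩ := (h.and (eventually_ge_atTop N)).exists
    rw [hN n hnN, map_sub, hn, sub_self, norm_zero]
  have := of_add (x - y) y
  rwa [sub_add_cancel, h0, zero_add] at this

lemma norm_preIsometry (c : Fin 2) (x : PreStab A) : ‖preIsometry c x‖ = ‖x‖ := by
  have h : of (star (preIsometry c x) * preIsometry c x) = of (star x * x) :=
    of_eq_of_eventually (by simpa using eventually_inner c c x x)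
  have h2 := congrArg norm h
  rw [norm_of, norm_of, PreStab.norm_star_mul_self, PreStab.norm_star_mul_self] at h2
  exact (mul_self_inj (norm_nonneg _) (norm_nonneg _)).1 h2

lemma uniformContinuous_preIsometry (c : Fin 2) :
    UniformContinuous (preIsometry c : PreStab A → PreStab A) :=
  (AddMonoidHomClass.isometry_of_norm (preIsometry (A := A) c)
    (norm_preIsometry c)).uniformContinuous

/-- The extension of `preIsometry` to `A ⊗ 𝕂`. -/
noncomputable def isoFun (c : Fin 2) : Stab A → Stab A :=
  Completion.map (preIsometry c : PreStab A → PreStab A)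

lemma continuous_isoFun (c : Fin 2) : Continuous (isoFun c : Stab A → Stab A) :=
  Completion.continuous_map

lemma isoFun_of (c : Fin 2) (x : PreStab A) : isoFun c (of x) = of (preIsometry c x) :=
  Completion.map_coe (uniformContinuous_preIsometry c) x

variable (A) in
/-- The isometries `e_k ↦ e_{2k}` and `e_k ↦ e_{2k+1}` in the multiplier algebra of `A ⊗ 𝕂`. -/
noncomputable def isometryPair : IsometryPair (Stab A) where
  L c :=
    { toFun := isoFun c
      map_add' := fun a b => by
        refine induction₂ (p := fun a b => isoFun c (a + b) = isoFun c a + isoFun c b) a b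
          (isClosed_eq ((continuous_isoFun c).comp (continuous_fst.add continuous_snd))
            (((continuous_isoFun c).comp continuous_fst).add
              ((continuous_isoFun c).comp continuous_snd))) fun x y => ?_
        rw [← of_add, isoFun_of, isoFun_of, isoFun_of, map_add, of_add]
      map_smul' := fun z a => by
        refine induction₁ (p := fun a => isoFun c (z • a) = z • isoFun c a) a
          (isClosed_eq ((continuous_isoFun c).comp (continuous_id.const_smul z))
            ((continuous_isoFun c).const_smul z)) fun x => ?_
        rw [← of_smul, isoFun_of, isoFun_of, map_smul, of_smul] }
  map_mul c a b := by
    refine induction₂ (p := fun a b => isoFun c (a * b) = isoFun c a * b) a b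
      (isClosed_eq ((continuous_isoFun c).comp (continuous_fst.mul continuous_snd))
        (((continuous_isoFun c).comp continuous_fst).mul continuous_snd)) fun x y => ?_
    rw [← of_mul, isoFun_of, isoFun_of, preIsometry_mul, of_mul]
  inner c c' a b := by
    refine induction₂ (p := fun a b => star (isoFun c a) * isoFun c' b =
      if c = c' then star a * b else 0) a b
      (isClosed_eq ((((continuous_isoFun c).comp continuous_fst).star).mul
        ((continuous_isoFun c').comp continuous_snd)) ?_) fun x y => ?_
    · split_ifs
      · exact continuous_fst.star.mul continuous_snd
      · exact continuous_const
    · rw [isoFun_of, isoFun_of, ← of_star, ← of_mul, of_eq_of_eventually (eventually_inner c c' x y)]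
      split_ifs
      · rw [of_mul, of_star]
      · rfl

/-- The element `a ⊗ e_{i,j}` of `A ⊗ 𝕂`. -/
noncomputable def unit (i j : ℕ) (a : A) : Stab A := of (preUnit i j a)

lemma unit_mul_unit (i j l : ℕ) (a b : A) : unit i j a * unit j l b = unit i l (a * b) := by
  rw [unit, unit, ← of_mul]
  refine of_eq_of_eventually ?_
  filter_upwards [eventually_gt_atTop j] with n hn
  ext k m
  rw [map_mul, CStarMatrix.mul_apply]
  simp only [term_preUnit]
  rw [Finset.sum_eq_single ⟨j, hn⟩]
  · simp only
    split_ifs <;> simp_all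
  · intro q _ hq
    have : (q : ℕ) ≠ j := fun h => hq (Fin.ext h)
    simp [this]
  · simp

lemma unit_zero_zero (a : A) : unit 0 0 a = corner a := by
  refine of_eq_of_eventually (Eventually.of_forall fun n => ?_)
  ext i j
  change (if (i : ℕ) = 0 ∧ (j : ℕ) = 0 then a else 0) =
    if h : (i : ℕ) < 1 ∧ (j : ℕ) < 1 then a else 0
  split_ifs <;> first | rfl | omega

lemma of_eq_sum (x : PreStab A) : ∃ (N : ℕ) (a : ℕ → ℕ → A),
    of x = ∑ i ∈ Finset.range N, ∑ j ∈ Finset.range N, unit i j (a i j) := by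
  obtain ⟨N, hN⟩ := x.exists_entry
  let i0 : PreStab A →+ Stab A := ⟨⟨of, of_zero⟩, of_add⟩
  let a : ℕ → ℕ → A := fun i j =>
    if h : i < N ∧ j < N then PreStab.term N x ⟨i, h.1⟩ ⟨j, h.2⟩ else 0
  refine ⟨N, a, ?_⟩
  have : ∑ i ∈ Finset.range N, ∑ j ∈ Finset.range N, unit i j (a i j) =
      of (∑ i ∈ Finset.range N, ∑ j ∈ Finset.range N, preUnit i j (a i j)) := by
    change _ = i0 _
    simp only [map_sum]
    rfl
  rw [this]
  refine of_eq_of_eventually ?_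
  filter_upwards [eventually_ge_atTop N] with n hn
  ext k l
  have e : ∀ (s : Finset ℕ) (f : ℕ → PreStab A), PreStab.term n (∑ i ∈ s, f i) k l =
      ∑ i ∈ s, PreStab.term n (f i) k l := fun s f => by
    rw [map_sum]
    induction s using Finset.induction_on with
    | empty => simp
    | insert b s hb ih => rw [Finset.sum_insert hb, Finset.sum_insert hb, CStarMatrix.add_apply, ih]
  rw [e]
  simp only [e, term_preUnit]
  rw [hN n hn]
  by_cases h : (k : ℕ) < N ∧ (l : ℕ) < N
  · rw [Finset.sum_eq_single (k : ℕ), Finset.sum_eq_single (l : ℕ)]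
    · simp [a]
    · intro q _ hq; simp [hq.symm]
    · simp [h.2]
    · intro q _ hq; simp [hq.symm]
    · simp [h.1]
  · rw [dif_neg h]
    symm
    refine Finset.sum_eq_zero fun i hi => Finset.sum_eq_zero fun j hj => ?_
    rw [if_neg]
    rintro ⟨rfl, rfl⟩
    exact h ⟨Finset.mem_range.1 hi, Finset.mem_range.1 hj⟩

lemma corner_injective : Function.Injective (corner : A → Stab A) := by
  rw [injective_iff_map_eq_zero]
  intro a ha
  have h1 : ‖of (preCorner a)‖ = 0 := norm_eq_zero.2 ha
  rw [norm_of] at h1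
  obtain ⟨N, hN⟩ := PreStab.exists_norm (preCorner a)
  have h2 := hN (N + 1) (by omega)
  rw [h1] at h2
  have h3 := norm_eq_zero.1 h2.symm
  exact congrFun (congrFun h3 0) 0

lemma isClosed_range_corner : IsClosed (Set.range (corner : A → Stab A)) :=
  (AddMonoidHomClass.isometry_of_norm (corner : A →⋆ₙₐ[ℂ] Stab A)
    (NonUnitalStarAlgHom.norm_map corner corner_injective)).isClosedEmbedding.isClosed_range

lemma unit_mul_unit_of_ne {i j k l : ℕ} (h : j ≠ k) (a b : A) : unit i j a * unit k l b = 0 := by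
  rw [unit, unit, ← of_mul, ← of_zero]
  refine of_eq_of_eventually (Eventually.of_forall fun n => ?_)
  ext p q
  rw [map_mul, CStarMatrix.mul_apply, map_zero, CStarMatrix.zero_apply]
  refine Finset.sum_eq_zero fun r _ => ?_
  simp only [term_preUnit]
  split_ifs <;> first | omega | simp

/-- For finite matrices this is multiplication of matrix units; it extends by continuity because the
corner is closed. -/
lemma exists_corner_eq (i j : ℕ) (a b : A) (x : Stab A) :
    ∃ c : A, corner c = unit 0 i a * x * unit j 0 b := by
  refine induction₁ (p := fun x => unit 0 i a * x * unit j 0 b ∈ Set.range corner) x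
    (isClosed_range_corner.preimage (by fun_prop)) fun y => ?_
  obtain ⟨N, d, hd⟩ := of_eq_sum y
  rw [hd]
  simp only [Finset.mul_sum, Finset.sum_mul]
  change _ ∈ AddMonoidHom.range ((corner : A →⋆ₙₐ[ℂ] Stab A) : A →+ Stab A)
  refine sum_mem fun k _ => sum_mem fun l _ => ?_
  by_cases hk : i = k
  · by_cases hl : l = j
    · subst hk hl
      rw [unit_mul_unit, unit_mul_unit, unit_zero_zero]
      exact ⟨_, rfl⟩
    · rw [mul_assoc, unit_mul_unit_of_ne hl, mul_zero]; exact zero_mem _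
  · rw [unit_mul_unit_of_ne hk, zero_mul]; exact zero_mem _

lemma eq_zero_of_mul_mul {C : Type*} [NonUnitalCStarAlgebra C] {x : C}
    (h : star x * x * star x = 0) : x = 0 := by
  have h1 : star x * x = 0 := by
    rw [← CStarRing.star_mul_self_eq_zero_iff, star_mul, star_star, ← mul_assoc, h, zero_mul]
  exact (CStarRing.star_mul_self_eq_zero_iff x).1 h1

lemma unit_add (i j : ℕ) (a b : A) : unit i j (a + b) = unit i j a + unit i j b := by
  rw [unit, unit, unit, ← of_add]
  refine of_eq_of_eventually (Eventually.of_forall fun n => ?_)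
  ext p q
  rw [map_add, CStarMatrix.add_apply]
  simp only [term_preUnit]
  split_ifs <;> simp

lemma unit_smul (i j : ℕ) (c : ℂ) (a : A) : unit i j (c • a) = c • unit i j a := by
  rw [unit, unit, ← of_smul]
  refine of_eq_of_eventually (Eventually.of_forall fun n => ?_)
  ext p q
  rw [map_smul, CStarMatrix.smul_apply]
  simp only [term_preUnit]
  split_ifs <;> simp

lemma mul_unit_eq_zero {x : Stab A} {i j : ℕ} (h : ∀ a b : A, unit 0 i a * x * unit j 0 b = 0)
    (k l : ℕ) (a b : A) : unit k i a * x * unit j l b = 0 := by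
  refine induction_sq (p := fun a => unit k i a * x * unit j l b = 0) ?_ ?_ ?_ a
  · intro a a' ha ha'
    rw [unit_add, add_mul, add_mul, ha, ha', add_zero]
  · intro c a ha
    rw [unit_smul, smul_mul_assoc, smul_mul_assoc, ha, smul_zero]
  intro s _
  refine induction_sq (p := fun b => unit k i (s * s) * x * unit j l b = 0) ?_ ?_ ?_ b
  · intro a a' ha ha'
    rw [unit_add, mul_add, ha, ha', add_zero]
  · intro c a ha
    rw [unit_smul, mul_smul_comm, ha, smul_zero]
  intro t _
  rw [← unit_mul_unit k 0 i, ← unit_mul_unit j 0 l]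
  have := h s t
  calc unit k 0 s * unit 0 i s * x * (unit j 0 t * unit 0 l t)
      = unit k 0 s * (unit 0 i s * x * unit j 0 t) * unit 0 l t := by noncomm_ring
    _ = 0 := by rw [this, mul_zero, zero_mul]

/-- If all compressions to the corner vanished, then `y x z = 0` first for matrices and by density
for all `y` and `z`, in particular `x⋆ x x⋆ = 0`. -/
lemma exists_corner_ne_zero {x : Stab A} (hx : x ≠ 0) : ∃ (i j : ℕ) (a b c : A),
    c ≠ 0 ∧ corner c = unit 0 i a * x * unit j 0 b := by
  by_contra! H
  have h0 : ∀ i j (a b : A), unit 0 i a * x * unit j 0 b = 0 := fun i j a b => by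
    obtain ⟨c, hc⟩ := exists_corner_eq i j a b x
    by_cases h : c = 0
    · rw [← hc, h, map_zero]
    · exact absurd hc (H i j a b c h)
  have h1 : ∀ y z : Stab A, y * x * z = 0 := fun y z => by
    refine induction₂ (p := fun y z => y * x * z = 0) y z
      (isClosed_eq (by fun_prop) (by fun_prop)) fun u v => ?_
    obtain ⟨N, a, ha⟩ := of_eq_sum u
    obtain ⟨M, b, hb⟩ := of_eq_sum v
    rw [ha, hb]
    simp only [Finset.mul_sum, Finset.sum_mul]
    refine Finset.sum_eq_zero fun k _ => Finset.sum_eq_zero fun l _ =>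
      Finset.sum_eq_zero fun p _ => Finset.sum_eq_zero fun q _ => ?_
    exact mul_unit_eq_zero (h0 _ _) _ _ _ _
  exact hx (eq_zero_of_mul_mul (h1 _ _))

/-- Non-zero ideals of the stabilization of a simple C⋆-algebra are dense. -/
lemma dense_of_isAlgIdeal [IsSimpleRing A] {I : Submodule ℂ (Stab A)} (hI : IsAlgIdeal I)
    {x : Stab A} (hx : x ∈ I) (hx0 : x ≠ 0) : Dense (I : Set (Stab A)) := by
  let J : TwoSidedIdeal A := TwoSidedIdeal.mk' {a | ∀ u v : Stab A, u * corner a * v ∈ I}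
    (fun u v => by simp)
    (fun {a b} ha hb u v => by
      rw [map_add, mul_add, add_mul]; exact I.add_mem (ha u v) (hb u v))
    (fun {a} ha u v => by
      rw [map_neg, mul_neg, neg_mul]; exact I.neg_mem (ha u v))
    (fun {a b} hb u v => by
      rw [map_mul, ← mul_assoc]; exact hb (u * corner a) v)
    (fun {a b} ha u v => by
      rw [map_mul, ← mul_assoc, mul_assoc]; exact ha u (corner b * v))
  have hJ : ∀ a, a ∈ J ↔ ∀ u v : Stab A, u * corner a * v ∈ I := fun a =>
    TwoSidedIdeal.mem_mk' _ _ _ _ _ _ a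
  obtain ⟨i, j, a, b, c, hc, hcx⟩ := exists_corner_ne_zero hx0
  have hcJ : c ∈ J := (hJ c).2 fun u v => by
    rw [hcx]
    exact (hI v _ (hI u _ (hI _ _ (hI _ x hx).1).2).1).2
  -- Algebraic simplicity is used here: the corner elements whose two-sided multiples all stay in
  -- `I` form a non-zero ideal of `A`.
  have hJt : J = ⊤ := (eq_bot_or_eq_top J).resolve_left fun h => hc (by rw [h] at hcJ; simpa using hcJ)
  have hall : ∀ (a : A) (u v : Stab A), u * corner a * v ∈ I := fun a =>
    (hJ a).1 (by rw [hJt]; trivial)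
  have hunit : ∀ (k l : ℕ) (a : A), unit k l a ∈ I := fun k l a => by
    refine induction_sq (p := fun a => unit k l a ∈ I) ?_ ?_ ?_ a
    · intro a b ha hb
      rw [unit_add]; exact I.add_mem ha hb
    · intro c a ha
      rw [unit_smul]; exact I.smul_mem _ ha
    · intro s hs
      obtain ⟨t, -, rfl⟩ := exists_sqrt hs
      -- Four factors are needed: two for the matrix units on the sides, and a product `t t` in the
      -- middle that sits in the corner.
      rw [show t * t * (t * t) = t * (t * t) * t by noncomm_ring, ← unit_mul_unit k 0 l,
        ← unit_mul_unit k 0 0, unit_zero_zero]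
      exact hall _ _ _
  refine denseRange_of.mono ?_
  rintro _ ⟨y, rfl⟩
  obtain ⟨N, a, ha⟩ := of_eq_sum y
  rw [ha]
  exact sum_mem fun k _ => sum_mem fun l _ => hunit _ _ _

end Stab

open scoped ComplexOrder

/-! ### Automatic 2-quasitraces, and scales in simple algebras. -/

section General

variable {B : Type u} [NonUnitalCStarAlgebra B] [PartialOrder B] [StarOrderedRing B]
variable {τ : Ped B → ℂ}

lemma IsQuasitrace.apply_eq_val_of_nonneg (hτ : IsQuasitrace τ) (Φ : IsometryPair B) {p : B}
    (hp : p ∈ Ped B) (h : 0 ≤ p) : τ ⟨p, hp⟩ = (val τ p : ℂ) := by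
  obtain ⟨f, G, hf, hG, rfl⟩ := Φ.exists_factor_of_mem_ped h hp
  have h1 := Complex.nonneg_iff.1 (hτ.nonneg ⟨G, mem_ped_of_unit hf.1 hG⟩)
  rw [val_of_mem τ hp]
  exact Complex.ext rfl h1.2.symm

lemma IsQuasitrace.apply_eq_val (hτ : IsQuasitrace τ) (Φ : IsometryPair B) {x : B}
    (hx : x ∈ Ped B) (h : IsSelfAdjoint x) : τ ⟨x, hx⟩ = (val τ x : ℂ) := by
  obtain ⟨p, q, hp, hq, hp0, hq0, hpq, hqp, rfl⟩ := Φ.exists_pos_sub_pos h hx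
  rw [hτ.val_sub hp hq hp0.isSelfAdjoint hq0.isSelfAdjoint (by rw [hpq, hqp]), Complex.ofReal_sub,
    ← hτ.apply_eq_val_of_nonneg Φ hp hp0, ← hτ.apply_eq_val_of_nonneg Φ hq hq0, eq_sub_iff_add_eq]
  have := (hτ.linear_of_commute (x := ⟨p - q, hx⟩) (y := ⟨q, hq⟩) (Subtype.ext h)
    (Subtype.ext hq0.isSelfAdjoint) (Subtype.ext (by
      show (p - q) * q = q * (p - q)
      rw [sub_mul, mul_sub, hpq, hqp]))).1
  rw [← this]
  exact congrArg τ (Subtype.ext (sub_add_cancel p q))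

lemma exists_re_im {x : B} (hx : x ∈ Ped B) : ∃ a b : B, a ∈ Ped B ∧ b ∈ Ped B ∧
    IsSelfAdjoint a ∧ IsSelfAdjoint b ∧ x = a + Complex.I • b := by
  have h : ∀ y ∈ Ped B, (realPart y : B) ∈ Ped B := fun y hy => by
    rw [realPart_apply_coe]
    exact IsQuasitrace.smul_mem_ped (add_mem hy (star_mem hy)) _
  refine ⟨realPart x, imaginaryPart x, h x hx, ?_, (realPart x).2, (imaginaryPart x).2,
    (realPart_add_I_smul_imaginaryPart x).symm⟩
  rw [imaginaryPart_apply_coe]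
  exact SMulMemClass.smul_mem _ (IsQuasitrace.smul_mem_ped (sub_mem hx (star_mem hx)) _)

lemma IsQuasitrace.apply_add_I (hτ : IsQuasitrace τ) (Φ : IsometryPair B) {a b : B}
    (ha : a ∈ Ped B) (hb : b ∈ Ped B) (has : IsSelfAdjoint a) (hbs : IsSelfAdjoint b)
    (h : a + Complex.I • b ∈ Ped B) :
    τ ⟨a + Complex.I • b, h⟩ = (val τ a : ℂ) + Complex.I * (val τ b : ℂ) := by
  rw [← hτ.apply_eq_val Φ ha has, ← hτ.apply_eq_val Φ hb hbs]
  exact hτ.add_I_smul ⟨a, ha⟩ ⟨b, hb⟩ (Subtype.ext has) (Subtype.ext hbs)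

lemma IsQuasitrace.val_conj_of_isSelfAdjoint (hτ : IsQuasitrace τ) (Φ : IsometryPair B)
    (i : Fin 2) {x : B} (hx : x ∈ Ped B) (h : IsSelfAdjoint x) :
    val τ (Φ.conj i i x) = val τ x := by
  obtain ⟨p, q, hp, hq, hp0, hq0, hpq, hqp, rfl⟩ := Φ.exists_pos_sub_pos h hx
  rw [Φ.conj_sub, hτ.val_sub hp hq hp0.isSelfAdjoint hq0.isSelfAdjoint (by rw [hpq, hqp]),
    hτ.val_sub (Φ.conj_mem_ped _ _ hp) (Φ.conj_mem_ped _ _ hq)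
    (Φ.conj_self_nonneg i hp0).isSelfAdjoint (Φ.conj_self_nonneg i hq0).isSelfAdjoint
    (by simp [Φ.conj_mul_conj, hpq, hqp]), hτ.val_conj Φ i hp hp0, hτ.val_conj Φ i hq hq0]

lemma IsQuasitrace.apply_conj (hτ : IsQuasitrace τ) (Φ : IsometryPair B)
    (i : Fin 2) {x : B} (hx : x ∈ Ped B) : τ ⟨Φ.conj i i x, Φ.conj_mem_ped i i hx⟩ = τ ⟨x, hx⟩ := by
  obtain ⟨a, b, ha, hb, has, hbs, rfl⟩ := exists_re_im hx
  have hc : ∀ y : B, IsSelfAdjoint y → IsSelfAdjoint (Φ.conj i i y) := fun y hy => by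
    rw [IsSelfAdjoint, Φ.star_conj, hy.star_eq]
  have e : Φ.conj i i (a + Complex.I • b) = Φ.conj i i a + Complex.I • Φ.conj i i b := by
    rw [Φ.conj_add, Φ.conj_smul]
  have h2 : Φ.conj i i a + Complex.I • Φ.conj i i b ∈ Ped B := e ▸ Φ.conj_mem_ped i i hx
  have h3 : (⟨Φ.conj i i (a + Complex.I • b), Φ.conj_mem_ped i i hx⟩ : Ped B) = ⟨_, h2⟩ :=
    Subtype.ext e
  rw [h3, hτ.apply_add_I Φ ha hb has hbs hx, hτ.apply_add_I Φ (Φ.conj_mem_ped i i ha)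
    (Φ.conj_mem_ped i i hb) (hc a has) (hc b hbs) h2, hτ.val_conj_of_isSelfAdjoint Φ i ha has,
    hτ.val_conj_of_isSelfAdjoint Φ i hb hbs]

/-- The `*`-homomorphism `M_2(Ped B) → Ped B` that is given by a pair of isometries. -/
def IsometryPair.matrixHom (Φ : IsometryPair B) : CStarMatrix (Fin 2) (Fin 2) (Ped B) → Ped B :=
  fun X => ∑ i, ∑ j, ⟨Φ.conj i j (X i j : B), Φ.conj_mem_ped i j (X i j).2⟩

lemma IsometryPair.coe_matrixHom (Φ : IsometryPair B) (X : CStarMatrix (Fin 2) (Fin 2) (Ped B)) :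
    (Φ.matrixHom X : B) = Φ.conj 0 0 (X 0 0 : B) + Φ.conj 0 1 (X 0 1 : B) +
      (Φ.conj 1 0 (X 1 0 : B) + Φ.conj 1 1 (X 1 1 : B)) := by
  simp [IsometryPair.matrixHom, Fin.sum_univ_two]

/-- `IsometryPair.matrixHom` as a `*`-homomorphism. -/
def IsometryPair.matrixStarHom (Φ : IsometryPair B) :
    CStarMatrix (Fin 2) (Fin 2) (Ped B) →⋆ₙₐ[ℂ] Ped B where
  toFun := Φ.matrixHom
  map_smul' c X := by
    refine Subtype.ext ?_
    change _ = c • (Φ.matrixHom X : B)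
    rw [Φ.coe_matrixHom, Φ.coe_matrixHom]
    simp [Φ.conj_smul, smul_add]
  map_zero' := by
    refine Subtype.ext ?_
    rw [Φ.coe_matrixHom]
    simp [IsometryPair.conj]
  map_add' X Y := by
    refine Subtype.ext ?_
    change _ = (Φ.matrixHom X : B) + (Φ.matrixHom Y : B)
    rw [Φ.coe_matrixHom, Φ.coe_matrixHom, Φ.coe_matrixHom]
    simp [Φ.conj_add]
    abel
  map_mul' X Y := by
    refine Subtype.ext ?_
    change _ = (Φ.matrixHom X : B) * (Φ.matrixHom Y : B)
    rw [Φ.coe_matrixHom, Φ.coe_matrixHom, Φ.coe_matrixHom]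
    simp [Φ.conj_add, CStarMatrix.mul_apply, Fin.sum_univ_two, add_mul, mul_add, Φ.conj_mul_conj]
    abel
  map_star' X := by
    refine Subtype.ext ?_
    change _ = star (Φ.matrixHom X : B)
    rw [Φ.coe_matrixHom, Φ.coe_matrixHom]
    simp [Φ.star_conj, CStarMatrix.star_apply]
    abel

/-- Quasitraces on the Pedersen ideal of a stable C⋆-algebra are 2-quasitraces. -/
lemma IsQuasitrace.isTwoQuasitrace (hτ : IsQuasitrace τ) (Φ : IsometryPair B) :
    IsTwoQuasitrace τ := by
  -- The extension is `X ↦ τ(∑ V_i X_ij V_j⋆)`. It restricts to `τ` on the corner because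
  -- conjugation by `V_0` preserves `τ`.
  refine ⟨hτ, fun X => τ (Φ.matrixStarHom X), ⟨fun X => ?_, fun X => ?_, fun C hC => ?_,
    fun X Y hX hY => ?_⟩, fun x => ?_⟩
  · rw [map_mul, map_star]; exact hτ.nonneg _
  · rw [map_mul, map_mul, map_star]; exact hτ.tracial _
  · obtain ⟨h1, h2⟩ := hτ.linear_of_comm (C.map Φ.matrixStarHom) (by
      rintro _ ⟨X, hX, rfl⟩ _ ⟨Y, hY, rfl⟩
      exact (map_mul Φ.matrixStarHom X Y).symm.trans ((congrArg _ (hC X hX Y hY)).trans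
        (map_mul Φ.matrixStarHom Y X)))
    refine ⟨fun X hX Y hY => ?_, fun c X hX => ?_⟩
    · rw [map_add]; exact h1 _ ⟨X, hX, rfl⟩ _ ⟨Y, hY, rfl⟩
    · rw [map_smul]; exact h2 c _ ⟨X, hX, rfl⟩
  · rw [map_add, map_smul]
    exact hτ.add_I_smul _ _ (hX.map _) (hY.map _)
  · rw [← hτ.apply_conj Φ 0 x.2]
    refine congrArg τ (Subtype.ext ?_)
    change (Φ.matrixHom _ : B) = _
    rw [Φ.coe_matrixHom]
    simp [IsometryPair.conj]

/-- A positive contraction in the Pedersen ideal that is a unit for a non-zero element. -/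
structure IsScale (f : B) : Prop where
  mem : f ∈ Ped B
  nonneg : 0 ≤ f
  norm_le : ‖f‖ ≤ 1
  exists_ne : ∃ g : B, g ≠ 0 ∧ f * g = g

variable (B) in
/-- Non-zero ideals are dense. -/
def IsAlgSimple : Prop := ∀ I : Submodule ℂ B, IsAlgIdeal I → ∀ x ∈ I, x ≠ 0 → Dense (I : Set B)

lemma isScale_fE {b : B} {ε : ℝ} (hε : 0 < ε) (h : cfcₙ (fEps ε) b ≠ 0) :
    IsScale (cfcₙ (fEps (ε / 2)) b) :=
  ⟨fE_mem b (half_pos hε), fE_nonneg _ _, norm_fE_le_one _ _, _, h,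
    fE_mul_fE (half_pos hε) (by linarith) b⟩

/-- `C` counts the copies of `f` in the block sum, so it does not depend on `τ`. -/
lemma IsometryPair.UnitGen.val_eq {Φ : IsometryPair B} {f u : B} (hf : f ∈ Ped B) (hf0 : 0 ≤ f)
    (hf1 : ‖f‖ ≤ 1) (hu : Φ.UnitGen {f} u) :
    ∃ C : ℝ, 0 ≤ C ∧ ∀ τ : Ped B → ℂ, IsQuasitrace τ → val τ u = C * val τ f := by
  have hS : ∀ f' ∈ ({f} : Set B), f' ∈ Ped B ∧ 0 ≤ f' ∧ ‖f'‖ ≤ 1 := by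
    rintro _ rfl; exact ⟨hf, hf0, hf1⟩
  induction hu with
  | base h => exact ⟨1, zero_le_one, fun τ _ => by rw [Set.mem_singleton_iff.1 h, one_mul]⟩
  | dsum h1 h2 ih1 ih2 =>
    obtain ⟨C, hC, h3⟩ := ih1
    obtain ⟨D, hD, h4⟩ := ih2
    refine ⟨C + D, add_nonneg hC hD, fun τ hτ => ?_⟩
    have p1 := h1.props hS
    have p2 := h2.props hS
    rw [hτ.val_dsum Φ p1.1 p1.2.1 p2.1 p2.2.1, h3 τ hτ, h4 τ hτ]
    ring

/-- The ideal of products with units among the block sums of `f` contains `g⋆g ≠ 0`. By simplicity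
it is dense, so it contains the Pedersen ideal, and `p` has a factorization whose unit consists of
copies of `f`. -/
lemma IsScale.exists_val_le (Φ : IsometryPair B) (hB : IsAlgSimple B) {f : B} (hf : IsScale f)
    {p : B} (hp : p ∈ Ped B) (hp0 : 0 ≤ p) :
    ∃ C : ℝ, 0 ≤ C ∧ ∀ τ : Ped B → ℂ, IsQuasitrace τ → val τ p ≤ C * val τ f := by
  obtain ⟨g, hg, hfg⟩ := hf.exists_ne
  have hne : ({f} : Set B).Nonempty := ⟨f, rfl⟩
  have hI := Φ.isAlgIdeal_unitIdeal hne
  have hgI : star g * g ∈ Φ.unitIdeal {f} hne := ⟨f, g, g, .base rfl, hfg, hfg, rfl⟩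
  have hgg : star g * g ≠ 0 := fun h => hg ((CStarRing.star_mul_self_eq_zero_iff g).1 h)
  obtain ⟨u, G, hu, huG, rfl⟩ := IsometryPair.exists_factor_of_mem_unitIdeal hp0
    (hp _ hI (hB _ hI _ hgI hgg))
  obtain ⟨C, hC, h⟩ := hu.val_eq hf.mem hf.nonneg hf.norm_le
  have hup := hu.props (by rintro _ rfl; exact ⟨hf.mem, hf.nonneg, hf.norm_le⟩)
  refine ⟨‖star G * G‖ * C, by positivity, fun τ hτ => ?_⟩
  rw [mul_assoc, ← h τ hτ]
  exact hτ.val_le_of_factor Φ hup.1 hup.2.1 hup.2.2 huG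

lemma IsScale.exists_norm_le (Φ : IsometryPair B) (hB : IsAlgSimple B) {f : B} (hf : IsScale f)
    (x : Ped B) : ∃ C : ℝ, 0 ≤ C ∧ ∀ τ : Ped B → ℂ, IsQuasitrace τ → ‖τ x‖ ≤ C * val τ f := by
  have hsa : ∀ y ∈ Ped B, IsSelfAdjoint y → ∃ C : ℝ, 0 ≤ C ∧ ∀ τ : Ped B → ℂ, IsQuasitrace τ →
      |val τ y| ≤ C * val τ f := by
    intro y hy hys
    obtain ⟨p, q, hp, hq, hp0, hq0, hpq, hqp, rfl⟩ := Φ.exists_pos_sub_pos hys hy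
    obtain ⟨C, hC, h1⟩ := hf.exists_val_le Φ hB hp hp0
    obtain ⟨D, hD, h2⟩ := hf.exists_val_le Φ hB hq hq0
    refine ⟨C + D, add_nonneg hC hD, fun τ hτ => ?_⟩
    rw [hτ.val_sub hp hq hp0.isSelfAdjoint hq0.isSelfAdjoint (by rw [hpq, hqp]), abs_le]
    have := h1 τ hτ
    have := h2 τ hτ
    have := hτ.val_nonneg Φ hp hp0
    have := hτ.val_nonneg Φ hq hq0
    have := mul_nonneg hC (hτ.val_nonneg Φ hf.mem hf.nonneg)
    have := mul_nonneg hD (hτ.val_nonneg Φ hf.mem hf.nonneg)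
    constructor <;> nlinarith
  obtain ⟨x, hx⟩ := x
  obtain ⟨a, b, ha, hb, has, hbs, rfl⟩ := exists_re_im hx
  obtain ⟨C, hC, h1⟩ := hsa a ha has
  obtain ⟨D, hD, h2⟩ := hsa b hb hbs
  refine ⟨C + D, add_nonneg hC hD, fun τ hτ => ?_⟩
  rw [hτ.apply_add_I Φ ha hb has hbs hx, add_mul]
  refine (norm_add_le _ _).trans (add_le_add ?_ ?_)
  · rw [Complex.norm_real]; exact h1 τ hτ
  · rw [norm_mul, Complex.norm_I, one_mul, Complex.norm_real]; exact h2 τ hτ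

lemma IsScale.val_pos (Φ : IsometryPair B) (hB : IsAlgSimple B) {f : B} (hf : IsScale f)
    (hτ : IsQuasitrace τ) (h0 : τ ≠ 0) : 0 < val τ f := by
  refine lt_of_le_of_ne (hτ.val_nonneg Φ hf.mem hf.nonneg) fun h => h0 (funext fun x => ?_)
  obtain ⟨C, -, hC⟩ := hf.exists_norm_le Φ hB x
  have := hC τ hτ
  rw [← h, mul_zero] at this
  exact norm_le_zero_iff.1 this

/-- For suitable `ε`, a multiple of `p` dominates `f_{ε/2}(p)`, which is a scale. -/
lemma IsQuasitrace.val_pos (Φ : IsometryPair B) (hB : IsAlgSimple B) (hτ : IsQuasitrace τ)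
    (h0 : τ ≠ 0) {p : B} (hp : p ∈ Ped B) (hp0 : 0 ≤ p) (hpne : p ≠ 0) : 0 < val τ p := by
  obtain ⟨ε, hε, hne⟩ := exists_fE_ne_zero hp0 hpne
  have h1 := (isScale_fE hε hne).val_pos Φ hB hτ h0
  refine lt_of_le_of_ne (hτ.val_nonneg Φ hp hp0) fun h => h1.ne' ?_
  have hε2 : 0 < ε / 2 := half_pos hε
  have hid : cfcₙ (fun t : ℝ => t) p = p := cfcₙ_id' ℝ p hp0.isSelfAdjoint
  have h2 : cfcₙ (fEps (ε / 2)) p ≤ (ε / 2)⁻¹ • p := by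
    nth_rw 2 [← hid]
    rw [← cfcₙ_smul (ε / 2)⁻¹ (fun t => t) p (by fun_prop) rfl]
    refine cfcₙ_mono (fun t ht => ?_) (hf := (continuous_fEps _).continuousOn)
      (hg := by fun_prop) (hf0 := fEps_zero _) (hg0 := by simp)
    have ht0 := quasispectrum_nonneg_of_nonneg p hp0 t ht
    rw [smul_eq_mul]
    rcases le_total t (ε / 2) with ht2 | ht2
    · rw [fEps_eq_zero hε2 ht2]; positivity
    · refine (fEps_le_one _ _).trans ?_
      rw [inv_mul_eq_div, le_div_iff₀ hε2]; linarith
  have h3 := hτ.val_mono Φ (fE_mem p hε2) (smul_mem_ped hp _) (fE_isSelfAdjoint _ _) h2 (by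
    rw [mul_smul_comm, smul_mul_assoc]
    congr 1
    nth_rw 2 [← hid]
    nth_rw 3 [← hid]
    exact cfcₙ_commute_cfcₙ _ _ _)
  rw [hτ.val_smul hp hp0.isSelfAdjoint, ← h, mul_zero] at h3
  exact le_antisymm h3 (hτ.val_nonneg Φ (fE_mem p hε2) (fE_nonneg _ _))

end General

/-! ### The cone of quasitraces: affine functions, compactness, Dini arguments. -/

namespace DQT

variable {A : Type u} [NonUnitalCStarAlgebra A] [PartialOrder A] [StarOrderedRing A]

lemma isQuasitrace (τ : DQT A) : IsQuasitrace τ.toFun := τ.2.1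

lemma d_eq_dim (τ : DQT A) (a : Stab A) : τ.d a = dim τ.toFun a := by
  refine iSup_congr fun n => ?_
  rw [val_of_mem τ.toFun (fEps_mem_ped a Nat.one_div_pos_of_nat)]
  rfl

lemma cut_eq_val (τ : DQT A) (n : ℕ) (a : Stab A) :
    τ.cut n a = ENNReal.ofReal (val τ.toFun (cfcₙ (fEps (1 / ((n : ℝ) + 1))) a)) := by
  rw [val_of_mem τ.toFun (fEps_mem_ped a Nat.one_div_pos_of_nat)]
  rfl

lemma toFun_injective : Function.Injective (DQT.toFun : DQT A → Ped (Stab A) → ℂ) :=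
  fun _ _ h => DQT.ext h

lemma toFun_ne_zero {τ : DQT A} (h : τ ≠ 0) : τ.toFun ≠ 0 := fun h0 => h (toFun_injective h0)

lemma isInducing_toFun : IsInducing (DQT.toFun : DQT A → Ped (Stab A) → ℂ) := ⟨rfl⟩

lemma continuous_apply (x : Ped (Stab A)) : Continuous fun τ : DQT A => τ x :=
  (_root_.continuous_apply x).comp isInducing_toFun.continuous

lemma continuous_val (x : Stab A) : Continuous fun τ : DQT A => val τ.toFun x := by
  by_cases h : x ∈ Ped (Stab A)
  · simp only [val_of_mem _ h]
    exact Complex.continuous_re.comp (continuous_apply ⟨x, h⟩)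
  · simp only [val, dif_neg h]
    exact continuous_const

lemma val_add_apply (τ σ : DQT A) (x : Stab A) :
    val (τ + σ).toFun x = val τ.toFun x + val σ.toFun x := by
  by_cases h : x ∈ Ped (Stab A)
  · simp only [val_of_mem _ h]; rfl
  · simp only [val, dif_neg h, add_zero]

lemma val_smul_apply (s : ℝ≥0) (τ : DQT A) (x : Stab A) :
    val (s • τ).toFun x = s * val τ.toFun x := by
  by_cases h : x ∈ Ped (Stab A)
  · simp only [val_of_mem _ h]
    exact Complex.re_ofReal_mul _ _
  · simp only [val, dif_neg h, mul_zero]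

lemma val_zero_apply (x : Stab A) : val (0 : DQT A).toFun x = 0 := by
  by_cases h : x ∈ Ped (Stab A)
  · simp only [val_of_mem _ h]; rfl
  · simp only [val, dif_neg h]

lemma isAff_val (x : Stab A) : IsAff fun τ : DQT A => val τ.toFun x :=
  ⟨continuous_val x, fun s τ => val_smul_apply s τ x, fun τ σ => val_add_apply τ σ x⟩

end DQT

section Aff

variable {A : Type u} [NonUnitalCStarAlgebra A] [PartialOrder A] [StarOrderedRing A]

lemma IsAff.add {f g : DQT A → ℝ} (hf : IsAff f) (hg : IsAff g) : IsAff fun τ => f τ + g τ :=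
  ⟨hf.continuous.add hg.continuous, fun s τ => by rw [hf.map_smul, hg.map_smul]; ring,
    fun τ σ => by rw [hf.map_add, hg.map_add]; ring⟩

lemma IsAff.const_mul {f : DQT A → ℝ} (hf : IsAff f) (c : ℝ) : IsAff fun τ => c * f τ :=
  ⟨hf.continuous.const_mul c, fun s τ => by rw [hf.map_smul]; ring,
    fun τ σ => by rw [hf.map_add]; ring⟩

lemma IsAff.sub {f g : DQT A → ℝ} (hf : IsAff f) (hg : IsAff g) : IsAff fun τ => f τ - g τ :=
  ⟨hf.continuous.sub hg.continuous, fun s τ => by rw [hf.map_smul, hg.map_smul]; ring,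
    fun τ σ => by rw [hf.map_add, hg.map_add]; ring⟩

lemma DQT.zero_smul' (τ : DQT A) : (0 : ℝ≥0) • τ = 0 := by
  refine DQT.ext (funext fun x => ?_)
  change ((0 : ℝ≥0) : ℝ) * τ x = (0 : ℂ)
  simp

lemma IsAff.map_zero {f : DQT A → ℝ} (hf : IsAff f) : f 0 = 0 := by
  rw [← DQT.zero_smul' (0 : DQT A), hf.map_smul]
  simp

variable [IsSimpleRing A]

lemma isAlgSimple_stab : IsAlgSimple (Stab A) := fun _ hI _ hx hx0 =>
  Stab.dense_of_isAlgIdeal hI hx hx0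

lemma isAffPos_val {p : Stab A} (hp : p ∈ Ped (Stab A)) (hp0 : 0 ≤ p) {c : ℝ} (hc : 0 < c) :
    IsAffPos fun τ : DQT A => c * val τ.toFun p := by
  refine ⟨(DQT.isAff_val p).const_mul c, ?_⟩
  by_cases h : p = 0
  · right
    funext τ
    rw [h, τ.isQuasitrace.val_zero, mul_zero]; rfl
  · left
    intro τ hτ
    exact mul_pos hc (τ.isQuasitrace.val_pos (Stab.isometryPair A) isAlgSimple_stab
      (DQT.toFun_ne_zero hτ) hp hp0 h)

lemma isClosed_isQuasitrace {P : Type u} [NonUnitalRing P] [StarRing P] [Module ℂ P] :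
    IsClosed {σ : P → ℂ | IsQuasitrace σ} := by
  have h : {σ : P → ℂ | IsQuasitrace σ} =
      (⋂ x : P, {σ | 0 ≤ σ (star x * x)}) ∩ (⋂ x : P, {σ | σ (star x * x) = σ (x * star x)}) ∩
      (⋂ (C : NonUnitalStarSubalgebra ℂ P) (_ : ∀ x ∈ C, ∀ y ∈ C, x * y = y * x) (x : P)
        (_ : x ∈ C) (y : P) (_ : y ∈ C), {σ | σ (x + y) = σ x + σ y}) ∩
      (⋂ (C : NonUnitalStarSubalgebra ℂ P) (_ : ∀ x ∈ C, ∀ y ∈ C, x * y = y * x) (c : ℂ) (x : P)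
        (_ : x ∈ C), {σ | σ (c • x) = c * σ x}) ∩
      (⋂ (a : P) (b : P) (_ : IsSelfAdjoint a) (_ : IsSelfAdjoint b),
        {σ | σ (a + Complex.I • b) = σ a + Complex.I * σ b}) := by
    ext σ
    simp only [Set.mem_inter_iff, Set.mem_iInter, Set.mem_ofPred_eq]
    exact ⟨fun h => ⟨⟨⟨⟨h.nonneg, h.tracial⟩, fun C hC => (h.linear_of_comm C hC).1⟩,
      fun C hC => (h.linear_of_comm C hC).2⟩, h.add_I_smul⟩,
      fun h => ⟨h.1.1.1.1, h.1.1.1.2, fun C hC => ⟨h.1.1.2 C hC, h.1.2 C hC⟩, h.2⟩⟩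
  rw [h]
  refine ((((isClosed_iInter fun x => ?_).inter (isClosed_iInter fun x => ?_)).inter ?_).inter
    ?_).inter ?_
  · exact isClosed_le continuous_const (continuous_apply _)
  · exact isClosed_eq (continuous_apply _) (continuous_apply _)
  · refine isClosed_iInter fun C => isClosed_iInter fun _ => isClosed_iInter fun x =>
      isClosed_iInter fun _ => isClosed_iInter fun y => isClosed_iInter fun _ => ?_
    exact isClosed_eq (continuous_apply _) (by fun_prop)
  · refine isClosed_iInter fun C => isClosed_iInter fun _ => isClosed_iInter fun c =>
      isClosed_iInter fun x => isClosed_iInter fun _ => ?_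
    exact isClosed_eq (continuous_apply _) (by fun_prop)
  · refine isClosed_iInter fun a => isClosed_iInter fun b => isClosed_iInter fun _ =>
      isClosed_iInter fun _ => ?_
    exact isClosed_eq (continuous_apply _) (by fun_prop)

/-- The quasitraces that are normalized at a non-zero element form a compact set. -/
lemma isCompact_normalized {f : Stab A} (hf : IsScale f) :
    IsCompact {τ : DQT A | val τ.toFun f = 1} := by
  let Φ := Stab.isometryPair A
  choose C hC0 hC using fun x => hf.exists_norm_le Φ isAlgSimple_stab x
  rw [DQT.isInducing_toFun.isCompact_iff]
  have hcl : IsClosed ({σ : Ped (Stab A) → ℂ | IsQuasitrace σ} ∩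
      {σ | (σ ⟨f, hf.mem⟩).re = 1}) :=
    isClosed_isQuasitrace.inter (isClosed_eq (Complex.continuous_re.comp (continuous_apply _))
      continuous_const)
  have heq : DQT.toFun '' {τ : DQT A | val τ.toFun f = 1} =
      {σ : Ped (Stab A) → ℂ | IsQuasitrace σ} ∩ {σ | (σ ⟨f, hf.mem⟩).re = 1} := by
    ext σ
    constructor
    · rintro ⟨τ, hτ, rfl⟩
      exact ⟨τ.isQuasitrace, by rw [← hτ, val_of_mem _ hf.mem]; rfl⟩
    · rintro ⟨h1, h2⟩
      -- Only the quasitrace axioms have to pass to pointwise limits, since the extension to 2×2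
      -- matrices is automatic.
      exact ⟨⟨σ, h1.isTwoQuasitrace Φ⟩, (val_of_mem σ hf.mem).trans h2, rfl⟩
  rw [heq]
  refine IsCompact.of_isClosed_subset (isCompact_univ_pi fun x : Ped (Stab A) =>
    isCompact_closedBall (0 : ℂ) (C x)) hcl ?_
  rintro σ ⟨h1, h2⟩ x -
  rw [mem_closedBall_zero_iff]
  have := hC x σ h1
  rwa [show val σ f = 1 from (val_of_mem σ hf.mem).trans h2, mul_one] at this

/-- A Dini type argument. -/
lemma exists_le_val_fE {f : Stab A} (hf : IsScale f) {y : Stab A} {k : DQT A → ℝ}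
    (hk : IsAff k) (h : ∀ τ : DQT A, ENNReal.ofReal (k τ) ≤ dim τ.toFun y) {η : ℝ} (hη : 0 < η) :
    ∃ δ : ℝ, 0 < δ ∧ ∀ δ', 0 < δ' → δ' ≤ δ → ∀ τ : DQT A,
      k τ ≤ val τ.toFun (cfcₙ (fEps δ') y) + η * val τ.toFun f := by
  let Φ := Stab.isometryPair A
  let v : ℕ → DQT A → ℝ := fun n τ => val τ.toFun (cfcₙ (fEps (1 / ((n : ℝ) + 1))) y)
  have hv : ∀ n, Continuous (v n) := fun n => DQT.continuous_val _
  have hmono : ∀ τ, Monotone fun n => v n τ := fun τ m n hmn =>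
    τ.isQuasitrace.val_fE_anti Φ y Nat.one_div_pos_of_nat (Nat.one_div_le_one_div hmn)
  -- The increasing values `τ(f_{1/(n+1)}(y))` have supremum `d_τ(y) ≥ k(τ)`, so each `τ` is
  -- eventually within `η`. Compactness makes `n` uniform.
  have hcover : {τ : DQT A | val τ.toFun f = 1} ⊆ ⋃ n, {τ | k τ < v n τ + η} := by
    intro τ _
    rw [Set.mem_iUnion]
    by_contra! hcon
    have h1 : ∀ n, v n τ ≤ k τ - η := fun n => by
      have := hcon n
      simp only [Set.mem_ofPred_eq, not_lt] at this
      linarith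
    have h0 : 0 ≤ k τ - η :=
      (τ.isQuasitrace.val_nonneg Φ (fE_mem y Nat.one_div_pos_of_nat) (fE_nonneg _ _)).trans (h1 0)
    have h2 : dim τ.toFun y ≤ ENNReal.ofReal (k τ - η) :=
      iSup_le fun n => ENNReal.ofReal_le_ofReal (h1 n)
    have h3 := (h τ).trans h2
    rw [ENNReal.ofReal_le_ofReal_iff h0] at h3
    linarith
  obtain ⟨t, ht⟩ := (isCompact_normalized hf).elim_finite_subcover _
    (fun n => isOpen_lt hk.continuous ((hv n).add continuous_const)) hcover
  let N := t.sup id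
  have hN : ∀ τ : DQT A, val τ.toFun f = 1 → k τ ≤ v N τ + η := fun τ hτ => by
    obtain ⟨n, hn, hlt⟩ := Set.mem_iUnion₂.1 (ht hτ)
    have : n ≤ N := Finset.le_sup (f := id) hn
    have h1 : k τ < v n τ + η := hlt
    linarith [hmono τ this]
  refine ⟨1 / ((N : ℝ) + 1), Nat.one_div_pos_of_nat, fun δ' hδ' hle τ => ?_⟩
  have h2 : v N τ ≤ val τ.toFun (cfcₙ (fEps δ') y) := τ.isQuasitrace.val_fE_anti Φ y hδ' hle
  refine le_trans ?_ (add_le_add_left h2 _)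
  by_cases h0 : τ = 0
  · subst h0
    rw [hk.map_zero, DQT.val_zero_apply, mul_zero, add_zero]
    exact (DQT.val_zero_apply _).ge
  · have hp : 0 < val τ.toFun f := hf.val_pos Φ isAlgSimple_stab τ.isQuasitrace
      (DQT.toFun_ne_zero h0)
    -- By homogeneity the estimate passes from normalized quasitraces to all of them, with the error
    -- `η` multiplied by `τ(f)`.
    set c : ℝ≥0 := ⟨(val τ.toFun f)⁻¹, (inv_pos.2 hp).le⟩ with hc
    have h3 := hN (c • τ) (by
      rw [DQT.val_smul_apply]; exact inv_mul_cancel₀ hp.ne')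
    have h4 : v N (c • τ) = c * v N τ := DQT.val_smul_apply _ _ _
    rw [hk.map_smul, h4] at h3
    have h5 := mul_le_mul_of_nonneg_left h3 hp.le
    have h6 : val τ.toFun f * (c : ℝ) = 1 := mul_inv_cancel₀ hp.ne'
    calc k τ = val τ.toFun f * (c * k τ) := by rw [← mul_assoc, h6, one_mul]
      _ ≤ _ := h5
      _ = _ := by rw [mul_add, ← mul_assoc, h6, one_mul, mul_comm η]

/-- `τ(p) ≤ τ(f_δ(p))` up to a small error that is uniform in `τ`. -/
lemma exists_val_le_val_fE_add {f : Stab A} (hf : IsScale f) {p : Stab A} (hp : p ∈ Ped (Stab A))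
    (hp0 : 0 ≤ p) (hp1 : ‖p‖ ≤ 1) {η : ℝ} (hη : 0 < η) :
    ∃ δ : ℝ, 0 < δ ∧ ∀ δ', 0 < δ' → δ' ≤ δ → ∀ τ : DQT A,
      val τ.toFun p ≤ val τ.toFun (cfcₙ (fEps δ') p) + η * val τ.toFun f :=
  exists_le_val_fE hf (DQT.isAff_val p)
    (fun τ => τ.isQuasitrace.val_le_dim (Stab.isometryPair A) hp hp0 hp1) hη

end Aff

section General

variable {B : Type*} [NonUnitalCStarAlgebra B] [PartialOrder B] [StarOrderedRing B]

lemma mul_eq_of_mul_eq {u a : B} (hu : 0 ≤ u) (ha : 0 ≤ a) (h : u * a = a) : a * u = a := by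
  have := congrArg star h
  rwa [star_mul, hu.isSelfAdjoint.star_eq, ha.isSelfAdjoint.star_eq] at this

/-- If `y ≲ e`, then `f_δ(y)` can be conjugated into a corner `f_γ(e) B f_γ(e)`. -/
lemma CuntzLE.exists_factor {y e : B} (hy : 0 ≤ y) (he : 0 ≤ e) (h : CuntzLE y e) {δ : ℝ}
    (hδ : 0 < δ) : ∃ (S : B) (γ : ℝ), 0 < γ ∧ star S * S = cfcₙ (fEps δ) y ∧
      cfcₙ (fEps γ) e * S = S := by
  obtain ⟨z, hz⟩ := h
  obtain ⟨s, hs, hse⟩ := exists_sqrt he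
  obtain ⟨k, hk⟩ := ((Metric.tendsto_nhds.1 hz) (δ / 2) (half_pos hδ)).exists
  have hT : InHer e (s * z k) := (InHer.sqrt_of_le hs hse le_rfl (InHer.self he)).mul_right _
  have hTe : star (s * z k) * (s * z k) = star (z k) * e * z k := by
    rw [star_mul, hs.isSelfAdjoint.star_eq, mul_assoc, ← mul_assoc s s, hse, ← mul_assoc]
  have h1 := (tendsto_const_nhds (x := y)).sub (tendsto_star_fE_mul hT) |>.norm
  rw [dist_comm, dist_eq_norm] at hk
  rw [hTe] at h1
  obtain ⟨n, hn⟩ := (h1.eventually_lt_const hk).exists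
  have hn0 : (0 : ℝ) < 1 / ((n : ℝ) + 1) := Nat.one_div_pos_of_nat
  obtain ⟨S, hS, hS'⟩ := exists_factor_fE hy hδ hn
  exact ⟨S, 1 / ((n : ℝ) + 1) / 2, half_pos hn0, hS, hS' _ (by
    rw [← mul_assoc, fE_mul_fE (half_pos hn0) (by linarith)])⟩

end General

/-! ### Realizing elements inside `Her e`. -/

section Realization

variable {A : Type u} [NonUnitalCStarAlgebra A] [PartialOrder A] [StarOrderedRing A]

variable (A) in
/-- Every strictly positive continuous affine function below `d(e)` is realized below `e`. -/
def RealizesAff : Prop :=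
  ∀ e : Stab A, 0 ≤ e → ∀ h : DQT A → ℝ, IsAffPos h →
    (∀ τ : DQT A, τ ≠ 0 → ENNReal.ofReal (h τ) < τ.d e) →
    ∃ y : Stab A, 0 ≤ y ∧ CuntzLE y e ∧ ∀ τ : DQT A, τ.d y = ENNReal.ofReal (h τ)

variable [IsSimpleRing A]

/-- A realizing `y` is only Cuntz below `e`. With `S⋆S = f_{δ/4}(y)` and `f_γ(e) S = S`, the map `z
↦ S z S⋆` moves `f_δ(y)` and its unit `f_{δ/2}(y)` into `Her e`. For these two `z` one has `S⋆S z =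
z`, so `S √z` implements the equivalence of `z` and `S z S⋆`. -/
lemma RealizesAff.exists_pair (h2 : RealizesAff A) {f : Stab A} (hf : IsScale f) {e : Stab A}
    (he : 0 ≤ e) {k : DQT A → ℝ} (hk : IsAffPos k)
    (hke : ∀ τ : DQT A, τ ≠ 0 → ENNReal.ofReal (k τ) < dim τ.toFun e) {η : ℝ} (hη : 0 < η) :
    ∃ (ζ₀ ζ : Stab A) (γ : ℝ), 0 < γ ∧ 0 ≤ ζ₀ ∧ ‖ζ₀‖ ≤ 1 ∧ 0 ≤ ζ ∧ ‖ζ‖ ≤ 1 ∧ ζ * ζ₀ = ζ₀ ∧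
      cfcₙ (fEps γ) e * ζ = ζ ∧ ∀ τ : DQT A, dim τ.toFun ζ ≤ ENNReal.ofReal (k τ) ∧
        k τ ≤ val τ.toFun ζ₀ + η * val τ.toFun f := by
  let Φ := Stab.isometryPair A
  obtain ⟨y, hy, hye, hyd⟩ := h2 e he k hk fun τ hτ => by rw [DQT.d_eq_dim]; exact hke τ hτ
  obtain ⟨δ, hδ, hδk⟩ := exists_le_val_fE hf hk.1
    (fun τ => by rw [← hyd τ, DQT.d_eq_dim]) hη
  obtain ⟨S, γ, hγ, hS, hSγ⟩ := hye.exists_factor hy he (half_pos (half_pos hδ))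
  set y₀ := cfcₙ (fEps δ) y with hy₀
  set y₁ := cfcₙ (fEps (δ / 2)) y with hy₁
  have h0 : 0 ≤ y₀ := fE_nonneg _ _
  have h1 : 0 ≤ y₁ := fE_nonneg _ _
  have hSn : ‖S‖ ≤ 1 := by
    have : ‖S‖ * ‖S‖ ≤ 1 := by
      rw [← CStarRing.norm_star_mul_self, hS]; exact norm_fE_le_one _ _
    nlinarith [norm_nonneg S]
  have hSm : S ∈ Ped (Stab A) := mem_ped_of_unit (fE_mem e hγ) hSγ
  have hnn : ∀ z : Stab A, 0 ≤ z → 0 ≤ S * z * star S := fun z hz =>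
    star_right_conjugate_nonneg hz S
  have hnorm : ∀ z : Stab A, ‖z‖ ≤ 1 → ‖S * z * star S‖ ≤ 1 := fun z hz => by
    refine (norm_mul_le _ _).trans (mul_le_one₀ ((norm_mul_le _ _).trans
      (mul_le_one₀ hSn (norm_nonneg _) hz)) (norm_nonneg _) ?_)
    rw [norm_star]; exact hSn
  have hfac : ∀ z : Stab A, 0 ≤ z → star S * S * z = z → ∃ W ∈ Ped (Stab A),
      W * star W = S * z * star S ∧ star W * W = z := fun z hz hSz => by
    obtain ⟨r, hr, hrz⟩ := exists_sqrt hz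
    refine ⟨S * r, mul_mem_ped_right _ hSm, ?_, ?_⟩
    · rw [star_mul, hr.isSelfAdjoint.star_eq, ← hrz]; noncomm_ring
    · rw [star_mul, hr.isSelfAdjoint.star_eq, mul_assoc, ← mul_assoc (star S),
        mul_sqrt_eq hr hrz hSz, hrz]
  refine ⟨S * y₀ * star S, S * y₁ * star S, γ, hγ, hnn _ h0, hnorm _ (norm_fE_le_one _ _),
    hnn _ h1, hnorm _ (norm_fE_le_one _ _), ?_, ?_, fun τ => ⟨?_, ?_⟩⟩
  · calc S * y₁ * star S * (S * y₀ * star S) = S * (y₁ * (star S * S) * y₀) * star S := by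
          noncomm_ring
      _ = S * y₀ * star S := by
        rw [hS, hy₁, hy₀, fE_mul_fE' (by positivity) (by linarith),
          fE_mul_fE (by positivity) (by linarith)]
  · rw [← mul_assoc, ← mul_assoc, hSγ]
  · obtain ⟨W, hW, hW1, hW2⟩ := hfac y₁ h1 (by
      rw [hS, hy₁, fE_mul_fE (by positivity) (by linarith)])
    rw [← hyd τ, DQT.d_eq_dim, ← hW1]
    have := τ.isQuasitrace.dim_star_mul_self Φ (star W)
    rw [star_star, hW2] at this
    obtain ⟨c, hc, -⟩ := exists_fE_eq_mul (half_pos hδ) hy.isSelfAdjoint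
    exact this.trans (τ.isQuasitrace.dim_le_of_inHer Φ hy h1 (InHer.of_mul hy c hc))
  · obtain ⟨W, hW, hW1, hW2⟩ := hfac y₀ h0 (by
      rw [hS, hy₀, fE_mul_fE (by positivity) (by linarith)])
    rw [← hW1, ← τ.isQuasitrace.val_tracial hW, hW2]
    exact hδk δ hδ le_rfl τ

/-- A positive contraction `p` in the Pedersen ideal dominates elements of almost proportional
size. -/
lemma RealizesAff.exists_fraction (h2 : RealizesAff A) {f : Stab A} (hf : IsScale f) {p : Stab A}
    (hp : p ∈ Ped (Stab A)) (hp0 : 0 ≤ p) (hp1 : ‖p‖ ≤ 1) {θ : ℝ} (hθ : 0 < θ) (hθ1 : θ < 1) {η : ℝ}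
    (hη : 0 < η) :
    ∃ (ζ₀ ζ : Stab A) (γ : ℝ), 0 < γ ∧ 0 ≤ ζ₀ ∧ ‖ζ₀‖ ≤ 1 ∧ 0 ≤ ζ ∧ ‖ζ‖ ≤ 1 ∧ ζ * ζ₀ = ζ₀ ∧
      cfcₙ (fEps γ) p * ζ = ζ ∧ ∀ τ : DQT A,
        dim τ.toFun ζ ≤ ENNReal.ofReal (θ * val τ.toFun p) ∧
        θ * val τ.toFun p ≤ val τ.toFun ζ₀ + η * val τ.toFun f := by
  let Φ := Stab.isometryPair A
  by_cases h0 : p = 0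
  · refine ⟨0, 0, 1, one_pos, le_rfl, by simp, le_rfl, by simp, by simp, by simp, fun τ => ?_⟩
    rw [h0, τ.isQuasitrace.val_zero, τ.isQuasitrace.dim_zero, mul_zero, zero_add]
    exact ⟨zero_le, mul_nonneg hη.le (τ.isQuasitrace.val_nonneg Φ hf.mem hf.nonneg)⟩
  · refine h2.exists_pair hf hp0 (isAffPos_val hp hp0 hθ) (fun τ hτ => ?_) hη
    have hpos := τ.isQuasitrace.val_pos Φ isAlgSimple_stab (DQT.toFun_ne_zero hτ) hp hp0 h0
    refine lt_of_lt_of_le ?_ (τ.isQuasitrace.val_le_dim Φ hp hp0 hp1)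
    rw [ENNReal.ofReal_lt_ofReal_iff hpos]
    nlinarith

/-- Realization needs a strict inequality, so the fraction `1 - t` is taken, with `t` so small that
`t τ(p)` is at most `(η/2) τ(f)`. -/
lemma RealizesAff.exists_fraction_one (h2 : RealizesAff A) {f : Stab A} (hf : IsScale f)
    {p : Stab A} (hp : p ∈ Ped (Stab A)) (hp0 : 0 ≤ p) (hp1 : ‖p‖ ≤ 1) {η : ℝ} (hη : 0 < η) :
    ∃ (ζ₀ ζ : Stab A) (γ : ℝ), 0 < γ ∧ 0 ≤ ζ₀ ∧ ‖ζ₀‖ ≤ 1 ∧ 0 ≤ ζ ∧ ‖ζ‖ ≤ 1 ∧ ζ * ζ₀ = ζ₀ ∧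
      cfcₙ (fEps γ) p * ζ = ζ ∧ ∀ τ : DQT A,
        val τ.toFun p ≤ val τ.toFun ζ₀ + η * val τ.toFun f := by
  let Φ := Stab.isometryPair A
  obtain ⟨C, hC, hCp⟩ := hf.exists_val_le Φ isAlgSimple_stab hp hp0
  set t := min (1 / 2) (η / 2 / (C + 1)) with ht
  have ht0 : 0 < t := by positivity
  have ht1 : t ≤ 1 / 2 := min_le_left _ _
  have ht2 : t * C ≤ η / 2 := by
    have : t ≤ η / 2 / (C + 1) := min_le_right _ _
    rw [le_div_iff₀ (by linarith)] at this
    nlinarith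
  obtain ⟨ζ₀, ζ, γ, h1, h2, h3, h4, h5, h6, h7, h8⟩ := h2.exists_fraction hf hp hp0 hp1
    (θ := 1 - t) (by linarith) (by linarith) (half_pos hη)
  refine ⟨ζ₀, ζ, γ, h1, h2, h3, h4, h5, h6, h7, fun τ => ?_⟩
  have := (h8 τ).2
  have := hCp τ.toFun τ.isQuasitrace
  have := τ.isQuasitrace.val_nonneg Φ hf.mem hf.nonneg
  nlinarith

end Realization

/-! ### Inner and outer elements, and the contraction of the gap. -/

section Pairs

variable {A : Type u} [NonUnitalCStarAlgebra A] [PartialOrder A] [StarOrderedRing A]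

variable (A) in
/-- A positive element `x` with a self-adjoint left unit `F`, and a threshold `s`. -/
structure UnitPair where
  x : Stab A
  F : Stab A
  s : ℝ
  x_nonneg : 0 ≤ x
  F_sa : IsSelfAdjoint F
  s_pos : 0 < s
  s_le : s ≤ 1 / 4
  F_mul_x : F * x = x

namespace UnitPair

/-- The inner element `f_s(x)` of a pair. -/
noncomputable def inn (P : UnitPair A) : Stab A := cfcₙ (fEps P.s) P.x

/-- The outer element `1 - f_s(1 - F)` of a pair. -/
noncomputable def out (P : UnitPair A) : Stab A := cfcₙ (cof P.s) P.F

variable (P : UnitPair A)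

lemma inn_nonneg : 0 ≤ P.inn := fE_nonneg _ _
lemma out_nonneg : 0 ≤ P.out := cof_cfc_nonneg _ _
lemma norm_inn_le : ‖P.inn‖ ≤ 1 := norm_fE_le_one _ _
lemma norm_out_le : ‖P.out‖ ≤ 1 := norm_cof_le_one _ _
lemma inn_mem : P.inn ∈ Ped (Stab A) := fE_mem _ P.s_pos
lemma out_mem : P.out ∈ Ped (Stab A) := cof_mem_ped _ P.s_pos P.s_le

lemma out_mul_inn : P.out * P.inn = P.inn :=
  mul_fE_eq P.s_pos P.x_nonneg.isSelfAdjoint (cof_mul_eq_self P.s_pos P.s_le P.F_sa P.F_mul_x)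

/-- The size of the gap between the inner and the outer element. -/
def Gap (f : Stab A) (g : ℝ) : Prop :=
  ∀ τ : DQT A, val τ.toFun P.out ≤ val τ.toFun P.inn + g * val τ.toFun f

variable [IsSimpleRing A]

/-- The inner element can be enlarged by half of the gap. -/
lemma exists_enlarge (h2 : RealizesAff A) {f : Stab A} (hf : IsScale f) {e : ℝ} (he : 0 < e) :
    ∃ X₀ X₁ : Stab A, 0 ≤ X₀ ∧ ‖X₀‖ ≤ 1 ∧ 0 ≤ X₁ ∧ ‖X₁‖ ≤ 1 ∧
      X₀ ∈ Ped (Stab A) ∧ X₁ ∈ Ped (Stab A) ∧ X₁ * X₀ = X₀ ∧ X₀ * P.inn = P.inn ∧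
      cfcₙ (cof (P.s / 8)) P.F * X₀ = X₀ ∧ cfcₙ (cof (P.s / 8)) P.F * X₁ = X₁ ∧
      ∀ τ : DQT A, ∃ a₁ a₃ b₄ : ℝ, a₁ ≤ val τ.toFun X₀ + e * val τ.toFun f ∧
        a₃ ≤ b₄ ∧ a₁ ≤ b₄ ∧
        val τ.toFun P.inn + (b₄ - a₁) / 2 ≤ val τ.toFun X₀ + e * val τ.toFun f ∧
        val τ.toFun X₁ ≤ a₃ + (b₄ - a₁) / 2 := by
  let Φ := Stab.isometryPair A
  obtain ⟨x, F, s, hx, hF, hs, hs4, hFx⟩ := P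
  simp only [inn]
  have hxs := hx.isSelfAdjoint
  set α₀ := cfcₙ (fEps s) x with hα₀
  set α₁ := cfcₙ (fEps (s / 2)) x with hα₁
  set α₂ := cfcₙ (fEps (s / 4)) x with hα₂
  set α₃ := cfcₙ (fEps (s / 8)) x with hα₃
  set B₃ := cfcₙ (cof (s / 8)) F with hB₃
  set B₄ := cfcₙ (cof (s / 16)) F with hB₄
  have h10 : α₁ * α₀ = α₀ := fE_mul_fE (by positivity) (by linarith) x
  have h20 : α₂ * α₀ = α₀ := fE_mul_fE (by positivity) (by linarith) x
  have h32 : α₃ * α₂ = α₂ := fE_mul_fE (by positivity) (by linarith) x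
  have hα₀n : 0 ≤ α₀ := fE_nonneg _ _
  have hα₁n : 0 ≤ α₁ := fE_nonneg _ _
  have hα₂n : 0 ≤ α₂ := fE_nonneg _ _
  have hα₃n : 0 ≤ α₃ := fE_nonneg _ _
  have hB₄n : 0 ≤ B₄ := cof_cfc_nonneg _ _
  have hB34 : B₃ * B₄ = B₄ :=
    cof_mul_cof_cfc (by positivity) (by linarith) (by positivity) (by linarith) F
  have hB3x : B₃ * x = x := cof_mul_eq_self (by positivity) (by linarith) hF hFx
  have hB4x : B₄ * x = x := cof_mul_eq_self (by positivity) (by linarith) hF hFx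
  have hB4α₁ : B₄ * α₁ = α₁ := mul_fE_eq (by positivity) hxs hB4x
  have hB4α₀ : B₄ * α₀ = α₀ := mul_fE_eq (by positivity) hxs hB4x
  have hB4α₃ : B₄ * α₃ = α₃ := mul_fE_eq (by positivity) hxs hB4x
  have hB3α₁ : B₃ * α₁ = α₁ := mul_fE_eq (by positivity) hxs hB3x
  have hB3α₂ : B₃ * α₂ = α₂ := mul_fE_eq (by positivity) hxs hB3x
  have hα₀m : α₀ ∈ Ped (Stab A) := fE_mem x hs
  have hα₁m : α₁ ∈ Ped (Stab A) := fE_mem x (by positivity)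
  have hα₂m : α₂ ∈ Ped (Stab A) := fE_mem x (by positivity)
  have hα₃m : α₃ ∈ Ped (Stab A) := fE_mem x (by positivity)
  have hB₄m : B₄ ∈ Ped (Stab A) := cof_mem_ped F (by positivity) (by linarith)
  have hp0 : 0 ≤ B₄ - α₁ := sub_nonneg.2
    (le_of_unit hα₁n (norm_fE_le_one _ _) hB₄n (norm_cof_le_one _ _) hB4α₁)
  have hp1 : ‖B₄ - α₁‖ ≤ 1 :=
    norm_sub_le_one_of_unit hα₁n (norm_fE_le_one _ _) hB₄n (norm_cof_le_one _ _) hB4α₁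
  have hpm : B₄ - α₁ ∈ Ped (Stab A) := sub_mem hB₄m hα₁m
  -- Half of `B₄ - α₁` is realized. Since `B₄` and `α₁` are units for `α₀`, everything below the
  -- difference is orthogonal to `α₀`; and `B₃` is a unit for it.
  obtain ⟨ζ₀, ζ, γ, hγ, hζ₀, hζ₀1, hζ, hζ1, hζζ, hγζ, hval⟩ :=
    h2.exists_fraction hf hpm hp0 hp1 (θ := 1 / 2) (by norm_num) (by norm_num) (half_pos he)
  have hζm : ζ ∈ Ped (Stab A) := mem_ped_of_unit (fE_mem _ hγ) hγζ
  have hζ₀m : ζ₀ ∈ Ped (Stab A) := mem_ped_of_unit hζm hζζ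
  have hζα : ζ * α₀ = 0 := by
    have h1 : ζ * cfcₙ (fEps γ) (B₄ - α₁) = ζ := mul_eq_of_mul_eq (fE_nonneg _ _) hζ hγζ
    have h3 : cfcₙ (fEps γ) (B₄ - α₁) * α₀ = 0 :=
      fE_mul_eq_zero hγ hp0.isSelfAdjoint (by rw [sub_mul, hB4α₀, h10, sub_self])
    rw [← h1, mul_assoc, h3, mul_zero]
  have hζ₀α : ζ₀ * α₀ = 0 := by
    rw [← mul_eq_of_mul_eq hζ hζ₀ hζζ, mul_assoc, hζα, mul_zero]
  have hB3ζ : B₃ * ζ = ζ := by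
    have h1 : B₃ * cfcₙ (fEps γ) (B₄ - α₁) = cfcₙ (fEps γ) (B₄ - α₁) :=
      mul_fE_eq hγ hp0.isSelfAdjoint (by rw [mul_sub, hB34, hB3α₁])
    rw [← hγζ, ← mul_assoc, h1]
  -- The summands need not commute, so `x'` is estimated through its dimension function: from above
  -- by subadditivity, from below by `α₂` and by the orthogonal sum `α₀ + ζ₀`.
  set x' := α₂ + ζ with hx'
  have hx'n : 0 ≤ x' := add_nonneg hα₂n hζ
  have hx'α : x' * α₀ = α₀ := by rw [hx', add_mul, h20, hζα, add_zero]
  have hB3x' : B₃ * x' = x' := by rw [hx', mul_add, hB3α₂, hB3ζ]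
  have hdx' : ∀ τ : DQT A, dim τ.toFun x' ≤ ENNReal.ofReal (val τ.toFun α₃ +
      (val τ.toFun B₄ - val τ.toFun α₁) / 2) := fun τ => by
    have hτ := τ.isQuasitrace
    have hv : val τ.toFun (B₄ - α₁) = val τ.toFun B₄ - val τ.toFun α₁ :=
      hτ.val_sub hB₄m hα₁m hB₄n.isSelfAdjoint hα₁n.isSelfAdjoint
        (by rw [hB4α₁, mul_eq_of_mul_eq hB₄n hα₁n hB4α₁])
    have hv0 := hτ.val_nonneg Φ hpm hp0
    rw [hv] at hv0
    rw [ENNReal.ofReal_add (hτ.val_nonneg Φ hα₃m hα₃n) (by linarith)]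
    refine (hτ.dim_add_le Φ hα₂n hζ).trans (add_le_add
      (hτ.dim_le_of_unit Φ hα₂n hα₃m hα₃n (norm_fE_le_one _ _) h32) ?_)
    refine (hval τ).1.trans_eq ?_
    rw [hv]; congr 1; ring
  obtain ⟨δ₁, hδ₁, hδ₁'⟩ := exists_le_val_fE hf (y := x') (DQT.isAff_val α₂) (fun τ =>
    (τ.isQuasitrace.val_le_dim Φ hα₂m hα₂n (norm_fE_le_one _ _)).trans
      (τ.isQuasitrace.dim_mono Φ hα₂n (le_add_of_nonneg_right hζ))) he
  have hα₀ζ₀ : α₀ * ζ₀ = 0 := mul_eq_zero_symm hζ₀ hα₀n hζ₀α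
  obtain ⟨δ₂, hδ₂, hδ₂'⟩ := exists_le_val_fE hf (y := x') (DQT.isAff_val (α₀ + ζ₀)) (fun τ => by
    refine (τ.isQuasitrace.val_le_dim Φ (add_mem hα₀m hζ₀m) (add_nonneg hα₀n hζ₀)
      (norm_add_le_one_of_orthogonal hα₀n hζ₀ (norm_fE_le_one _ _) hζ₀1 hα₀ζ₀ hζ₀α)).trans
      (τ.isQuasitrace.dim_le_of_inHer Φ hx'n (add_nonneg hα₀n hζ₀) (InHer.add ?_ ?_))
    · exact InHer.of_mul hx'n α₀ hx'α.symm
    · exact (InHer.of_le hζ (le_add_of_nonneg_left hα₂n)).trans hζ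
        (InHer.of_mul hζ ζ₀ hζζ.symm)) (half_pos he)
  set t := min (min δ₁ δ₂) (1 / 2) with ht
  have ht0 : 0 < t := by positivity
  have ht1 : t ≤ δ₁ := (min_le_left _ _).trans (min_le_left _ _)
  have ht2 : t ≤ δ₂ := (min_le_left _ _).trans (min_le_right _ _)
  refine ⟨cfcₙ (fEps t) x', cfcₙ (fEps (t / 2)) x', fE_nonneg _ _, norm_fE_le_one _ _,
    fE_nonneg _ _, norm_fE_le_one _ _, fE_mem _ ht0, fE_mem _ (half_pos ht0),
    fE_mul_fE (half_pos ht0) (by linarith) _,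
    fE_mul_eq_self ht0 (min_le_right _ _) hx'n.isSelfAdjoint hx'α,
    mul_fE_eq ht0 hx'n.isSelfAdjoint hB3x', mul_fE_eq (half_pos ht0) hx'n.isSelfAdjoint hB3x',
    fun τ => ⟨val τ.toFun α₁, val τ.toFun α₃, val τ.toFun B₄, ?_, ?_, ?_, ?_, ?_⟩⟩
  · refine le_trans ?_ (hδ₁' t ht0 ht1 τ)
    exact τ.isQuasitrace.val_fE_anti Φ x (by positivity) (by linarith)
  · exact τ.isQuasitrace.val_mono Φ hα₃m hB₄m hα₃n.isSelfAdjoint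
      (le_of_unit hα₃n (norm_fE_le_one _ _) hB₄n (norm_cof_le_one _ _) hB4α₃)
      (by rw [hB4α₃, mul_eq_of_mul_eq hB₄n hα₃n hB4α₃])
  · exact τ.isQuasitrace.val_mono Φ hα₁m hB₄m hα₁n.isSelfAdjoint (sub_nonneg.1 hp0)
      (by rw [hB4α₁, mul_eq_of_mul_eq hB₄n hα₁n hB4α₁])
  · have hτ := τ.isQuasitrace
    have h3 := hδ₂' t ht0 ht2 τ
    rw [hτ.val_add hα₀m hζ₀m hα₀n.isSelfAdjoint hζ₀.isSelfAdjoint (by rw [hα₀ζ₀, hζ₀α])] at h3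
    have h4 := (hval τ).2
    rw [hτ.val_sub hB₄m hα₁m hB₄n.isSelfAdjoint hα₁n.isSelfAdjoint
        (by rw [hB4α₁, mul_eq_of_mul_eq hB₄n hα₁n hB4α₁])] at h4
    linarith
  · have hτ := τ.isQuasitrace
    have h3 := (hτ.val_fE_le_dim Φ x' (half_pos ht0)).trans (hdx' τ)
    have h4 := hτ.val_mono Φ hα₁m hB₄m hα₁n.isSelfAdjoint (sub_nonneg.1 hp0)
      (by rw [hB4α₁, mul_eq_of_mul_eq hB₄n hα₁n hB4α₁])
    rwa [ENNReal.ofReal_le_ofReal_iff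
      (add_nonneg (hτ.val_nonneg Φ hα₃m hα₃n) (by linarith))] at h3

/-- The gap can be shrunk by a fixed factor. -/
lemma exists_step (h2 : RealizesAff A) {f : Stab A} (hf : IsScale f) {g : ℝ} (hg : 0 < g)
    (hP : P.Gap f g) : ∃ Q : UnitPair A, Q.inn * P.inn = P.inn ∧ P.out * Q.out = Q.out ∧
      Q.Gap f (9 / 10 * g) := by
  let Φ := Stab.isometryPair A
  -- The value `g / 100` makes all approximation errors small compared with the gain of at least
  -- about a quarter of `g`.
  have he : 0 < g / 100 := by positivity
  obtain ⟨X₀, X₁, hX₀, hX₀1, hX₁, hX₁1, hX₀m, hX₁m, hXX, hXi, hB3X₀, hB3X₁, hest⟩ :=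
    P.exists_enlarge h2 hf he
  have hs := P.s_pos
  have hs4 := P.s_le
  set B₁ := cfcₙ (cof (P.s / 2)) P.F with hB₁
  set B₂ := cfcₙ (cof (P.s / 4)) P.F with hB₂
  set B₃ := cfcₙ (cof (P.s / 8)) P.F with hB₃
  set B₀ := P.out with hB₀
  have hB₁n : 0 ≤ B₁ := cof_cfc_nonneg _ _
  have hB₂n : 0 ≤ B₂ := cof_cfc_nonneg _ _
  have hB₃n : 0 ≤ B₃ := cof_cfc_nonneg _ _
  have hB₀n : 0 ≤ B₀ := P.out_nonneg
  have hB₂m : B₂ ∈ Ped (Stab A) := cof_mem_ped P.F (by positivity) (by linarith)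
  have h01 : B₀ * B₁ = B₁ := cof_mul_cof_cfc hs hs4 (by positivity) (by linarith) P.F
  have h03 : B₀ * B₃ = B₃ := cof_mul_cof_cfc hs hs4 (by positivity) (by linarith) P.F
  have h12 : B₁ * B₂ = B₂ :=
    cof_mul_cof_cfc (by positivity) (by linarith) (by positivity) (by linarith) P.F
  have h13 : B₁ * B₃ = B₃ :=
    cof_mul_cof_cfc (by positivity) (by linarith) (by positivity) (by linarith) P.F
  have h23 : B₂ * B₃ = B₃ :=
    cof_mul_cof_cfc (by positivity) (by linarith) (by positivity) (by linarith) P.F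
  have hB2X₁ : B₂ * X₁ = X₁ := by rw [← hB3X₁, ← mul_assoc, h23]
  have hB2X₀ : B₂ * X₀ = X₀ := by rw [← hB3X₀, ← mul_assoc, h23]
  have hB1X₁ : B₁ * X₁ = X₁ := by rw [← hB3X₁, ← mul_assoc, h13]
  have hp0 : 0 ≤ B₂ - X₁ := sub_nonneg.2 (le_of_unit hX₁ hX₁1 hB₂n (norm_cof_le_one _ _) hB2X₁)
  have hp1 : ‖B₂ - X₁‖ ≤ 1 := norm_sub_le_one_of_unit hX₁ hX₁1 hB₂n (norm_cof_le_one _ _) hB2X₁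
  have hpm : B₂ - X₁ ∈ Ped (Stab A) := sub_mem hB₂m hX₁m
  obtain ⟨ζ₀, ζ, γ, hγ, hζ₀, hζ₀1, hζ, hζ1, hζζ, hγζ, hval⟩ :=
    h2.exists_fraction_one hf hpm hp0 hp1 he
  have hζm : ζ ∈ Ped (Stab A) := mem_ped_of_unit (fE_mem _ hγ) hγζ
  have hζ₀m : ζ₀ ∈ Ped (Stab A) := mem_ped_of_unit hζm hζζ
  have hζX₀ : ζ * X₀ = 0 := by
    have h1 : ζ * cfcₙ (fEps γ) (B₂ - X₁) = ζ := mul_eq_of_mul_eq (fE_nonneg _ _) hζ hγζ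
    have h3 : cfcₙ (fEps γ) (B₂ - X₁) * X₀ = 0 :=
      fE_mul_eq_zero hγ hp0.isSelfAdjoint (by rw [sub_mul, hB2X₀, hXX, sub_self])
    rw [← h1, mul_assoc, h3, mul_zero]
  have hB1ζ : B₁ * ζ = ζ := by
    have h1 : B₁ * cfcₙ (fEps γ) (B₂ - X₁) = cfcₙ (fEps γ) (B₂ - X₁) :=
      mul_fE_eq hγ hp0.isSelfAdjoint (by rw [mul_sub, h12, hB1X₁])
    rw [← hγζ, ← mul_assoc, h1]
  have hB0ζ : B₀ * ζ = ζ := by rw [← hB1ζ, ← mul_assoc, h01]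
  have hB1ζ₀ : B₁ * ζ₀ = ζ₀ := by rw [← hζζ, ← mul_assoc, hB1ζ]
  have hB0ζ₀ : B₀ * ζ₀ = ζ₀ := by rw [← hζζ, ← mul_assoc, hB0ζ]
  obtain ⟨δ, hδ, hδ'⟩ := exists_val_le_val_fE_add hf hX₀m hX₀ hX₀1 he
  set t := min δ (1 / 4) with ht
  have ht0 : 0 < t := by positivity
  have ht4 : t ≤ 1 / 4 := min_le_right _ _
  -- Removing from `B₃` an element `ζ` orthogonal to `X₀` leaves a unit for `X₀`. It need not be
  -- positive, which is why pairs only ask for self-adjoint units.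
  have hFsa : IsSelfAdjoint (B₃ - ζ) := hB₃n.isSelfAdjoint.sub hζ.isSelfAdjoint
  refine ⟨⟨X₀, B₃ - ζ, t, hX₀, hFsa, ht0, ht4, by rw [sub_mul, hB3X₀, hζX₀, sub_zero]⟩,
    fE_mul_eq_self ht0 (by linarith) hX₀.isSelfAdjoint hXi, ?_, fun τ => ?_⟩
  · obtain ⟨c, hc⟩ := exists_cof_eq_mul ht0 ht4 hFsa
    change B₀ * cfcₙ (cof t) (B₃ - ζ) = cfcₙ (cof t) (B₃ - ζ)
    rw [hc, ← mul_assoc, mul_sub, h03, hB0ζ]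
  · have hτ := τ.isQuasitrace
    change val τ.toFun (cfcₙ (cof t) (B₃ - ζ)) ≤ val τ.toFun (cfcₙ (fEps t) X₀) + _
    have hDm : cfcₙ (cof t) (B₃ - ζ) ∈ Ped (Stab A) := cof_mem_ped _ ht0 ht4
    have hDd := hτ.val_le_dim Φ hDm (cof_cfc_nonneg _ _) (norm_cof_le_one _ _)
    -- Two upper bounds for the new outer element: from `B₃ - ζ ≤ B₃` and from `B₃ - ζ ≤ B₁ - ζ`.
    -- The second is useful because `B₀ - ζ₀` is a unit for `B₁ - ζ` and has value `τ(B₀) - τ(ζ₀)`.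
    have hT1 : val τ.toFun (cfcₙ (cof t) (B₃ - ζ)) ≤ val τ.toFun B₂ := by
      rw [← ENNReal.ofReal_le_ofReal_iff (hτ.val_nonneg Φ hB₂m hB₂n)]
      exact hDd.trans ((hτ.dim_cof_le Φ ht0 ht4 hFsa hB₃n (sub_le_self _ hζ)).trans
        (hτ.dim_le_of_unit Φ hB₃n hB₂m hB₂n (norm_cof_le_one _ _) h23))
    have hT2 : val τ.toFun (cfcₙ (cof t) (B₃ - ζ)) ≤ val τ.toFun B₀ - val τ.toFun ζ₀ := by
      have hR : 0 ≤ B₁ - ζ := sub_nonneg.2 (le_of_unit hζ hζ1 hB₁n (norm_cof_le_one _ _) hB1ζ)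
      have hS : 0 ≤ B₀ - ζ₀ := sub_nonneg.2 (le_of_unit hζ₀ hζ₀1 hB₀n P.norm_out_le hB0ζ₀)
      have hSm : B₀ - ζ₀ ∈ Ped (Stab A) := sub_mem P.out_mem hζ₀m
      have hle : B₃ - ζ ≤ B₁ - ζ := sub_le_sub_right
        (le_of_unit hB₃n (norm_cof_le_one _ _) hB₁n (norm_cof_le_one _ _) h13) _
      have hunit : (B₀ - ζ₀) * (B₁ - ζ) = B₁ - ζ := by
        rw [sub_mul, mul_sub, mul_sub, h01, hB0ζ, mul_eq_of_mul_eq hB₁n hζ₀ hB1ζ₀,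
          mul_eq_of_mul_eq hζ hζ₀ hζζ, sub_self, sub_zero]
      rw [← hτ.val_sub P.out_mem hζ₀m hB₀n.isSelfAdjoint hζ₀.isSelfAdjoint
        (by rw [hB0ζ₀, mul_eq_of_mul_eq hB₀n hζ₀ hB0ζ₀]),
        ← ENNReal.ofReal_le_ofReal_iff (hτ.val_nonneg Φ hSm hS)]
      exact hDd.trans ((hτ.dim_cof_le Φ ht0 ht4 hFsa hR hle).trans
        (hτ.dim_le_of_unit Φ hR hSm hS
          (norm_sub_le_one_of_unit hζ₀ hζ₀1 hB₀n P.norm_out_le hB0ζ₀) hunit))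
    have h3 := hval τ
    rw [hτ.val_sub hB₂m hX₁m hB₂n.isSelfAdjoint hX₁.isSelfAdjoint
      (by rw [hB2X₁, mul_eq_of_mul_eq hB₂n hX₁ hB2X₁])] at h3
    have h4 := hδ' t ht0 (min_le_left _ _) τ
    have h5 := hP τ
    obtain ⟨a₁, a₃, b₄, e1, e2, e3, e4, e5⟩ := hest τ
    have h6 : val τ.toFun B₂ ≤ val τ.toFun B₀ := hτ.val_mono Φ hB₂m P.out_mem hB₂n.isSelfAdjoint
      (le_of_unit hB₂n (norm_cof_le_one _ _) hB₀n P.norm_out_le (by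
        rw [← h12, ← mul_assoc, h01])) (by
        rw [show B₀ * B₂ = B₂ by rw [← h12, ← mul_assoc, h01], mul_eq_of_mul_eq hB₀n hB₂n (by
        rw [← h12, ← mul_assoc, h01])])
    have h7 : 0 ≤ g * val τ.toFun f := mul_nonneg hg.le (hτ.val_nonneg Φ hf.mem hf.nonneg)
    rw [div_mul_eq_mul_div] at e1 e4 h3 h4
    rw [mul_assoc]
    -- Write `G = gτ(f)` and `m = (b₄ - a₁)/2`. Up to the errors, the inner value grows by `m`, so
    -- the gap is at most `G - m`. Averaging the two upper bounds, together with `τ(X₁) ≤ a₃ + m ≤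
    -- a₁ + 3m`, bounds it by `G/2 + m`. The worst case `m = G/4` gives `3G/4`, and the errors fit
    -- below `9G/10`.
    linarith

end UnitPair

end Pairs

/-! ### Infinite sums and compressions by `1 - D`. -/

section General

variable {B : Type*} [NonUnitalCStarAlgebra B]

lemma InHer.sum {ι : Type*} {e : B} {s : Finset ι} {v : ι → B} (h : ∀ i ∈ s, InHer e (v i)) :
    InHer e (∑ i ∈ s, v i) := by
  classical
  induction s using Finset.induction_on with
  | empty => simpa using InHer.zero e
  | insert i s hi ih =>
    rw [Finset.sum_insert hi]
    exact (h i (Finset.mem_insert_self _ _)).add (ih fun j hj => h j (Finset.mem_insert_of_mem hj))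

lemma summable_geometric_smul {a : ℕ → B} {M : ℝ} (hM : ∀ n, ‖a n‖ ≤ M) :
    Summable fun n => ((1 / 2 : ℝ) ^ n) • a n := by
  refine Summable.of_norm_bounded (g := fun n => (1 / 2 : ℝ) ^ n * M)
    ((summable_geometric_of_lt_one (by norm_num) (by norm_num)).mul_right M) fun n => ?_
  rw [norm_smul, Real.norm_of_nonneg (by positivity)]
  exact mul_le_mul_of_nonneg_left (hM n) (by positivity)

variable [PartialOrder B] [StarOrderedRing B]

lemma InHer.of_hasSum {e y : B} {v : ℕ → B} (h : ∀ n, InHer e (v n)) (hy : HasSum v y) :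
    InHer e y :=
  InHer.of_tendsto (fun n => InHer.sum fun i _ => h i) hy.tendsto_sum_nat

lemma le_of_hasSum {y : B} {v : ℕ → B} (h : ∀ n, 0 ≤ v n) (hy : HasSum v y) (n : ℕ) : v n ≤ y :=
  le_hasSum hy n fun m _ => h m

/-- The compression of `e` by `1 - D`. -/
def compr (e D : B) : B := (e - e * D) - D * (e - e * D)

lemma compr_eq {r e D : B} (hr : 0 ≤ r) (hre : r * r = e) (hD : 0 ≤ D) :
    compr e D = (r - D * r) * star (r - D * r) := by
  rw [star_sub, star_mul, hr.isSelfAdjoint.star_eq, hD.isSelfAdjoint.star_eq, compr, ← hre]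
  noncomm_ring

lemma compr_nonneg {e D : B} (he : 0 ≤ e) (hD : 0 ≤ D) : 0 ≤ compr e D := by
  obtain ⟨r, hr, hre⟩ := exists_sqrt he
  rw [compr_eq hr hre hD]
  exact mul_star_self_nonneg _

lemma norm_compr_le {e D : B} (hD : ‖D‖ ≤ 1) : ‖compr e D‖ ≤ 4 * ‖e‖ := by
  have h1 : ‖e - e * D‖ ≤ 2 * ‖e‖ := by
    refine (norm_sub_le _ _).trans ?_
    have := (norm_mul_le e D).trans (mul_le_of_le_one_right (norm_nonneg _) hD)
    linarith
  refine (norm_sub_le _ _).trans ?_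
  have := (norm_mul_le D (e - e * D)).trans (mul_le_of_le_one_left (norm_nonneg _) hD)
  linarith

lemma InHer.compr {e D : B} (he : 0 ≤ e) (hD : InHer e D) : InHer e (compr e D) :=
  ((InHer.self he).sub ((InHer.self he).mul_right D)).sub (hD.mul_right _)

lemma mul_compr_eq_zero {a e D : B} (h : a * D = a) : a * compr e D = 0 := by
  rw [compr, mul_sub, ← mul_assoc, h, sub_self]

/-- With `r = √e` and `w = D r`, the parallelogram law gives `e ≤ 2(w⋆w + (r - w)⋆(r - w))`. Here
`ww⋆` has the unit `E`, and `(r - w)(r - w)⋆` is the compression. -/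
lemma IsQuasitrace.dim_le_add_compr {τ : Ped B → ℂ} (hτ : IsQuasitrace τ) (Φ : IsometryPair B)
    {e D E : B} (he : 0 ≤ e) (hD : 0 ≤ D) (hE : 0 ≤ E) (hE1 : ‖E‖ ≤ 1) (hEm : E ∈ Ped B)
    (hED : E * D = D) : dim τ e ≤ ENNReal.ofReal (val τ E) + dim τ (compr e D) := by
  obtain ⟨r, hr, hre⟩ := exists_sqrt he
  set w := D * r with hw
  have h1 : e ≤ (2 : ℝ) • (star w * w + star (r - w) * (r - w)) := by
    have h2 : (2 : ℝ) • (star w * w + star (r - w) * (r - w)) - e =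
        star (r - (w + w)) * (r - (w + w)) := by
      rw [two_smul, star_sub, star_sub, star_add, hr.isSelfAdjoint.star_eq, ← hre]
      noncomm_ring
    rw [← sub_nonneg, h2]
    exact star_mul_self_nonneg _
  have hz1 : 0 ≤ star w * w := star_mul_self_nonneg _
  have hz2 : 0 ≤ star (r - w) * (r - w) := star_mul_self_nonneg _
  refine (hτ.dim_le_smul Φ he (add_nonneg hz1 hz2) h1).trans
    ((hτ.dim_add_le Φ hz1 hz2).trans (add_le_add ?_ ?_))
  · refine (hτ.dim_star_mul_self Φ w).trans
      (hτ.dim_le_of_unit Φ (mul_star_self_nonneg w) hEm hE hE1 ?_)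
    rw [hw, ← mul_assoc, ← mul_assoc, hED]
  · rw [compr_eq hr hre hD]
    exact hτ.dim_star_mul_self Φ _

end General

/-! ### Splitting off an element with continuous dimension function. -/

section Splitting

variable {A : Type u} [NonUnitalCStarAlgebra A] [PartialOrder A] [StarOrderedRing A]
variable [IsSimpleRing A]

lemma IsAffPos.nonneg {k : DQT A → ℝ} (hk : IsAffPos k) (τ : DQT A) : 0 ≤ k τ := by
  rcases hk.2 with h | h
  · by_cases h0 : τ = 0
    · rw [h0, hk.1.map_zero]
    · exact (h τ h0).le
  · rw [h]; rfl

namespace UnitPair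

/-- The gap bound `(9/10)^n g` depends on `n`, so the recursion carries it in the type of the `n`-th
pair. -/
lemma exists_sequence (h2 : RealizesAff A) {f : Stab A} (hf : IsScale f) {g : ℝ} (hg : 0 < g)
    (P : UnitPair A) (hP : P.Gap f g) : ∃ Q : ℕ → UnitPair A, Q 0 = P ∧
      (∀ n, (Q n).Gap f ((9 / 10) ^ n * g)) ∧ (∀ n, (Q (n + 1)).inn * (Q n).inn = (Q n).inn) ∧
      ∀ n, (Q n).out * (Q (n + 1)).out = (Q (n + 1)).out := by
  choose F hF1 hF2 hF3 using fun (n : ℕ) (R : {R : UnitPair A // R.Gap f ((9 / 10) ^ n * g)}) =>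
    R.1.exists_step h2 hf (by positivity) R.2
  let Q : (n : ℕ) → {R : UnitPair A // R.Gap f ((9 / 10) ^ n * g)} := fun n =>
    Nat.rec ⟨P, by simpa using hP⟩
      (fun n R => ⟨F n R, by rw [pow_succ', mul_assoc]; exact hF3 n R⟩) n
  exact ⟨fun n => (Q n).1, rfl, fun n => (Q n).2, fun n => hF1 n (Q n), fun n => hF2 n (Q n)⟩

variable {Q : ℕ → UnitPair A}

lemma inn_chain (h : ∀ n, (Q (n + 1)).inn * (Q n).inn = (Q n).inn) {m n : ℕ} (hmn : m < n) :
    (Q n).inn * (Q m).inn = (Q m).inn := by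
  induction n, hmn using Nat.le_induction with
  | base => exact h m
  | succ n hn ih => rw [← ih, ← mul_assoc, h n]

lemma out_chain (h : ∀ n, (Q n).out * (Q (n + 1)).out = (Q (n + 1)).out) {m n : ℕ} (hmn : m < n) :
    (Q m).out * (Q n).out = (Q n).out := by
  induction n, hmn using Nat.le_induction with
  | base => exact h m
  | succ n hn ih => rw [← h n, ← mul_assoc, ih]

lemma out_mul_inn_chain (h : ∀ n, (Q (n + 1)).inn * (Q n).inn = (Q n).inn)
    (h' : ∀ n, (Q n).out * (Q (n + 1)).out = (Q (n + 1)).out) (m n : ℕ) :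
    (Q m).out * (Q n).inn = (Q n).inn := by
  rcases lt_trichotomy m n with hmn | rfl | hmn
  · rw [← (Q n).out_mul_inn, ← mul_assoc, out_chain h' hmn]
  · exact (Q m).out_mul_inn
  · rw [← inn_chain h hmn, ← mul_assoc, (Q m).out_mul_inn]

end UnitPair

/-- An element below `e` whose dimension function is continuous and close to a prescribed function,
together with a complement. -/
lemma RealizesAff.exists_split (h2 : RealizesAff A) {f : Stab A} (hf : IsScale f) {e : Stab A}
    (he : 0 ≤ e) {k : DQT A → ℝ} (hk : IsAffPos k)
    (hke : ∀ τ : DQT A, τ ≠ 0 → ENNReal.ofReal (k τ) < dim τ.toFun e) {η : ℝ} (hη : 0 < η) :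
    ∃ (y V : Stab A) (κ : DQT A → ℝ), 0 ≤ y ∧ 0 ≤ V ∧ InHer e y ∧ InHer e V ∧ y * V = 0 ∧
      IsAffPos κ ∧ ∀ τ : DQT A, dim τ.toFun y = ENNReal.ofReal (κ τ) ∧ κ τ ≤ k τ ∧
        k τ ≤ κ τ + η * val τ.toFun f ∧ dim τ.toFun e ≤ dim τ.toFun y + dim τ.toFun V := by
  let Φ := Stab.isometryPair A
  obtain ⟨ζ₀, ζ, γ, hγ, hζ₀, hζ₀1, hζ, hζ1, hζζ, hγζ, hval⟩ :=
    h2.exists_pair hf he hk hke (half_pos hη)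
  have hζm : ζ ∈ Ped (Stab A) := mem_ped_of_unit (fE_mem _ hγ) hγζ
  have hζ₀m : ζ₀ ∈ Ped (Stab A) := mem_ped_of_unit hζm hζζ
  obtain ⟨δ, hδ, hδ'⟩ := exists_val_le_val_fE_add hf hζ₀m hζ₀ hζ₀1 (half_pos hη)
  have hs0 : 0 < min δ (1 / 4) := by positivity
  let P : UnitPair A := ⟨ζ₀, ζ, min δ (1 / 4), hζ₀, hζ.isSelfAdjoint, hs0, min_le_right _ _, hζζ⟩
  have hPout : ∀ τ : DQT A, val τ.toFun P.out ≤ k τ := fun τ => by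
    rw [← ENNReal.ofReal_le_ofReal_iff (hk.nonneg τ)]
    exact (τ.isQuasitrace.val_le_dim Φ P.out_mem P.out_nonneg P.norm_out_le).trans
      ((τ.isQuasitrace.dim_cof_le Φ P.s_pos P.s_le P.F_sa hζ le_rfl).trans (hval τ).1)
  have hPinn : ∀ τ : DQT A, k τ ≤ val τ.toFun P.inn + η * val τ.toFun f := fun τ => by
    have h1 := (hval τ).2
    have h3 : val τ.toFun ζ₀ ≤ val τ.toFun P.inn + η / 2 * val τ.toFun f :=
      hδ' _ hs0 (min_le_left _ _) τ
    linarith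
  obtain ⟨Q, hQ0, hgap, hinn, hout⟩ := UnitPair.exists_sequence h2 hf hη P
    fun τ => (hPout τ).trans (hPinn τ)
  have hDa := UnitPair.out_mul_inn_chain hinn hout
  have haD : ∀ m n, (Q n).inn * (Q m).out = (Q n).inn := fun m n =>
    mul_eq_of_mul_eq (Q m).out_nonneg (Q n).inn_nonneg (hDa m n)
  have hamono : ∀ τ : DQT A, Monotone fun n => val τ.toFun (Q n).inn := fun τ =>
    monotone_nat_of_le_succ fun n => τ.isQuasitrace.val_mono Φ (Q n).inn_mem (Q (n + 1)).inn_mem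
      (Q n).inn_nonneg.isSelfAdjoint (le_of_unit (Q n).inn_nonneg (Q n).norm_inn_le
        (Q (n + 1)).inn_nonneg (Q (n + 1)).norm_inn_le (hinn n))
      (by rw [hinn n, mul_eq_of_mul_eq (Q (n + 1)).inn_nonneg (Q n).inn_nonneg (hinn n)])
  have hale : ∀ (τ : DQT A) m n, val τ.toFun (Q n).inn ≤ val τ.toFun (Q m).out := fun τ m n =>
    τ.isQuasitrace.val_mono Φ (Q n).inn_mem (Q m).out_mem
      (Q n).inn_nonneg.isSelfAdjoint (le_of_unit (Q n).inn_nonneg (Q n).norm_inn_le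
        (Q m).out_nonneg (Q m).norm_out_le (hDa m n))
      (by rw [hDa m n, haD m n])
  -- The inner values increase and stay below every outer value, so `κ` lies between them and both
  -- sides converge to it.
  let κ : DQT A → ℝ := fun τ => ⨆ n, val τ.toFun (Q n).inn
  have hbdd : ∀ τ : DQT A, BddAbove (Set.range fun n => val τ.toFun (Q n).inn) := fun τ =>
    ⟨val τ.toFun (Q 0).out, by rintro _ ⟨n, rfl⟩; exact hale τ 0 n⟩
  have hlim : ∀ τ : DQT A, Tendsto (fun n => val τ.toFun (Q n).inn) atTop (𝓝 (κ τ)) := fun τ =>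
    tendsto_atTop_ciSup (hamono τ) (hbdd τ)
  have haκ : ∀ (τ : DQT A) n, val τ.toFun (Q n).inn ≤ κ τ := fun τ n => le_ciSup (hbdd τ) n
  have hκD : ∀ (τ : DQT A) n, κ τ ≤ val τ.toFun (Q n).out := fun τ n => ciSup_le fun m => hale τ n m
  have hκ0 : ∀ τ : DQT A, 0 ≤ κ τ := fun τ =>
    (τ.isQuasitrace.val_nonneg Φ (Q 0).inn_mem (Q 0).inn_nonneg).trans (haκ τ 0)
  have hf0 : ∀ τ : DQT A, 0 ≤ val τ.toFun f := fun τ =>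
    τ.isQuasitrace.val_nonneg Φ hf.mem hf.nonneg
  have hκcont : Continuous κ := by
    -- The error is at most `(9/10)^n η τ(f)`, and `τ(f)` is bounded near `τ₀`. A locally uniform
    -- limit of continuous functions is continuous.
    have hu : TendstoLocallyUniformly (fun (n : ℕ) (τ : DQT A) => val τ.toFun (Q n).inn) κ
        atTop := by
      rw [Metric.tendstoLocallyUniformly_iff]
      intro ε hε τ₀
      refine ⟨{τ | val τ.toFun f < val τ₀.toFun f + 1},
        (isOpen_lt (DQT.continuous_val f) continuous_const).mem_nhds
          (show val τ₀.toFun f < val τ₀.toFun f + 1 by linarith), ?_⟩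
      have ht : Tendsto (fun n : ℕ => (9 / 10 : ℝ) ^ n * (η * (val τ₀.toFun f + 1))) atTop
          (𝓝 (0 * (η * (val τ₀.toFun f + 1)))) :=
        (tendsto_pow_atTop_nhds_zero_of_lt_one (by norm_num) (by norm_num)).mul_const _
      rw [zero_mul] at ht
      filter_upwards [ht.eventually_lt_const hε] with n hn τ hτ
      have hτ' : val τ.toFun f < val τ₀.toFun f + 1 := hτ
      rw [Real.dist_eq, abs_of_nonneg (sub_nonneg.2 (haκ τ n))]
      have h1 := hκD τ n
      have h3 := hgap n τ
      have h4 : (9 / 10 : ℝ) ^ n * η * val τ.toFun f ≤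
          (9 / 10 : ℝ) ^ n * η * (val τ₀.toFun f + 1) :=
        mul_le_mul_of_nonneg_left hτ'.le (by positivity)
      rw [← mul_assoc] at hn
      linarith
    exact hu.continuous (Eventually.of_forall fun n => DQT.continuous_val _).frequently
  have hκaff : IsAff κ := ⟨hκcont,
    fun s τ => tendsto_nhds_unique (hlim _) (by
      simp only [DQT.val_smul_apply]; exact (hlim τ).const_mul _),
    fun τ σ => tendsto_nhds_unique (hlim _) (by
      simp only [DQT.val_add_apply]; exact (hlim τ).add (hlim σ))⟩
  have hsum := (summable_geometric_smul fun n => (Q n).norm_inn_le).hasSum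
  set y := ∑' n, ((1 / 2 : ℝ) ^ n) • (Q n).inn with hy
  have hterm : ∀ n, 0 ≤ ((1 / 2 : ℝ) ^ n) • (Q n).inn := fun n =>
    smul_nonneg (by positivity) (Q n).inn_nonneg
  have hy0 : 0 ≤ y := hsum.nonneg hterm
  have hdy : ∀ τ : DQT A, dim τ.toFun y = ENNReal.ofReal (κ τ) := fun τ => by
    have hτ := τ.isQuasitrace
    refine le_antisymm ?_ ?_
    · refine hτ.dim_le_of_tendsto Φ hy0 (fun N => Finset.sum_nonneg fun n _ => hterm n)
        hsum.tendsto_sum_nat fun N => ?_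
      -- The `N`-th partial sum involves only the inner elements before `N`, and the inner element
      -- `N` is a unit for all of them.
      refine (hτ.dim_le_of_unit Φ (Finset.sum_nonneg fun n _ => hterm n) (Q N).inn_mem
        (Q N).inn_nonneg (Q N).norm_inn_le ?_).trans (ENNReal.ofReal_le_ofReal (haκ τ N))
      rw [Finset.mul_sum]
      refine Finset.sum_congr rfl fun n hn => ?_
      rw [mul_smul_comm, UnitPair.inn_chain hinn (Finset.mem_range.1 hn)]
    · refine le_of_tendsto' ((ENNReal.continuous_ofReal.tendsto _).comp (hlim τ)) fun n => ?_
      refine (hτ.val_le_dim Φ (Q n).inn_mem (Q n).inn_nonneg (Q n).norm_inn_le).trans ?_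
      rw [← hτ.dim_smul Φ (Q n).inn_nonneg (c := (1 / 2 : ℝ) ^ n) (by positivity)]
      exact hτ.dim_mono Φ (hterm n) (le_of_hasSum hterm hsum n)
  have hκpos : IsAffPos κ := by
    refine ⟨hκaff, ?_⟩
    by_cases hyz : y = 0
    · right
      funext τ
      have h1 := hdy τ
      rw [hyz, τ.isQuasitrace.dim_zero] at h1
      exact le_antisymm (ENNReal.ofReal_eq_zero.1 h1.symm) (hκ0 τ)
    · left
      intro τ hτ0
      obtain ⟨ε, hε, hne⟩ := exists_fE_ne_zero hy0 hyz
      have h1 := τ.isQuasitrace.val_pos Φ isAlgSimple_stab (DQT.toFun_ne_zero hτ0)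
        (fE_mem y hε) (fE_nonneg _ _) hne
      have h3 := τ.isQuasitrace.val_fE_le_dim Φ y hε
      rw [hdy τ, ENNReal.ofReal_le_ofReal_iff (hκ0 τ)] at h3
      exact h1.trans_le h3
  have hVsum := (summable_geometric_smul fun n =>
    norm_compr_le (e := e) (Q n).norm_out_le).hasSum
  -- Every outer element is a unit for every inner one, so each compression by `1 - outer` is
  -- orthogonal to all inner elements, hence to `y`.
  set V := ∑' n, ((1 / 2 : ℝ) ^ n) • compr e (Q n).out with hV
  have hVterm : ∀ n, 0 ≤ ((1 / 2 : ℝ) ^ n) • compr e (Q n).out := fun n =>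
    smul_nonneg (by positivity) (compr_nonneg he (Q n).out_nonneg)
  have hV0 : 0 ≤ V := hVsum.nonneg hVterm
  have hD0 : InHer e (Q 0).out := by
    obtain ⟨c, hc⟩ := exists_cof_eq_mul (Q 0).s_pos (Q 0).s_le (Q 0).F_sa
    rw [UnitPair.out, hc, hQ0]
    exact (InHer.of_unit he hγ hγζ).mul_right c
  have hD : ∀ n, InHer e (Q n).out := fun n => by
    rcases n.eq_zero_or_pos with rfl | hn
    · exact hD0
    · rw [← UnitPair.out_chain hout hn]; exact hD0.mul_right _
  refine ⟨y, V, κ, hy0, hV0, InHer.of_hasSum (fun n => InHer.smul _ ?_) hsum,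
    InHer.of_hasSum (fun n => InHer.smul _ (InHer.compr he (hD n))) hVsum, ?_, hκpos,
    fun τ => ⟨hdy τ, ?_, ?_, ?_⟩⟩
  · rw [← hDa n n]; exact (hD n).mul_right _
  · have h1 : ∀ n, (Q n).inn * V = 0 := fun n => by
      have h3 := hVsum.mul_left (Q n).inn
      refine h3.unique ?_
      convert hasSum_zero with m
      rw [mul_smul_comm, mul_compr_eq_zero (haD m n), smul_zero]
    refine (hsum.mul_right V).unique ?_
    convert hasSum_zero with n
    rw [smul_mul_assoc, h1, smul_zero]
  · exact (hκD τ 0).trans (by rw [hQ0]; exact hPout τ)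
  · have h1 := hPinn τ
    have h3 := haκ τ 0
    rw [hQ0] at h3
    linarith
  · have hτ := τ.isQuasitrace
    -- The outer element `n` is a unit for the outer element `n + 1`, and `V` dominates a multiple
    -- of the compression by the latter. Letting `n → ∞` replaces the outer value by `κ`.
    have h1 : ∀ n : ℕ, dim τ.toFun e ≤
        ENNReal.ofReal (κ τ + (9 / 10 : ℝ) ^ n * (η * val τ.toFun f)) + dim τ.toFun V := fun n => by
      refine (hτ.dim_le_add_compr Φ he (Q (n + 1)).out_nonneg (Q n).out_nonneg (Q n).norm_out_le
        (Q n).out_mem (hout n)).trans (add_le_add (ENNReal.ofReal_le_ofReal ?_) ?_)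
      · have h3 := hgap n τ
        have h4 := haκ τ n
        rw [mul_assoc] at h3
        linarith
      · rw [← hτ.dim_smul Φ (compr_nonneg he (Q (n + 1)).out_nonneg)
          (c := (1 / 2 : ℝ) ^ (n + 1)) (by positivity)]
        exact hτ.dim_mono Φ (hVterm _) (le_of_hasSum hVterm hVsum _)
    have h3 : Tendsto (fun n : ℕ => ENNReal.ofReal (κ τ + (9 / 10 : ℝ) ^ n * (η * val τ.toFun f)) +
        dim τ.toFun V) atTop (𝓝 (ENNReal.ofReal (κ τ + 0 * (η * val τ.toFun f)) +
        dim τ.toFun V)) := by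
      refine Tendsto.add ((ENNReal.continuous_ofReal.tendsto _).comp (tendsto_const_nhds.add
        ((tendsto_pow_atTop_nhds_zero_of_lt_one (by norm_num) (by norm_num)).mul_const _)))
        tendsto_const_nhds
    rw [zero_mul, add_zero] at h3
    rw [hdy τ]
    exact ge_of_tendsto' h3 h1

end Splitting

/-! ### Countable orthogonal sums, and the exhaustion of `h` below `e`. -/

section General

variable {B : Type*} [NonUnitalCStarAlgebra B] [PartialOrder B] [StarOrderedRing B]

lemma IsQuasitrace.dim_sum_of_orthogonal {τ : Ped B → ℂ} (hτ : IsQuasitrace τ)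
    (Φ : IsometryPair B) {z : ℕ → B} (h0 : ∀ n, 0 ≤ z n) (hz : ∀ m n, m ≠ n → z m * z n = 0)
    (n : ℕ) : dim τ (∑ i ∈ Finset.range n, z i) = ∑ i ∈ Finset.range n, dim τ (z i) := by
  induction n with
  | zero => simpa using hτ.dim_zero
  | succ n ih =>
    rw [Finset.sum_range_succ, Finset.sum_range_succ, ← ih]
    refine hτ.dim_add_of_orthogonal Φ (Finset.sum_nonneg fun i _ => h0 i) (h0 n) ?_
    rw [Finset.sum_mul]
    exact Finset.sum_eq_zero fun i hi => hz i n (Finset.mem_range.1 hi).ne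

/-- The dimension function is countably additive on orthogonal sums. -/
lemma IsQuasitrace.dim_hasSum {τ : Ped B → ℂ} (hτ : IsQuasitrace τ) (Φ : IsometryPair B)
    {z : ℕ → B} {y : B} (h0 : ∀ n, 0 ≤ z n) (hz : ∀ m n, m ≠ n → z m * z n = 0)
    (hy : HasSum z y) : dim τ y = ∑' n, dim τ (z n) := by
  refine le_antisymm ?_ ?_
  · refine hτ.dim_le_of_tendsto Φ (hy.nonneg h0) (fun n => Finset.sum_nonneg fun i _ => h0 i)
      hy.tendsto_sum_nat fun n => ?_
    rw [hτ.dim_sum_of_orthogonal Φ h0 hz]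
    exact ENNReal.sum_le_tsum _
  · rw [ENNReal.tsum_eq_iSup_nat]
    refine iSup_le fun n => ?_
    rw [← hτ.dim_sum_of_orthogonal Φ h0 hz]
    exact hτ.dim_mono Φ (Finset.sum_nonneg fun i _ => h0 i) (sum_le_hasSum _ (fun i _ => h0 i) hy)

lemma exists_smul_norm_lt (y : B) {ε : ℝ} (hε : 0 < ε) : ∃ c : ℝ, 0 < c ∧ ‖c • y‖ < ε := by
  refine ⟨ε / (‖y‖ + 1), by positivity, ?_⟩
  rw [norm_smul, Real.norm_of_nonneg (by positivity), div_mul_eq_mul_div,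
    div_lt_iff₀ (by positivity)]
  nlinarith [norm_nonneg y]

end General

section Orthogonal

variable {A : Type u} [NonUnitalCStarAlgebra A] [PartialOrder A] [StarOrderedRing A]

lemma IsLAffPos.map_zero {h : DQT A → ℝ≥0∞} (hh : IsLAffPos h) : h 0 = 0 := by
  obtain ⟨g, hg, -, hlim⟩ := hh
  refine tendsto_nhds_unique (hlim 0) ?_
  simp [(hg _).1.map_zero]

lemma IsAff.zero : IsAff fun _ : DQT A => (0 : ℝ) :=
  ⟨continuous_const, fun _ _ => (mul_zero _).symm, fun _ _ => (add_zero _).symm⟩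

variable [IsSimpleRing A]

/-- The inductive step of `RealizesAff.exists_orthogonal_of_pos`. -/
lemma RealizesAff.exists_next (h2 : RealizesAff A) {f : Stab A} (hf : IsScale f) {V : Stab A}
    (hV : 0 ≤ V) {d h : DQT A → ℝ≥0∞} (hhd : ∀ τ : DQT A, τ ≠ 0 → h τ < d τ)
    {σ t : DQT A → ℝ} (hσ : IsAff σ) (hσ0 : ∀ τ, 0 ≤ σ τ) (ht : IsAff t)
    (hσt : ∀ τ : DQT A, τ ≠ 0 → σ τ < t τ) (hth : ∀ τ, ENNReal.ofReal (t τ) ≤ h τ)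
    (hd : ∀ τ : DQT A, d τ ≤ ENNReal.ofReal (σ τ) + dim τ.toFun V) {η : ℝ} (hη : 0 < η) :
    ∃ (y V' : Stab A) (κ : DQT A → ℝ), 0 ≤ y ∧ 0 ≤ V' ∧ InHer V y ∧ InHer V V' ∧ y * V' = 0 ∧
      IsAff κ ∧ ∀ τ : DQT A, 0 ≤ κ τ ∧ dim τ.toFun y = ENNReal.ofReal (κ τ) ∧
        σ τ + κ τ ≤ t τ ∧ t τ ≤ σ τ + κ τ + η * val τ.toFun f ∧
        d τ ≤ ENNReal.ofReal (σ τ + κ τ) + dim τ.toFun V' := by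
  have hpos : IsAffPos fun τ => t τ - σ τ := ⟨ht.sub hσ, .inl fun τ hτ => sub_pos.2 (hσt τ hτ)⟩
  -- If this failed at `τ`, then `d(τ) ≤ σ + (t - σ) = t ≤ h(τ)`, contrary to `h < d`.
  have hlt : ∀ τ : DQT A, τ ≠ 0 → ENNReal.ofReal (t τ - σ τ) < dim τ.toFun V := fun τ hτ => by
    by_contra! hcon
    refine (hhd τ hτ).not_ge (le_trans ?_ (hth τ))
    refine (hd τ).trans ((add_le_add_right hcon _).trans_eq ?_)
    rw [← ENNReal.ofReal_add (hσ0 τ) (hpos.nonneg τ), add_sub_cancel]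
  obtain ⟨y, V', κ, hy, hV', hVy, hVV', hyV', hκ, hall⟩ := h2.exists_split hf hV hpos hlt hη
  refine ⟨y, V', κ, hy, hV', hVy, hVV', hyV', hκ.1, fun τ => ?_⟩
  obtain ⟨a1, a2, a3, a4⟩ := hall τ
  refine ⟨hκ.nonneg τ, a1, by linarith, by linarith, (hd τ).trans ?_⟩
  rw [ENNReal.ofReal_add (hσ0 τ) (hκ.nonneg τ), add_assoc, ← a1]
  exact add_le_add_right a4 _

lemma RealizesAff.exists_orthogonal_of_pos (h2 : RealizesAff A) {f : Stab A} (hf : IsScale f)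
    {e : Stab A} (he : 0 ≤ e) {h : DQT A → ℝ≥0∞} (h0 : h 0 = 0)
    (hhe : ∀ τ : DQT A, τ ≠ 0 → h τ < dim τ.toFun e) {g : ℕ → DQT A → ℝ} (hg : ∀ n, IsAff (g n))
    (hgpos : ∀ n (τ : DQT A), τ ≠ 0 → 0 < g n τ) (hgmono : ∀ n τ, g n τ ≤ g (n + 1) τ)
    (hlim : ∀ τ, Tendsto (fun n => ENNReal.ofReal (g n τ)) atTop (𝓝 (h τ))) :
    ∃ (y : ℕ → Stab A) (κ : ℕ → DQT A → ℝ), (∀ n, 0 ≤ y n) ∧ (∀ n, InHer e (y n)) ∧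
      (∀ m n, m ≠ n → y m * y n = 0) ∧ (∀ n, IsAff (κ n)) ∧ (∀ n τ, 0 ≤ κ n τ) ∧
      (∀ n (τ : DQT A), dim τ.toFun (y n) = ENNReal.ofReal (κ n τ)) ∧
      ∀ τ : DQT A, ∑' n, dim τ.toFun (y n) = h τ := by
  let Φ := Stab.isometryPair A
  have hg0 : ∀ n τ, 0 ≤ g n τ := fun n τ =>
    IsAffPos.nonneg ⟨hg n, .inl (hgpos n)⟩ τ
  have hgh : ∀ n τ, ENNReal.ofReal (g n τ) ≤ h τ := fun n τ =>
    (monotone_nat_of_le_succ fun n => ENNReal.ofReal_le_ofReal (hgmono n τ)).ge_of_tendsto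
      (hlim τ) n
  -- The factors increase strictly to 1. So the amount already used, at most `c n * g n`, is
  -- strictly below the next target `c (n + 1) * g (n + 1)` even where `g` is constant in `n`.
  let c : ℕ → ℝ := fun n => 1 - (1 / 2) ^ (n + 1)
  have hc1 : ∀ n, c n < 1 := fun n => sub_lt_self _ (by positivity)
  have hc0 : ∀ n, 0 < c n := fun n => sub_pos.2 (pow_lt_one₀ (by norm_num) (by norm_num) (by omega))
  have hcs : ∀ n, c n < c (n + 1) := fun n => sub_lt_sub_left
    (pow_lt_pow_right_of_lt_one₀ (by norm_num) (by norm_num) (by omega)) _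
  -- A state consists of the remaining room `V` below `e` and the total dimension `σ` used so far;
  -- the last condition says that `V` still carries the rest of `d(e)`.
  let St : ℕ → Type u := fun n => {p : Stab A × (DQT A → ℝ) // 0 ≤ p.1 ∧ InHer e p.1 ∧ IsAff p.2 ∧
    (∀ τ, 0 ≤ p.2 τ) ∧ (∀ τ : DQT A, τ ≠ 0 → p.2 τ < c n * g n τ) ∧
    ∀ τ : DQT A, dim τ.toFun e ≤ ENNReal.ofReal (p.2 τ) + dim τ.toFun p.1}
  have step : ∀ n (S : St n), ∃ (S' : St (n + 1)) (y : Stab A) (κ : DQT A → ℝ), 0 ≤ y ∧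
      InHer S.1.1 y ∧ InHer S.1.1 S'.1.1 ∧ y * S'.1.1 = 0 ∧ IsAff κ ∧
      (∀ τ, S'.1.2 τ = S.1.2 τ + κ τ) ∧ ∀ τ : DQT A, 0 ≤ κ τ ∧
      dim τ.toFun y = ENNReal.ofReal (κ τ) ∧ S'.1.2 τ ≤ c n * g n τ ∧
      c n * g n τ ≤ S'.1.2 τ + (1 / 2) ^ n * val τ.toFun f := by
    rintro n ⟨⟨V, σ⟩, hV, heV, hσ, hσ0, hσg, hd⟩
    obtain ⟨y, V', κ, hy, hV', hVy, hVV', hyV', hκ, hall⟩ := h2.exists_next hf hV hhe hσ hσ0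
      ((hg n).const_mul (c n)) hσg (fun τ => (ENNReal.ofReal_le_ofReal
        (mul_le_of_le_one_left (hg0 n τ) (hc1 n).le)).trans (hgh n τ)) hd
      (η := (1 / 2) ^ n) (by positivity)
    refine ⟨⟨⟨V', fun τ => σ τ + κ τ⟩, hV', heV.trans hV hVV', hσ.add hκ,
      fun τ => add_nonneg (hσ0 τ) (hall τ).1, fun τ hτ => ?_, fun τ => (hall τ).2.2.2.2⟩, y, κ,
      hy, hVy, hVV', hyV', hκ, fun τ => rfl, fun τ => ⟨(hall τ).1, (hall τ).2.1, (hall τ).2.2.1,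
        (hall τ).2.2.2.1⟩⟩
    refine (hall τ).2.2.1.trans_lt ?_
    calc c n * g n τ < c (n + 1) * g n τ := mul_lt_mul_of_pos_right (hcs n) (hgpos n τ hτ)
      _ ≤ c (n + 1) * g (n + 1) τ := mul_le_mul_of_nonneg_left (hgmono n τ) (hc0 _).le
  choose N y κ hy hVy hVV hyV hκ hσ hall using step
  let S : (n : ℕ) → St n := fun n => Nat.rec ⟨⟨e, fun _ => 0⟩, he, InHer.self he, IsAff.zero,
    fun _ => le_rfl, fun τ hτ => mul_pos (hc0 0) (hgpos 0 τ hτ), fun τ => by simp⟩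
    (fun n R => N n R) n
  have hchain : ∀ m n, m ≤ n → InHer (S m).1.1 (S n).1.1 := fun m n hmn => by
    induction n, hmn using Nat.le_induction with
    | base => exact InHer.self (S m).2.1
    | succ n hn ih => exact ih.trans (S n).2.1 (hVV n (S n))
  -- The `m`-th element is orthogonal to the room left after it, and all later elements lie in that
  -- room.
  have horth : ∀ m n, m < n → y m (S m) * y n (S n) = 0 := fun m n hmn =>
    InHer.mul_eq_zero (S (m + 1)).2.1
      ((hchain (m + 1) n hmn).trans (S n).2.1 (hVy n (S n))) (hyV m (S m))
  have hsum : ∀ (τ : DQT A) n, ∑ i ∈ Finset.range n, dim τ.toFun (y i (S i)) =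
      ENNReal.ofReal ((S n).1.2 τ) := fun τ n => by
    induction n with
    | zero => simp [S]
    | succ n ih =>
      rw [Finset.sum_range_succ, ih, (hall n (S n) τ).2.1,
        ← ENNReal.ofReal_add ((S n).2.2.2.2.1 τ) (hall n (S n) τ).1]
      exact congrArg ENNReal.ofReal (hσ n (S n) τ).symm
  refine ⟨fun n => y n (S n), fun n => κ n (S n), fun n => hy n (S n),
    fun n => (S n).2.2.1.trans (S n).2.1 (hVy n (S n)), fun m n hmn => ?_, fun n => hκ n (S n),
    fun n τ => (hall n (S n) τ).1, fun n τ => (hall n (S n) τ).2.1, fun τ => ?_⟩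
  · rcases hmn.lt_or_gt with h | h
    · exact horth m n h
    · exact mul_eq_zero_symm (hy n (S n)) (hy m (S m)) (horth n m h)
  · have hfin : h τ ≠ ∞ := by
      by_cases hτ : τ = 0
      · rw [hτ, h0]; exact ENNReal.zero_ne_top
      · exact (hhe τ hτ).ne_top
    have hgl : Tendsto (fun n => g n τ) atTop (𝓝 (h τ).toReal) := by
      have := (ENNReal.tendsto_toReal hfin).comp (hlim τ)
      refine this.congr fun n => ?_
      exact ENNReal.toReal_ofReal (hg0 n τ)
    have hp : Tendsto (fun n : ℕ => (1 / 2 : ℝ) ^ n) atTop (𝓝 0) :=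
      tendsto_pow_atTop_nhds_zero_of_lt_one (by norm_num) (by norm_num)
    have hcl : Tendsto (fun n => c n * g n τ) atTop (𝓝 (h τ).toReal) := by
      have h3 : Tendsto c atTop (𝓝 (1 - 0)) :=
        tendsto_const_nhds.sub ((tendsto_add_atTop_iff_nat 1).2 hp)
      simpa using h3.mul hgl
    -- `σ` is squeezed between `c n * g n - 2⁻ⁿ τ(f)` and `c n * g n`.
    have hσl : Tendsto (fun n => (S (n + 1)).1.2 τ) atTop (𝓝 (h τ).toReal) := by
      have h3 := hcl.sub (hp.mul_const (val τ.toFun f))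
      rw [zero_mul, sub_zero] at h3
      refine tendsto_of_tendsto_of_tendsto_of_le_of_le h3 hcl (fun n => ?_) fun n => ?_
      · have h4 : c n * g n τ ≤ (S (n + 1)).1.2 τ + (1 / 2) ^ n * val τ.toFun f :=
          (hall n (S n) τ).2.2.2
        simp only
        linarith
      · exact (hall n (S n) τ).2.2.1
    have h4 := (ENNReal.continuous_ofReal.tendsto _).comp hσl
    rw [ENNReal.ofReal_toReal hfin] at h4
    refine tendsto_nhds_unique (ENNReal.tendsto_nat_tsum _) ?_
    refine (tendsto_add_atTop_iff_nat 1).1 ?_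
    refine h4.congr fun n => ?_
    exact (hsum τ (n + 1)).symm

/-- Functions in `LAff_+` below `d(e)` are realized by orthogonal sequences of elements below `e`
with continuous dimension functions. -/
lemma RealizesAff.exists_orthogonal (h2 : RealizesAff A) {f : Stab A} (hf : IsScale f)
    {e : Stab A} (he : 0 ≤ e) {h : DQT A → ℝ≥0∞} (hh : IsLAffPos h)
    (hhe : ∀ τ : DQT A, τ ≠ 0 → h τ < dim τ.toFun e) :
    ∃ (z : ℕ → Stab A) (κ : ℕ → DQT A → ℝ), (∀ n, 0 ≤ z n) ∧ (∀ n, InHer e (z n)) ∧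
      (∀ m n, m ≠ n → z m * z n = 0) ∧ (∀ n, IsAff (κ n)) ∧ (∀ n τ, 0 ≤ κ n τ) ∧
      (∀ n (τ : DQT A), dim τ.toFun (z n) = ENNReal.ofReal (κ n τ)) ∧
      (∀ τ : DQT A, ∑' n, dim τ.toFun (z n) = h τ) ∧ ∀ n, ‖z n‖ < 1 / 2 ^ (n + 1) := by
  let Φ := Stab.isometryPair A
  have h0 := hh.map_zero
  obtain ⟨g, hg, hgmono, hlim⟩ := hh
  by_cases hex : ∃ N, ∀ τ : DQT A, τ ≠ 0 → 0 < g N τ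
  -- The sequence may begin with zero functions; once it is strictly positive it stays so, and the
  -- initial part is dropped.
  · obtain ⟨N, hN⟩ := hex
    have hpos : ∀ n (τ : DQT A), τ ≠ 0 → 0 < g (n + N) τ := fun n τ hτ =>
      (hN τ hτ).trans_le (monotone_nat_of_le_succ (fun n => hgmono n τ) (Nat.le_add_left N n))
    obtain ⟨y, κ, hy, hey, horth, hκ, hκ0, hd, hsum⟩ := h2.exists_orthogonal_of_pos hf he h0 hhe
      (g := fun n => g (n + N)) (fun n => (hg _).1) hpos
      (fun n τ => by rw [Nat.add_right_comm]; exact hgmono _ τ)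
      (fun τ => (tendsto_add_atTop_iff_nat N).2 (hlim τ))
    choose c hc0 hc using fun n => exists_smul_norm_lt (y n)
      (show (0 : ℝ) < 1 / 2 ^ (n + 1) by positivity)
    have hdim : ∀ n (τ : DQT A), dim τ.toFun (c n • y n) = dim τ.toFun (y n) := fun n τ =>
      τ.isQuasitrace.dim_smul Φ (hy n) (hc0 n)
    exact ⟨fun n => c n • y n, κ, fun n => smul_nonneg (hc0 n).le (hy n),
      fun n => (hey n).smul _, fun m n hmn => by
        rw [smul_mul_smul_comm, horth m n hmn, smul_zero], hκ, hκ0,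
      fun n τ => (hdim n τ).trans (hd n τ), fun τ => by simp only [hdim, hsum], hc⟩
  · push Not at hex
    have hg0 : ∀ n τ, g n τ = 0 := fun n τ => by
      rcases (hg n).2 with h | h
      · obtain ⟨τ', hτ', hle⟩ := hex n
        exact absurd (h τ' hτ') hle.not_gt
      · rw [h]; rfl
    refine ⟨fun _ => 0, fun _ _ => 0, fun _ => le_rfl, fun _ => InHer.zero e, by simp,
      fun _ => IsAff.zero, fun _ _ => le_rfl, fun n τ => by simp [τ.isQuasitrace.dim_zero],
      fun τ => ?_, fun n => by simp⟩
    simp only [τ.isQuasitrace.dim_zero, tsum_zero]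
    refine tendsto_nhds_unique ?_ (hlim τ)
    simp [hg0]

/-- Continuity of the dimension function implies that the tracial oscillation vanishes. -/
lemma omega_eq_zero {f : Stab A} (hf : IsScale f)
    (hfQ : ∀ τ ∈ closure (QT A), val τ.toFun f ≤ 1) {z : Stab A} {κ : DQT A → ℝ} (hκ : IsAff κ)
    (hz : ∀ τ : DQT A, dim τ.toFun z = ENNReal.ofReal (κ τ)) : omega z = 0 := by
  let Φ := Stab.isometryPair A
  refine le_antisymm (le_of_forall_pos_le_add fun ε hε => ?_) zero_le
  rw [zero_add]
  rcases eq_or_ne ε ∞ with rfl | hεt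
  · exact le_top
  have hε' : 0 < ε.toReal := ENNReal.toReal_pos hε.ne' hεt
  -- Dini applied to `d(z) = κ` gives an error `ε τ(f)`, which is at most `ε` on the closure of
  -- `QT`.
  obtain ⟨δ, hδ, hδ'⟩ := exists_le_val_fE hf hκ (fun τ => (hz τ).ge) hε'
  obtain ⟨n, hn⟩ := exists_nat_one_div_lt hδ
  refine (iInf_le _ n).trans (iSup₂_le fun τ hτ => ?_)
  rw [tsub_le_iff_left, DQT.d_eq_dim, DQT.cut_eq_val, hz, ← ENNReal.ofReal_toReal hεt,
    ← ENNReal.ofReal_add (τ.isQuasitrace.val_nonneg Φ (fE_mem z Nat.one_div_pos_of_nat)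
      (fE_nonneg _ _)) hε'.le]
  refine ENNReal.ofReal_le_ofReal ((hδ' _ Nat.one_div_pos_of_nat hn.le τ).trans ?_)
  have := mul_le_mul_of_nonneg_left (hfQ τ hτ) hε'.le
  linarith

variable (A) in
-- The scale is taken in the corner, as a cut-off of an element of `A`. It is then a contraction in
-- `Ped A`, so the normalization of `QT` bounds its values by 1, and this bound is closed.
lemma exists_scale : ∃ f : Stab A, IsScale f ∧ ∀ τ ∈ closure (QT A), val τ.toFun f ≤ 1 := by
  obtain ⟨a, ha⟩ : ∃ a : A, a ≠ 0 := by
    by_contra! hcon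
    refine (bot_ne_top : (⊥ : TwoSidedIdeal A) ≠ ⊤) (SetLike.ext fun x => ?_)
    rw [hcon x]
    exact ⟨fun _ => trivial, fun _ => zero_mem _⟩
  set b := star a * a with hb
  have hb0 : 0 ≤ b := star_mul_self_nonneg a
  have hbne : b ≠ 0 := fun h => ha ((CStarRing.star_mul_self_eq_zero_iff a).1 h)
  obtain ⟨ε, hε, hne⟩ := exists_fE_ne_zero hb0 hbne
  have hmap : ∀ δ : ℝ, Stab.corner (cfcₙ (fEps δ) b) = cfcₙ (fEps δ) (Stab.corner b) := fun δ =>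
    NonUnitalStarAlgHomClass.map_cfcₙ Stab.corner (fEps δ) b
      (continuous_fEps _).continuousOn (fEps_zero _)
      (AddMonoidHomClass.continuous_of_bound Stab.corner 1 fun x => by
        simpa using NonUnitalStarAlgHom.norm_apply_le Stab.corner x)
      hb0.isSelfAdjoint (hb0.isSelfAdjoint.map Stab.corner)
  have hne' : cfcₙ (fEps ε) (Stab.corner b) ≠ 0 := by
    rw [← hmap]
    exact fun h => hne (Stab.corner_injective (h.trans (map_zero Stab.corner).symm))
  refine ⟨_, isScale_fE hε hne', fun τ hτ => ?_⟩
  have hcl : IsClosed {τ : DQT A | val τ.toFun (cfcₙ (fEps (ε / 2)) (Stab.corner b)) ≤ 1} :=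
    isClosed_le (DQT.continuous_val _) continuous_const
  refine closure_minimal (fun σ hσ => ?_) hcl hτ
  have hm : cfcₙ (fEps (ε / 2)) b ∈ Ped A := fE_mem b (half_pos hε)
  have h1 : (σ ⟨Stab.corner (cfcₙ (fEps (ε / 2)) b), corner_mem_ped hm⟩).re ≤ 1 :=
    hσ.1 ⟨_, hm, fE_nonneg _ _, norm_fE_le_one _ _, rfl⟩
  rw [Set.mem_ofPred_eq, ← hmap, val_of_mem _ (corner_mem_ped hm)]
  exact h1

end Orthogonal

end TracialCuntz

/-! ### The equivalence. -/

theorem mainTheorem5 {A : Type*} [NonUnitalCStarAlgebra A] [PartialOrder A] [StarOrderedRing A]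
    [IsSimpleRing A] (hQT : (QT A).Nonempty) :
    List.TFAE [
      GammaHereditarySurjective A,
      ∀ e : Stab A, 0 ≤ e → ∀ h : DQT A → ℝ, IsAffPos h →
        (∀ τ : DQT A, τ ≠ 0 → ENNReal.ofReal (h τ) < τ.d e) →
        ∃ y : Stab A, 0 ≤ y ∧ CuntzLE y e ∧ ∀ τ : DQT A, τ.d y = ENNReal.ofReal (h τ),
      ∀ e : Stab A, 0 ≤ e → ∀ h : DQT A → ℝ≥0∞, IsLAffPos h →
        (∀ τ : DQT A, τ ≠ 0 → h τ < τ.d e) →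
        (∃ y : Stab A, 0 ≤ y ∧ CuntzLE y e ∧ (∀ τ : DQT A, τ.d y = h τ) ∧
          ∃ z : ℕ → Stab A, (∀ n, 0 ≤ z n) ∧ (∀ m n, m ≠ n → z m * z n = 0) ∧
            (∀ n, omega (z n) = 0 ∧ ‖z n‖ < 1 / 2 ^ (n + 1)) ∧ HasSum z y) ∧
        ∀ ε : ℝ, 0 < ε →
          ∃ b : ℕ → Stab A, (∀ n, b n ∈ Her e ∧ 0 ≤ b n) ∧ (∀ m n, m ≠ n → b m * b n = 0) ∧
            (∀ n, omega (b n) < ENNReal.ofReal (ε / 2 ^ (n + 1))) ∧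
            ∀ τ ∈ closure (QT A),
              h τ < (∑' n, τ.d (b n)) + ENNReal.ofReal ε ∧
              (∑' n, τ.d (b n)) < h τ + ENNReal.ofReal ε] := by
  tfae_have 3 → 1 := fun H a ha f hf hfa => by
    obtain ⟨⟨y, hy, hya, hyd, -⟩, -⟩ := H a ha f hf hfa
    exact ⟨y, hy, hya, hyd⟩
  tfae_have 1 → 2 := fun H e he h hh hhe =>
    H e he (fun τ => ENNReal.ofReal (h τ))
      ⟨fun _ => h, fun _ => hh, fun _ _ => le_rfl, fun _ => tendsto_const_nhds⟩ hhe
  tfae_have 2 → 3 := fun H e he h hh hhe => by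
    have h2 : RealizesAff A := H
    obtain ⟨f, hf, hfQ⟩ := exists_scale A
    obtain ⟨z, κ, hz, hez, horth, hκ, hκ0, hd, hsum, hnorm⟩ :=
      h2.exists_orthogonal hf he hh fun τ hτ => by rw [← DQT.d_eq_dim]; exact hhe τ hτ
    have homega : ∀ n, omega (z n) = 0 := fun n => omega_eq_zero hf hfQ (hκ n) (hd n)
    have hsum' : ∀ τ : DQT A, ∑' n, τ.d (z n) = h τ := fun τ => by
      simp only [DQT.d_eq_dim, hsum]
    constructor
    · have hs : Summable z := by
        refine Summable.of_norm_bounded (g := fun n => (1 / 2 : ℝ) ^ (n + 1))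
          ((summable_nat_add_iff 1).2
            (summable_geometric_of_lt_one (by norm_num) (by norm_num))) fun n => ?_
        rw [one_div_pow]
        exact (hnorm n).le
      have hy := hs.hasSum
      refine ⟨∑' n, z n, hy.nonneg hz, (InHer.of_hasSum hez hy).cuntzLE he (hy.nonneg hz),
        fun τ => ?_, z, hz, horth, fun n => ⟨homega n, hnorm n⟩, hy⟩
      rw [DQT.d_eq_dim, τ.isQuasitrace.dim_hasSum (Stab.isometryPair A) hz horth hy, hsum τ]
    · intro ε hε
      -- The same sequence serves for every `ε`: its oscillations vanish and its dimensions sum to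
      -- `h` exactly. Finiteness of `h`, forced by `h < d(e)`, makes the inequalities in `[0, ∞]`
      -- strict.
      refine ⟨z, fun n => ⟨(hez n).mem_her (hz n), hz n⟩, horth, fun n => ?_, fun τ _ => ?_⟩
      · rw [homega n]
        exact ENNReal.ofReal_pos.2 (by positivity)
      · have hfin : h τ ≠ ∞ := by
          by_cases hτ : τ = 0
          · rw [hτ, hh.map_zero]; exact ENNReal.zero_ne_top
          · exact (hhe τ hτ).ne_top
        rw [hsum' τ]
        have := ENNReal.lt_add_right hfin (ENNReal.ofReal_pos.2 hε).ne'
        exact ⟨this, this⟩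
  tfae_finish
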